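/- For a character $\chi:\mathbb R^*\to\mathbb R^*$ and an $r$-dimensional real vector space $V$ with space of frames $\mathrm{Fr}(V)=\mathrm{Isom}(\mathbb R^r,V)$, let $L_\chi(V)$ be the line of functions $\xi:\mathrm{Fr}(V)\to\mathbb R$ with $\xi(e\cdot A)=\chi(\det A)\,\xi(e)$ for all $A\in GL_r$. The cases $\chi=|\cdot|$, $\chi=\mathrm{id}$, $\chi=\mathrm{sign}$ give the densities $\mathcal D_V$, the volume elements $\mathcal V_V=\Lambda^{\mathrm{top}}V^*$ and the orientation line $\mathfrak o_V$. Pointwise multiplication gives $L_\chi(V)\otimes L_\psi(V)\cong L_{\chi\psi}(V)$, the pairing $(\eta,\xi)\mapsto\eta(e^*)\,\xi(e)$ (for any frame $e$, with dual frame $e^*$) gives $L_\chi(V^*)\cong L_\chi(V)^*$, and a short exact sequence $0\to V\to U\to W\to 0$ induces $L_\chi(U)\cong L_\chi(V)\otimes L_\chi(W)$. Let $\mathcal G$ be a (finite-dimensional) Lie groupoid over $M$ with source $s$, target $t$ and Lie algebroid $A$ ($A_x=\ker d_{1_x}s$), with all $s$-fibres of the same dimension $r$. Put $L_\chi^{\mathrm{tr}}=L_\chi(A^*)\otimes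 L_\chi(TM)$, a smooth line bundle over $M$; thus one has $\mathcal D_A^{\mathrm{tr}}$, $\mathcal V_A^{\mathrm{tr}}$ and $\mathfrak o_A^{\mathrm{tr}}$. For an arrow $g:x\to y$, right translation by $g$ and $ds$ give a short exact sequence $0\to A_y\to T_g\mathcal G\to T_xM\to 0$. These sequences at $g$ and at $g^{-1}$ and the differential of the inversion $T_g\mathcal G\cong T_{g^{-1}}\mathcal G$ induce $$L_\chi(A_y)\otimes L_\chi(T_xM)\cong L_\chi(T_g\mathcal G)\cong L_\chi(T_{g^{-1}}\mathcal G)\cong L_\chi(A_x)\otimes L_\chi(T_yM),$$ hence, by $L_\chi(A^*)\cong L_\chi(A)^*$, a linear map $g_\sharp: L^{\mathrm{tr}}_{\chi,x}\to L^{\mathrm{tr}}_{\chi,y}$. Let $g_*=\chi((-1)^r)\,g_\sharp$ (so $g_*=g_\sharp$ for densities). Then, for the actions $g\mapsto g_*$, the bundles $\mathcal D_A^{\mathrm{tr}}$, $\mathcal V_A^{\mathrm{tr}}$ and $\mathfrak o_A^{\mathrm{tr}}$ are (smooth) representations of $\mathcal G$, and the canonical isomorphisms of smooth line bundles $$\mathcal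 D_A^{\mathrm{tr}}\cong\mathcal V_A^{\mathrm{tr}}\otimes\mathfrak o_A^{\mathrm{tr}},\qquad \mathcal V_A^{\mathrm{tr}}\cong\mathcal D_A^{\mathrm{tr}}\otimes\mathfrak o_A^{\mathrm{tr}},\qquad \mathfrak o_A^{\mathrm{tr}}\otimes\mathfrak o_A^{\mathrm{tr}}\cong M\times\mathbb R,\qquad \mathfrak o_A^{\mathrm{tr}}\cong(\mathfrak o_A^{\mathrm{tr}})^*,$$ all induced by pointwise multiplication of functions of frames, are isomorphisms of representations of $\mathcal G$, where tensor products and duals carry the induced actions and $M\times\mathbb R$ the trivial action. The same four isomorphisms also commute with the maps induced by the $g_\sharp$ (the dual of $g_\sharp$ being $l\mapsto l\circ(g^{-1})_\sharp$). -/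

import Mathlib

open CategoryTheory Bundle Set TopologicalSpace
open scoped Manifold ContDiff TensorProduct Topology

noncomputable section

namespace TransverseBundles

section LinearAlgebra

/-- Frames of an `r`-dimensional real vector space `V`: linear isomorphisms `ℝ^r ≅ V`. -/
abbrev Frame (r : ℕ) (V : Type*) [AddCommGroup V] [Module ℝ V] := (Fin r → ℝ) ≃ₗ[ℝ] V

/-- The general linear group `GL_r`; its product is composition. -/
abbrev GLr (r : ℕ) := (Fin r → ℝ) ≃ₗ[ℝ] (Fin r → ℝ)

/-- `L_δ(V)`: the functions `ξ : Fr(V) → ℝ` with `ξ(e · A) = δ(A) ξ(e)`, where `e · A = e ∘ A`. -/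
def Line {r : ℕ} (δ : GLr r →* ℝˣ) (V : Type*) [AddCommGroup V] [Module ℝ V] :
    Submodule ℝ (Frame r V → ℝ) where
  carrier := {ξ | ∀ (e : Frame r V) (A : GLr r), ξ (A.trans e) = (δ A : ℝ) * ξ e}
  zero_mem' := by intro e A; simp
  add_mem' := by
    intro ξ η hξ hη e A
    simp [hξ e A, hη e A, mul_add]
  smul_mem' := by
    intro c ξ hξ e A
    simp [hξ e A, mul_left_comm]

/-- The character `χ ∘ det` of `GL_r` attached to a multiplicative map `χ` of `ℝ`. -/
def detChar (χ : ℝ →*₀ ℝ) (r : ℕ) : GLr r →* ℝˣ :=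
  (Units.map (χ : ℝ →* ℝ)).comp LinearEquiv.det

theorem detChar_apply (χ : ℝ →*₀ ℝ) {r : ℕ} (A : GLr r) :
    (detChar χ r A : ℝ) = χ (LinearEquiv.det A : ℝ) := rfl

/-- The identity, for which `χ ∘ det = det`. -/
abbrev idChar : ℝ →*₀ ℝ := MonoidWithZeroHom.id ℝ

/-- The sign, for which `χ ∘ det = sign ∘ det`. -/
def signChar : ℝ →*₀ ℝ where
  toFun a := (SignType.sign a : ℝ)
  map_zero' := by simp
  map_one' := by simp
  map_mul' a b := by simp [sign_mul]

/-- The absolute value, for which `χ ∘ det = |det|`. -/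
abbrev absChar : ℝ →*₀ ℝ := absHom

/-- A character of `ℝ^*` that is smooth. -/
class SmoothChar (χ : ℝ →*₀ ℝ) : Prop where
  contDiffOn : ContDiffOn ℝ ∞ χ {0}ᶜ

instance : SmoothChar idChar := ⟨contDiffOn_id⟩

instance : SmoothChar absChar := ⟨by
  intro x hx
  exact (contDiffAt_abs hx).contDiffWithinAt⟩

instance : SmoothChar signChar := ⟨by
  intro x hx
  refine ContDiffAt.contDiffWithinAt ?_
  rcases lt_or_gt_of_ne (show x ≠ 0 from hx) with h | h
  · refine (contDiffAt_const (c := (-1 : ℝ))).congr_of_eventuallyEq ?_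
    filter_upwards [Iio_mem_nhds h] with y hy
    simp [signChar, sign_neg (show y < 0 from hy)]
  · refine (contDiffAt_const (c := (1 : ℝ))).congr_of_eventuallyEq ?_
    filter_upwards [Ioi_mem_nhds h] with y hy
    simp [signChar, sign_pos (show 0 < y from hy)]⟩

instance : SmoothChar 1 := ⟨by
  intro x hx
  refine ContDiffAt.contDiffWithinAt ((contDiffAt_const (c := (1 : ℝ))).congr_of_eventuallyEq ?_)
  filter_upwards [isOpen_compl_singleton.mem_nhds hx] with y hy
  exact MonoidWithZeroHom.one_apply_of_ne_zero hy⟩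

variable {r m n : ℕ} {V W U : Type*} [AddCommGroup V] [Module ℝ V] [AddCommGroup W] [Module ℝ W]
  [AddCommGroup U] [Module ℝ U]

/-- Evaluation on a frame identifies `L_δ(V)` with `ℝ`. -/
def Line.eval (δ : GLr r →* ℝˣ) (e : Frame r V) : Line δ V ≃ₗ[ℝ] ℝ where
  toFun ξ := ξ.1 e
  map_add' _ _ := rfl
  map_smul' _ _ := rfl
  invFun c := ⟨fun e' => (δ (e'.trans e.symm) : ℝ) * c, by
    intro e' A
    have : (A.trans e').trans e.symm = (e'.trans e.symm) * A := rfl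
    simp only [this, map_mul, Units.val_mul]
    ring⟩
  left_inv ξ := by
    ext e'
    have h := ξ.2 e (e'.trans e.symm)
    have h2 : (e'.trans e.symm).trans e = e' := by ext; simp
    rw [h2] at h
    exact h.symm
  right_inv c := by
    have : e.trans e.symm = 1 := by ext; simp
    simp [this]

instance (δ : GLr r →* ℝˣ) : Module.Finite ℝ (Line δ V) := by
  rcases isEmpty_or_nonempty (Frame r V) with h | ⟨⟨e⟩⟩
  · have : Subsingleton (Line δ V) := ⟨fun ξ η => Subtype.ext (funext fun e => isEmptyElim e)⟩
    infer_instance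
  · exact Module.Finite.equiv (Line.eval δ e).symm

/-- Functoriality of `L_δ` for isomorphisms. -/
def Line.map (δ : GLr r →* ℝˣ) (f : V ≃ₗ[ℝ] W) : Line δ V ≃ₗ[ℝ] Line δ W where
  toFun ξ := ⟨fun e => ξ.1 (e.trans f.symm), fun e A => ξ.2 (e.trans f.symm) A⟩
  map_add' _ _ := rfl
  map_smul' _ _ := rfl
  invFun η := ⟨fun e => η.1 (e.trans f), fun e A => η.2 (e.trans f) A⟩
  left_inv ξ := by
    ext e
    show ξ.1 ((e.trans f).trans f.symm) = ξ.1 e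
    exact congrArg _ (by ext; simp)
  right_inv η := by
    ext e
    show η.1 ((e.trans f.symm).trans f) = η.1 e
    exact congrArg _ (by ext; simp)

/-- The dual frame of the dual space. -/
def dualFrame (e : Frame r V) : Frame r (Module.Dual ℝ V) :=
  (Pi.basisFun ℝ (Fin r)).toDualEquiv.trans e.symm.dualMap

theorem dualFrame_apply (e : Frame r V) (c : Fin r → ℝ) (v : V) :
    dualFrame e c v = ∑ i, c i * e.symm v i := by
  simp only [dualFrame, LinearEquiv.trans_apply, LinearEquiv.dualMap_apply,
    Module.Basis.toDualEquiv_apply]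
  simp [Module.Basis.toDual, Module.Basis.constr_apply_fintype]

/-- Pointwise multiplication `L_δ(V) ⊗ L_δ'(V) → L_δδ'(V)`. -/
def Line.mulMap {δ δ' δ'' : GLr r →* ℝˣ} (h : δ * δ' = δ'') :
    Line δ V ⊗[ℝ] Line δ' V →ₗ[ℝ] Line δ'' V :=
  TensorProduct.lift (LinearMap.mk₂ ℝ
    (fun ξ η => (⟨fun e => ξ.1 e * η.1 e, by
      intro e A
      simp only [ξ.2 e A, η.2 e A, ← h, MonoidHom.mul_apply, Units.val_mul]
      ring⟩ : Line δ'' V))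
    (by intros; ext; simp [add_mul]) (by intros; ext; simp [mul_assoc])
    (by intros; ext; simp [mul_add]) (by intros; ext; simp [mul_left_comm]))

theorem Line.mulMap_tmul {δ δ' δ'' : GLr r →* ℝˣ} (h : δ * δ' = δ'') (ξ : Line δ V)
    (η : Line δ' V) (e : Frame r V) : (Line.mulMap h (ξ ⊗ₜ η)).1 e = ξ.1 e * η.1 e := rfl

theorem Line.mulMap_bijective {δ δ' δ'' : GLr r →* ℝˣ} (h : δ * δ' = δ'')
    (hV : Nonempty (Frame r V)) : Function.Bijective (Line.mulMap (V := V) h) := by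
  obtain ⟨e⟩ := hV
  let T := TensorProduct.congr (Line.eval δ e) (Line.eval δ' e) ≪≫ₗ TensorProduct.lid ℝ ℝ
    ≪≫ₗ (Line.eval δ'' e).symm
  have : Line.mulMap (V := V) h = T.toLinearMap := by
    ext ξ η : 3
    apply (Line.eval δ'' e).injective
    simp [T]
    rfl
  rw [this]
  exact T.bijective

/-- The canonical isomorphism `L_δ(V) ⊗ L_δ'(V) ≅ L_δδ'(V)` given by pointwise multiplication. -/
def Line.mulIso {δ δ' δ'' : GLr r →* ℝˣ} (h : δ * δ' = δ'') (hV : Nonempty (Frame r V)) :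
    Line δ V ⊗[ℝ] Line δ' V ≃ₗ[ℝ] Line δ'' V :=
  LinearEquiv.ofBijective (Line.mulMap h) (Line.mulMap_bijective h hV)

/-- The canonical isomorphism of `L_1(V)` (the constant functions of frames) with `ℝ`. -/
def Line.constIso (hV : Nonempty (Frame r V)) : Line (1 : GLr r →* ℝˣ) V ≃ₗ[ℝ] ℝ :=
  Line.eval 1 hV.some

theorem Line.constIso_apply (hV : Nonempty (Frame r V)) (ξ : Line (1 : GLr r →* ℝˣ) V)
    (e : Frame r V) : Line.constIso hV ξ = ξ.1 e := by
  have h := ξ.2 e (hV.some.trans e.symm)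
  have h2 : (hV.some.trans e.symm).trans e = hV.some := by ext; simp
  rw [h2] at h
  exact h.trans (by simp)

theorem det_dualFrame (e e' : Frame r V) :
    LinearEquiv.det ((dualFrame e').trans (dualFrame e).symm) =
      LinearEquiv.det (e.trans e'.symm) := by
  have key : LinearMap.toMatrix' ((dualFrame e').trans (dualFrame e).symm).toLinearMap =
      (LinearMap.toMatrix' (e.trans e'.symm).toLinearMap).transpose := by
    ext j i
    have h : ∀ c, dualFrame e (((dualFrame e').trans (dualFrame e).symm) c) = dualFrame e' c := by
      intro c; simp
    have h1 := LinearMap.congr_fun (h (Pi.single i 1)) (e (Pi.single j 1))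
    rw [dualFrame_apply, dualFrame_apply] at h1
    simpa [LinearMap.toMatrix'_apply, Pi.single_apply] using h1
  ext
  rw [LinearEquiv.coe_det, LinearEquiv.coe_det, ← LinearMap.det_toMatrix', key,
    Matrix.det_transpose, LinearMap.det_toMatrix']

/-- The canonical isomorphism `L_χ(V^*) ≅ L_χ(V)^*`, given by `(η, ξ) ↦ η(e^*) ξ(e)`
for any frame `e`. -/
def Line.dualIso (χ : ℝ →*₀ ℝ) (hV : Nonempty (Frame r V)) :
    Line (detChar χ r) (Module.Dual ℝ V) ≃ₗ[ℝ] Module.Dual ℝ (Line (detChar χ r) V) :=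
  Line.eval _ (dualFrame hV.some) ≪≫ₗ (LinearMap.ringLmapEquivSelf ℝ ℝ ℝ).symm ≪≫ₗ
    (Line.eval _ hV.some).dualMap

theorem Line.eval_change (δ : GLr r →* ℝˣ) (ξ : Line δ V) (e e' : Frame r V) :
    ξ.1 e' = (δ (e'.trans e.symm) : ℝ) * ξ.1 e := by
  have h := ξ.2 e (e'.trans e.symm)
  rwa [show (e'.trans e.symm).trans e = e' by ext; simp] at h

theorem Line.dualIso_apply (χ : ℝ →*₀ ℝ) (hV : Nonempty (Frame r V))
    (η : Line (detChar χ r) (Module.Dual ℝ V)) (ξ : Line (detChar χ r) V) (e : Frame r V) :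
    Line.dualIso χ hV η ξ = η.1 (dualFrame e) * ξ.1 e := by
  have h1 := Line.eval_change _ ξ e hV.some
  have h2 := Line.eval_change _ η (dualFrame hV.some) (dualFrame e)
  have h3 : Line.dualIso χ hV η ξ = η.1 (dualFrame hV.some) * ξ.1 hV.some := by
    simp [Line.dualIso, Line.eval, mul_comm]
  rw [h3, h1, h2]
  simp only [detChar, MonoidHom.comp_apply, det_dualFrame]
  ring

/-- The sequence `0 → V → U → W → 0` given by `i` and `p` is exact. -/
structure ShortExact (i : V →ₗ[ℝ] U) (p : U →ₗ[ℝ] W) : Prop where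
  injective : Function.Injective i
  exact : Function.Exact i p
  surjective : Function.Surjective p

/-- `u` is a frame of the middle term of the sequence `i, p` that is adapted to the frames `e`
and `f` of the outer terms: it consists of the image of `e` followed by a lift of `f`. -/
def IsAdapted (i : V →ₗ[ℝ] U) (p : U →ₗ[ℝ] W) (e : Frame m V) (f : Frame n W)
    (u : Frame (m + n) U) : Prop :=
  (∀ c : Fin m → ℝ, u (Fin.append c 0) = i (e c)) ∧
    ∀ (c : Fin m → ℝ) (d : Fin n → ℝ), p (u (Fin.append c d)) = f d

theorem exists_isAdapted {i : V →ₗ[ℝ] U} {p : U →ₗ[ℝ] W} (h : ShortExact i p)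
    (e : Frame m V) (f : Frame n W) : ∃ u : Frame (m + n) U, IsAdapted i p e f u := by
  obtain ⟨hi, hip, hp⟩ := h
  obtain ⟨g, hg⟩ := LinearMap.exists_rightInverse_of_surjective p (LinearMap.range_eq_top.2 hp)
  have hg' : ∀ w, p (g w) = w := fun w => LinearMap.congr_fun hg w
  have hpi : ∀ v, p (i v) = 0 := fun v => (hip _).2 ⟨v, rfl⟩
  let T : (Fin (m + n) → ℝ) →ₗ[ℝ] U :=
    i ∘ₗ e.toLinearMap ∘ₗ LinearMap.funLeft ℝ ℝ (Fin.castAdd n) +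
      g ∘ₗ f.toLinearMap ∘ₗ LinearMap.funLeft ℝ ℝ (Fin.natAdd m)
  have hT : ∀ c d, T (Fin.append c d) = i (e c) + g (f d) := by
    intro c d
    have h1 : LinearMap.funLeft ℝ ℝ (Fin.castAdd n) (Fin.append c d) = c := by
      ext j; simp [LinearMap.funLeft_apply]
    have h2 : LinearMap.funLeft ℝ ℝ (Fin.natAdd m) (Fin.append c d) = d := by
      ext j; simp [LinearMap.funLeft_apply]
    simp [T, h1, h2]
  have hsplit : ∀ x : Fin (m + n) → ℝ, ∃ c d, x = Fin.append c d := fun x =>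
    ⟨fun j => x (Fin.castAdd n j), fun j => x (Fin.natAdd m j), (Fin.append_castAdd_natAdd).symm⟩
  have hbij : Function.Bijective T := by
    constructor
    · rw [injective_iff_map_eq_zero]
      intro x hx
      obtain ⟨c, d, rfl⟩ := hsplit x
      rw [hT] at hx
      have h1 : f d = 0 := by simpa [hpi, hg'] using congrArg p hx
      have hd : d = 0 := by simpa using h1
      rw [h1, map_zero, add_zero] at hx
      have hc : c = 0 := by
        have := hi (hx.trans (map_zero i).symm)
        simpa using this
      subst hc; subst hd
      ext j
      refine Fin.addCases (fun j => ?_) (fun j => ?_) j <;> simp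
    · intro y
      obtain ⟨v, hv⟩ := (hip (y - g (p y))).1 (by simp [hg'])
      refine ⟨Fin.append (e.symm v) (f.symm (p y)), ?_⟩
      rw [hT]; simp [hv]
  refine ⟨LinearEquiv.ofBijective T hbij, ?_, ?_⟩
  · intro c
    exact (hT c 0).trans (by simp)
  · intro c d
    exact (congrArg p (hT c d)).trans (by simp [hpi, hg'])

theorem det_isAdapted {i : V →ₗ[ℝ] U} {p : U →ₗ[ℝ] W}
    {e e' : Frame m V} {f f' : Frame n W} {u u' : Frame (m + n) U} (hu : IsAdapted i p e f u)
    (hu' : IsAdapted i p e' f' u') :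
    LinearEquiv.det (u'.trans u.symm) =
      LinearEquiv.det (e'.trans e.symm) * LinearEquiv.det (f'.trans f.symm) := by
  have hsplit : ∀ x : Fin (m + n) → ℝ, ∃ c d, x = Fin.append c d := fun x =>
    ⟨fun j => x (Fin.castAdd n j), fun j => x (Fin.natAdd m j), (Fin.append_castAdd_natAdd).symm⟩
  have h1 : ∀ c, (u'.trans u.symm) (Fin.append c 0) = Fin.append ((e'.trans e.symm) c) 0 := by
    intro c
    apply u.injective
    rw [hu.1]
    simp [hu'.1]
  have h2 : ∀ c d, ∃ c', (u'.trans u.symm) (Fin.append c d) =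
      Fin.append c' ((f'.trans f.symm) d) := by
    intro c d
    obtain ⟨c', d', h⟩ := hsplit ((u'.trans u.symm) (Fin.append c d))
    refine ⟨c', ?_⟩
    rw [h]
    congr 1
    apply f.injective
    have := hu.2 c' d'
    rw [← h] at this
    simp only [LinearEquiv.trans_apply, LinearEquiv.apply_symm_apply, hu'.2] at this ⊢
    exact this.symm
  have a1 : ∀ j : Fin m, (Pi.single (Fin.castAdd n j) 1 : Fin (m + n) → ℝ) =
      Fin.append (Pi.single j 1) 0 := by
    intro j; ext k
    refine Fin.addCases (fun k => ?_) (fun k => ?_) k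
    · simp [Pi.single_apply]
    · simp [Pi.single_apply, Fin.ext_iff]; omega
  have a2 : ∀ j : Fin n, (Pi.single (Fin.natAdd m j) 1 : Fin (m + n) → ℝ) =
      Fin.append 0 (Pi.single j 1) := by
    intro j; ext k
    refine Fin.addCases (fun k => ?_) (fun k => ?_) k
    · simp [Pi.single_apply, Fin.ext_iff]; omega
    · simp [Pi.single_apply]
  have key : Matrix.reindex finSumFinEquiv.symm finSumFinEquiv.symm
      (LinearMap.toMatrix' (u'.trans u.symm).toLinearMap) =
      Matrix.fromBlocks (LinearMap.toMatrix' (e'.trans e.symm).toLinearMap)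
        (Matrix.of fun k j => LinearMap.toMatrix' (u'.trans u.symm).toLinearMap
          (Fin.castAdd n k) (Fin.natAdd m j)) 0
        (LinearMap.toMatrix' (f'.trans f.symm).toLinearMap) := by
    ext k j
    rcases k with k | k <;> rcases j with j | j
    · simp only [Matrix.reindex_apply, Matrix.submatrix_apply, Equiv.symm_symm,
        finSumFinEquiv_apply_left, Matrix.fromBlocks_apply₁₁, LinearMap.toMatrix'_apply,
        LinearEquiv.coe_coe]
      rw [a1, h1, Fin.append_left]
    · simp
    · simp only [Matrix.reindex_apply, Matrix.submatrix_apply, Equiv.symm_symm,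
        finSumFinEquiv_apply_left, finSumFinEquiv_apply_right, Matrix.fromBlocks_apply₂₁,
        LinearMap.toMatrix'_apply, LinearEquiv.coe_coe]
      rw [a1, h1, Fin.append_right]; rfl
    · simp only [Matrix.reindex_apply, Matrix.submatrix_apply, Equiv.symm_symm,
        finSumFinEquiv_apply_right, Matrix.fromBlocks_apply₂₂, LinearMap.toMatrix'_apply,
        LinearEquiv.coe_coe]
      obtain ⟨c', h⟩ := h2 0 (Pi.single j 1)
      rw [a2, h, Fin.append_right]
  ext
  rw [Units.val_mul, LinearEquiv.coe_det, LinearEquiv.coe_det, LinearEquiv.coe_det,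
    ← LinearMap.det_toMatrix', ← LinearMap.det_toMatrix', ← LinearMap.det_toMatrix',
    ← Matrix.det_reindex_self finSumFinEquiv.symm, key, Matrix.det_fromBlocks_zero₂₁]

/-- For a short exact sequence `0 → V → U → W → 0`, the induced isomorphism
`L_χ(U) ≅ L_χ(V) ⊗ L_χ(W)`. -/
def Line.exactIso (χ : ℝ →*₀ ℝ) {i : V →ₗ[ℝ] U} {p : U →ₗ[ℝ] W} (h : ShortExact i p)
    (hV : Nonempty (Frame m V)) (hW : Nonempty (Frame n W)) :
    Line (detChar χ (m + n)) U ≃ₗ[ℝ] Line (detChar χ m) V ⊗[ℝ] Line (detChar χ n) W :=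
  Line.eval _ (exists_isAdapted h hV.some hW.some).choose ≪≫ₗ
    (TensorProduct.lid ℝ ℝ).symm ≪≫ₗ
    TensorProduct.congr (Line.eval _ hV.some).symm (Line.eval _ hW.some).symm

theorem Line.exactIso_symm_tmul (χ : ℝ →*₀ ℝ) {i : V →ₗ[ℝ] U} {p : U →ₗ[ℝ] W}
    (h : ShortExact i p) (hV : Nonempty (Frame m V)) (hW : Nonempty (Frame n W)) (α : Line (detChar χ m) V)
    (β : Line (detChar χ n) W) {e : Frame m V} {f : Frame n W} {u : Frame (m + n) U}
    (hu : IsAdapted i p e f u) :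
    ((Line.exactIso χ h hV hW).symm (α ⊗ₜ β)).1 u = α.1 e * β.1 f := by
  have hu0 := (exists_isAdapted h hV.some hW.some).choose_spec
  rw [Line.eval_change _ _ (exists_isAdapted h hV.some hW.some).choose u,
    Line.eval_change _ α hV.some e, Line.eval_change _ β hW.some f]
  simp only [detChar_apply, det_isAdapted hu0 hu, map_mul, Units.val_mul]
  have h3 : ((Line.exactIso χ h hV hW).symm (α ⊗ₜ β)).1
      (exists_isAdapted h hV.some hW.some).choose = α.1 hV.some * β.1 hW.some := by
    have : Line.eval _ (exists_isAdapted h hV.some hW.some).choose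
        ((Line.exactIso χ h hV hW).symm (α ⊗ₜ β)) =
        Line.eval _ hV.some α * Line.eval _ hW.some β := by
      simp [Line.exactIso]
    exact this
  rw [h3]
  ring

/-- From an isomorphism `P ⊗ Q → P' ⊗ Q'` of tensor products of lines, the induced map
`P'^* ⊗ Q → P^* ⊗ Q'`: an element `λ ⊗ q` goes to the element of `P^* ⊗ Q' = Hom(P, Q')`
that sends `p` to the contraction of `φ (p ⊗ q)` with `λ`. -/
def transposeLeft {P Q P' Q' : Type*} [AddCommGroup P] [Module ℝ P] [Module.Finite ℝ P]
    [AddCommGroup Q] [Module ℝ Q] [AddCommGroup P'] [Module ℝ P'] [AddCommGroup Q'] [Module ℝ Q']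
    (φ : P ⊗[ℝ] Q →ₗ[ℝ] P' ⊗[ℝ] Q') :
    Module.Dual ℝ P' ⊗[ℝ] Q →ₗ[ℝ] Module.Dual ℝ P ⊗[ℝ] Q' :=
  (dualTensorHomEquiv ℝ P Q').symm.toLinearMap ∘ₗ
    TensorProduct.lift (LinearMap.mk₂ ℝ
      (fun l q => (TensorProduct.lid ℝ Q').toLinearMap ∘ₗ l.rTensor Q' ∘ₗ φ ∘ₗ
        (TensorProduct.mk ℝ P Q).flip q)
      (by intros; ext; simp [LinearMap.rTensor_add])
      (by intros; ext; simp [LinearMap.rTensor_smul])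
      (by intros; ext; simp)
      (by intros; ext; simp))

section Transport

variable {V' W' U' : Type*} [AddCommGroup V'] [Module ℝ V'] [AddCommGroup W'] [Module ℝ W']
  [AddCommGroup U'] [Module ℝ U']

/-- Given short exact sequences `0 → V → U → W → 0` and `0 → V' → U' → W' → 0` and an isomorphism
`d : U ≅ U'`, the composition `L(V) ⊗ L(W) ≅ L(U) ≅ L(U') ≅ L(V') ⊗ L(W')`. -/
def Line.swapIso (χ : ℝ →*₀ ℝ) {i : V →ₗ[ℝ] U} {p : U →ₗ[ℝ] W} (h : ShortExact i p)
    {i' : V' →ₗ[ℝ] U'} {p' : U' →ₗ[ℝ] W'} (h' : ShortExact i' p') (d : U ≃ₗ[ℝ] U')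
    (hV : Nonempty (Frame m V)) (hW : Nonempty (Frame n W))
    (hV' : Nonempty (Frame m V')) (hW' : Nonempty (Frame n W')) :
    Line (detChar χ m) V ⊗[ℝ] Line (detChar χ n) W ≃ₗ[ℝ]
      Line (detChar χ m) V' ⊗[ℝ] Line (detChar χ n) W' :=
  (Line.exactIso χ h hV hW).symm ≪≫ₗ Line.map _ d ≪≫ₗ Line.exactIso χ h' hV' hW'

/-- The map `L(V'^*) ⊗ L(W) → L(V^*) ⊗ L(W')` induced by `Line.swapIso` and the canonical
isomorphisms `L(V^*) ≅ L(V)^*` and `L(V'^*) ≅ L(V')^*`. -/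
def Line.transport (χ : ℝ →*₀ ℝ) {i : V →ₗ[ℝ] U} {p : U →ₗ[ℝ] W} (h : ShortExact i p)
    {i' : V' →ₗ[ℝ] U'} {p' : U' →ₗ[ℝ] W'} (h' : ShortExact i' p') (d : U ≃ₗ[ℝ] U')
    (hV : Nonempty (Frame m V)) (hW : Nonempty (Frame n W))
    (hV' : Nonempty (Frame m V')) (hW' : Nonempty (Frame n W')) :
    Line (detChar χ m) (Module.Dual ℝ V') ⊗[ℝ] Line (detChar χ n) W →ₗ[ℝ]
      Line (detChar χ m) (Module.Dual ℝ V) ⊗[ℝ] Line (detChar χ n) W' :=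
  (TensorProduct.congr (Line.dualIso χ hV).symm
      (LinearEquiv.refl ℝ (Line (detChar χ n) W'))).toLinearMap ∘ₗ
    transposeLeft (Line.swapIso χ h h' d hV hW hV' hW').toLinearMap ∘ₗ
    (TensorProduct.congr (Line.dualIso χ hV')
      (LinearEquiv.refl ℝ (Line (detChar χ n) W))).toLinearMap

end Transport

end LinearAlgebra
section LineBundles

variable {EM M : Type*} [NormedAddCommGroup EM] [NormedSpace ℝ EM] [TopologicalSpace M]
  [ChartedSpace EM M]

variable (EM M) in
/-- A smooth real line bundle over `M` with prescribed fibres, given by a covering family of local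
trivializations with smooth transition functions. A local trivialization is a pair `(U, φ)` of an
open set and of linear isomorphisms `φ x` of the fibres with `ℝ`; the values of `φ` outside of `U`
are irrelevant. The bundle in the sense of Mathlib is constructed below. -/
structure LineBundle where
  /-- the fibres -/
  Fiber : M → Type*
  [addCommGroup : ∀ x, AddCommGroup (Fiber x)]
  [module : ∀ x, Module ℝ (Fiber x)]
  /-- the local trivializations -/
  triv : Set (Opens M × ∀ x, Fiber x ≃ₗ[ℝ] ℝ)
  exists_mem_triv : ∀ x, ∃ φ ∈ triv, x ∈ φ.1
  contMDiffOn_transition : ∀ φ ∈ triv, ∀ ψ ∈ triv,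
    ContMDiffOn 𝓘(ℝ, EM) 𝓘(ℝ, ℝ) ∞ (fun x => ψ.2 x ((φ.2 x).symm 1))
      ((φ.1 : Set M) ∩ (ψ.1 : Set M))

namespace LineBundle

attribute [instance] LineBundle.addCommGroup LineBundle.module

/-- The fibres carry their canonical topology as finite-dimensional vector spaces. -/
instance (L : LineBundle EM M) (x : M) : TopologicalSpace (L.Fiber x) := moduleTopology ℝ _

instance (L : LineBundle EM M) (x : M) : IsModuleTopology ℝ (L.Fiber x) := ⟨rfl⟩

/-- The map `L|_U → U × ℝ` of a local trivialization. -/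
def pretriv (L : LineBundle EM M) (φ : Opens M × ∀ x, L.Fiber x ≃ₗ[ℝ] ℝ) :
    Pretrivialization ℝ (π ℝ L.Fiber) where
  toFun p := (p.1, φ.2 p.1 p.2)
  invFun q := ⟨q.1, (φ.2 q.1).symm q.2⟩
  source := π ℝ L.Fiber ⁻¹' φ.1
  target := (φ.1 : Set M) ×ˢ univ
  map_source' p hp := ⟨hp, mem_univ _⟩
  map_target' q hq := hq.1
  left_inv' p _ := by simp
  right_inv' q _ := by simp
  open_target := φ.1.isOpen.prod isOpen_univ
  baseSet := φ.1
  open_baseSet := φ.1.isOpen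
  source_eq := rfl
  target_eq := rfl
  proj_toFun _ _ := rfl

theorem pretriv_symm (L : LineBundle EM M) (φ : Opens M × ∀ x, L.Fiber x ≃ₗ[ℝ] ℝ) {x : M}
    (hx : x ∈ φ.1) (v : ℝ) : (L.pretriv φ).symm x v = (φ.2 x).symm v := by
  have h := (L.pretriv φ).symm_apply_apply_mk hx ((φ.2 x).symm v)
  have h2 : ((L.pretriv φ) ⟨x, (φ.2 x).symm v⟩).2 = v := (φ.2 x).apply_symm_apply v
  rwa [h2] at h

/-- The local trivializations as a vector prebundle. -/
def prebundle (L : LineBundle EM M) : VectorPrebundle ℝ ℝ L.Fiber where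
  pretrivializationAtlas := L.pretriv '' L.triv
  pretrivialization_linear' := by
    rintro _ ⟨φ, _, rfl⟩
    exact ⟨fun x _ => (φ.2 x).toLinearMap.isLinear⟩
  pretrivializationAt x := L.pretriv (L.exists_mem_triv x).choose
  mem_base_pretrivializationAt x := (L.exists_mem_triv x).choose_spec.2
  pretrivialization_mem_atlas x := ⟨_, (L.exists_mem_triv x).choose_spec.1, rfl⟩
  exists_coordChange := by
    rintro _ ⟨φ, hφ, rfl⟩ _ ⟨ψ, hψ, rfl⟩
    refine ⟨fun x => (ψ.2 x ((φ.2 x).symm 1)) • ContinuousLinearMap.id ℝ ℝ,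
      (L.contMDiffOn_transition φ hφ ψ hψ).continuousOn.smul continuousOn_const, ?_⟩
    intro x hx v
    rw [pretriv_symm L φ hx.1]
    show ψ.2 x ((φ.2 x).symm 1) * v = ψ.2 x ((φ.2 x).symm v)
    have : v = v • (1 : ℝ) := by simp
    conv_rhs => rw [this, map_smul, map_smul]
    simp [mul_comm]
  totalSpaceMk_isInducing x := by
    let e := (L.exists_mem_triv x).choose.2 x
    have : ContinuousAdd (L.Fiber x) := IsModuleTopology.toContinuousAdd ℝ _
    have h1 : Continuous e := IsModuleTopology.continuous_of_linearMap e.toLinearMap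
    have h2 : Continuous e.symm := IsModuleTopology.continuous_of_linearMap e.symm.toLinearMap
    let h : L.Fiber x ≃ₜ ℝ := ⟨e.toEquiv, h1, h2⟩
    exact (Topology.isInducing_const_prod.2 h.isInducing : Topology.IsInducing fun v => (x, h v))

instance (L : LineBundle EM M) : L.prebundle.IsContMDiff 𝓘(ℝ, EM) ∞ where
  exists_contMDiffCoordChange := by
    rintro _ ⟨φ, hφ, rfl⟩ _ ⟨ψ, hψ, rfl⟩
    refine ⟨fun x => (ψ.2 x ((φ.2 x).symm 1)) • ContinuousLinearMap.id ℝ ℝ,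
      (L.contMDiffOn_transition φ hφ ψ hψ).smul contMDiffOn_const, ?_⟩
    intro x hx v
    rw [pretriv_symm L φ hx.1]
    show ψ.2 x ((φ.2 x).symm 1) * v = ψ.2 x ((φ.2 x).symm v)
    have : v = v • (1 : ℝ) := by simp
    conv_rhs => rw [this, map_smul, map_smul]
    simp [mul_comm]

instance (L : LineBundle EM M) : TopologicalSpace (TotalSpace ℝ L.Fiber) :=
  L.prebundle.totalSpaceTopology

instance (L : LineBundle EM M) : FiberBundle ℝ L.Fiber := L.prebundle.toFiberBundle

instance (L : LineBundle EM M) : VectorBundle ℝ ℝ L.Fiber := L.prebundle.toVectorBundle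

instance (L : LineBundle EM M) : ContMDiffVectorBundle ∞ ℝ L.Fiber 𝓘(ℝ, EM) :=
  L.prebundle.contMDiffVectorBundle 𝓘(ℝ, EM)

variable (EM M) in
/-- The trivial line bundle. -/
def trivial : LineBundle EM M where
  Fiber _ := ℝ
  triv := {(⊤, fun _ => LinearEquiv.refl ℝ ℝ)}
  exists_mem_triv x := ⟨_, rfl, Set.mem_univ x⟩
  contMDiffOn_transition := by
    rintro _ rfl _ rfl
    exact contMDiffOn_const

/-- The tensor product of two line bundles. -/
def tensor (L L' : LineBundle EM M) : LineBundle EM M where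
  Fiber x := L.Fiber x ⊗[ℝ] L'.Fiber x
  triv := {θ | ∃ φ ∈ L.triv, ∃ ψ ∈ L'.triv, θ = (φ.1 ⊓ ψ.1, fun x =>
    TensorProduct.congr (φ.2 x) (ψ.2 x) ≪≫ₗ TensorProduct.lid ℝ ℝ)}
  exists_mem_triv x := by
    obtain ⟨φ, hφ, hx⟩ := L.exists_mem_triv x
    obtain ⟨ψ, hψ, hx'⟩ := L'.exists_mem_triv x
    exact ⟨_, ⟨φ, hφ, ψ, hψ, rfl⟩, hx, hx'⟩
  contMDiffOn_transition := by
    rintro _ ⟨φ, hφ, ψ, hψ, rfl⟩ _ ⟨φ', hφ', ψ', hψ', rfl⟩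
    have s1 : ((φ.1 ⊓ ψ.1 : Opens M) : Set M) ∩ ((φ'.1 ⊓ ψ'.1 : Opens M) : Set M) ⊆
        (φ.1 : Set M) ∩ (φ'.1 : Set M) := fun x hx => ⟨hx.1.1, hx.2.1⟩
    have s2 : ((φ.1 ⊓ ψ.1 : Opens M) : Set M) ∩ ((φ'.1 ⊓ ψ'.1 : Opens M) : Set M) ⊆
        (ψ.1 : Set M) ∩ (ψ'.1 : Set M) := fun x hx => ⟨hx.1.2, hx.2.2⟩
    have h1 := (L.contMDiffOn_transition φ hφ φ' hφ').mono s1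
    have h2 := (L'.contMDiffOn_transition ψ hψ ψ' hψ').mono s2
    refine (h1.mul h2).congr ?_
    intro x _
    simp

/-- The dual of a line bundle. -/
def dual (L : LineBundle EM M) : LineBundle EM M where
  Fiber x := Module.Dual ℝ (L.Fiber x)
  triv := {θ | ∃ φ ∈ L.triv, θ = (φ.1, fun x =>
    (φ.2 x).symm.dualMap ≪≫ₗ LinearMap.ringLmapEquivSelf ℝ ℝ ℝ)}
  exists_mem_triv x := by
    obtain ⟨φ, hφ, hx⟩ := L.exists_mem_triv x
    exact ⟨_, ⟨φ, hφ, rfl⟩, hx⟩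
  contMDiffOn_transition := by
    rintro _ ⟨φ, hφ, rfl⟩ _ ⟨ψ, hψ, rfl⟩
    refine ((L.contMDiffOn_transition ψ hψ φ hφ).mono (fun x hx => ⟨hx.2, hx.1⟩)).congr ?_
    intro x _
    simp

end LineBundle

end LineBundles

section SubmersionFacts

universe u

variable {EN : Type u} {N EB B EM M : Type*} [NormedAddCommGroup EN] [NormedSpace ℝ EN]
  [TopologicalSpace N] [ChartedSpace EN N]
  [NormedAddCommGroup EB] [NormedSpace ℝ EB]
  [TopologicalSpace B] [ChartedSpace EB B]
  [NormedAddCommGroup EM] [NormedSpace ℝ EM] [TopologicalSpace M] [ChartedSpace EM M]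

theorem mdifferentiable_of_mem_maximalAtlas {e : OpenPartialHomeomorph N EN}
    (he : e ∈ IsManifold.maximalAtlas 𝓘(ℝ, EN) ∞ N) :
    e.MDifferentiable 𝓘(ℝ, EN) 𝓘(ℝ, EN) :=
  ⟨(contMDiffOn_of_mem_maximalAtlas he).mdifferentiableOn (by simp),
    (contMDiffOn_symm_of_mem_maximalAtlas he).mdifferentiableOn (by simp)⟩

/-- The local form of a submersion and of its differential. -/
theorem submersion_local {f : N → B} (hf : Manifold.IsSubmersion 𝓘(ℝ, EN) 𝓘(ℝ, EB) ∞ f) (p : N) :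
    ∃ (F : Type u) (_ : NormedAddCommGroup F) (_ : NormedSpace ℝ F) (l : EN ≃L[ℝ] EB × F)
      (e : OpenPartialHomeomorph N EN) (k : EB → B)
      (_ : e ∈ IsManifold.maximalAtlas 𝓘(ℝ, EN) ∞ N), p ∈ e.source ∧
      (∀ z ∈ e.target, f (e.symm z) = k (l z).1) ∧
      ∀ z ∈ e.target, ∃ D : EB ≃L[ℝ] EB, ∀ w : EN,
        (mfderiv 𝓘(ℝ, EN) 𝓘(ℝ, EB) f (e.symm z) (mfderiv 𝓘(ℝ, EN) 𝓘(ℝ, EN) e.symm z w) : EB) =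
          D (l w).1 := by
  have hp := hf.isSubmersionAt p
  have he := mdifferentiable_of_mem_maximalAtlas hp.domChart_mem_maximalAtlas
  have hc := mdifferentiable_of_mem_maximalAtlas hp.codChart_mem_maximalAtlas
  have hw : ∀ z ∈ hp.domChart.target,
      hp.codChart (f (hp.domChart.symm z)) = (hp.equiv z).1 := by
    intro z hz
    have hz2 : z ∈ (hp.domChart.extend 𝓘(ℝ, EN)).target := by simpa using hz
    have := hp.writtenInCharts hz2
    simpa using this
  have hs : ∀ z ∈ hp.domChart.target, f (hp.domChart.symm z) ∈ hp.codChart.source := fun z hz =>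
    hp.source_subset_preimage_source (hp.domChart.map_target hz)
  have hk : ∀ z ∈ hp.domChart.target,
      f (hp.domChart.symm z) = hp.codChart.symm (hp.equiv z).1 := by
    intro z hz
    rw [← hw z hz, hp.codChart.left_inv (hs z hz)]
  refine ⟨hp.complement, inferInstance, inferInstance, hp.equiv, hp.domChart, hp.codChart.symm, hp.domChart_mem_maximalAtlas,
    hp.mem_domChart_source, hk, ?_⟩
  intro z hz
  have hz' : (hp.equiv z).1 ∈ hp.codChart.target := by
    rw [← hw z hz]; exact hp.codChart.map_source (hs z hz)
  refine ⟨hc.symm.mfderiv hz', fun w => ?_⟩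
  have h1 : HasMFDerivAt 𝓘(ℝ, EN) 𝓘(ℝ, EB) (f ∘ hp.domChart.symm) z
      ((mfderiv 𝓘(ℝ, EN) 𝓘(ℝ, EB) f (hp.domChart.symm z)).comp
        (mfderiv 𝓘(ℝ, EN) 𝓘(ℝ, EN) hp.domChart.symm z)) :=
    ((hf.contMDiff.mdifferentiable (by simp) _).hasMFDerivAt).comp z
      ((he.mdifferentiableAt_symm hz).hasMFDerivAt)
  have h2 : HasMFDerivAt 𝓘(ℝ, EN) 𝓘(ℝ, EB)
      (hp.codChart.symm ∘ (fun z => (hp.equiv z).1)) z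
      ((mfderiv 𝓘(ℝ, EB) 𝓘(ℝ, EB) hp.codChart.symm (hp.equiv z).1).comp
        ((ContinuousLinearMap.fst ℝ EB hp.complement).comp
          (hp.equiv : EN →L[ℝ] EB × hp.complement))) :=
    ((hc.mdifferentiableAt_symm hz').hasMFDerivAt).comp z
      ((ContinuousLinearMap.fst ℝ EB hp.complement).comp
          (hp.equiv : EN →L[ℝ] EB × hp.complement)).hasMFDerivAt
  have h3 := h2.congr_of_eventuallyEq (f₁ := f ∘ hp.domChart.symm)
    (by filter_upwards [hp.domChart.open_target.mem_nhds hz] with z' hz' using hk z' hz')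
  exact DFunLike.congr_fun (hasMFDerivAt_unique h1 h3) w

theorem submersion_surjective {f : N → B} (hf : Manifold.IsSubmersion 𝓘(ℝ, EN) 𝓘(ℝ, EB) ∞ f)
    (p : N) : Function.Surjective (mfderiv 𝓘(ℝ, EN) 𝓘(ℝ, EB) f p) := by
  obtain ⟨F, _, _, l, e, k, he, hp, -, h⟩ := submersion_local hf p
  obtain ⟨D, hD⟩ := h _ (e.map_source hp)
  intro v
  rw [e.left_inv hp] at hD
  exact ⟨_, (hD (l.symm (D.symm (v : EB), 0))).trans (by simp; exact D.apply_symm_apply (v : EB))⟩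

theorem submersion_ker {f : N → B} (hf : Manifold.IsSubmersion 𝓘(ℝ, EN) 𝓘(ℝ, EB) ∞ f)
    (p : N) (v : EN) (hv : mfderiv 𝓘(ℝ, EN) 𝓘(ℝ, EB) f p v = 0) :
    ∃ γ : ℝ → N, γ 0 = p ∧ (∀ᶠ τ in 𝓝 0, f (γ τ) = f p) ∧
      HasMFDerivAt 𝓘(ℝ, ℝ) 𝓘(ℝ, EN) γ 0 (ContinuousLinearMap.toSpanSingleton ℝ v) := by
  obtain ⟨F, _, _, l, e, k, he, hp, hk, h⟩ := submersion_local hf p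
  have hm := mdifferentiable_of_mem_maximalAtlas he
  obtain ⟨D, hD⟩ := h _ (e.map_source hp)
  let w : EN := mfderiv 𝓘(ℝ, EN) 𝓘(ℝ, EN) e p v
  have hw : (mfderiv 𝓘(ℝ, EN) 𝓘(ℝ, EN) e.symm (e p) w : EN) = v :=
    DFunLike.congr_fun (hm.symm_comp_deriv hp) v
  have hw2 : (l w).1 = 0 := by
    have h1 := hD w
    rw [hw, e.left_inv hp] at h1
    have h2 : D (l w).1 = 0 := h1.symm.trans hv
    simpa using h2
  have hc : ContinuousAt (fun τ : ℝ => e p + τ • w) 0 := by fun_prop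
  refine ⟨fun τ => e.symm (e p + τ • w), by simp [e.left_inv hp], ?_, ?_⟩
  · have hn : e.target ∈ 𝓝 (e p + (0 : ℝ) • w) := by
      simpa using e.open_target.mem_nhds (e.map_source hp)
    filter_upwards [hc.preimage_mem_nhds hn] with τ hτ
    rw [hk _ hτ]
    have := hk _ (e.map_source hp)
    rw [e.left_inv hp] at this
    rw [this]
    simp [hw2]
  · have h1 : HasMFDerivAt 𝓘(ℝ, ℝ) 𝓘(ℝ, EN) (fun τ : ℝ => e p + τ • w) 0
        (ContinuousLinearMap.toSpanSingleton ℝ w) := by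
      have := ((hasDerivAt_id (0 : ℝ)).smul_const w).const_add (e p)
      rw [one_smul] at this
      exact this.hasFDerivAt.hasMFDerivAt
    have h2 : HasMFDerivAt 𝓘(ℝ, EN) 𝓘(ℝ, EN) e.symm (e p + (0 : ℝ) • w)
        (mfderiv 𝓘(ℝ, EN) 𝓘(ℝ, EN) e.symm (e p)) := by
      rw [zero_smul, add_zero]
      exact (hm.mdifferentiableAt_symm (e.map_source hp)).hasMFDerivAt
    have h3 := h2.comp (0 : ℝ) h1
    have h4 : (mfderiv 𝓘(ℝ, EN) 𝓘(ℝ, EN) e.symm (e p) : EN →L[ℝ] EN).comp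
        (ContinuousLinearMap.toSpanSingleton ℝ w) =
        ContinuousLinearMap.toSpanSingleton ℝ v := by
      ext
      exact (congrArg _ (one_smul ℝ w)).trans (hw.trans (one_smul ℝ v).symm)
    exact h4 ▸ h3

theorem contMDiffOn_chart_field [IsManifold 𝓘(ℝ, EN) ∞ N] {u : M → N} (hu : ContMDiff 𝓘(ℝ, EM) 𝓘(ℝ, EN) ∞ u)
    {e : OpenPartialHomeomorph N EN} (he : e ∈ IsManifold.maximalAtlas 𝓘(ℝ, EN) ∞ N) (w : EN) :
    ContMDiffOn 𝓘(ℝ, EM) (𝓘(ℝ, EN).prod 𝓘(ℝ, EN)) ∞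
      (fun x => (⟨e.symm (e (u x)), mfderiv 𝓘(ℝ, EN) 𝓘(ℝ, EN) e.symm (e (u x)) w⟩ :
        TangentBundle 𝓘(ℝ, EN) N)) (u ⁻¹' e.source) := by
  have h1 := (contMDiffOn_symm_of_mem_maximalAtlas he).contMDiffOn_tangentMapWithin
    (m := ∞) (by simp) e.open_target.uniqueMDiffOn
  have h2 : ContMDiffOn 𝓘(ℝ, EM) 𝓘(ℝ, EN) ∞ (fun x => e (u x)) (u ⁻¹' e.source) :=
    (contMDiffOn_of_mem_maximalAtlas he).comp hu.contMDiffOn (fun x hx => hx)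
  have h3 : ContMDiffOn 𝓘(ℝ, EM) (𝓘(ℝ, EN).prod 𝓘(ℝ, EN)) ∞
      (fun x => (⟨e (u x), w⟩ : TangentBundle 𝓘(ℝ, EN) EN)) (u ⁻¹' e.source) := by
    intro x hx
    rw [contMDiffWithinAt_totalSpace]
    exact ⟨h2 x hx, by simpa using contMDiffWithinAt_const⟩
  refine (h1.comp h3 (fun x hx => e.map_source hx)).congr ?_
  intro x hx
  simp only [Function.comp, tangentMapWithin]
  rw [mfderivWithin_of_isOpen e.open_target (e.map_source hx)]

end SubmersionFacts

section Frames

variable {EM M EN N : Type*} [NormedAddCommGroup EM] [NormedSpace ℝ EM]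
  [TopologicalSpace M] [ChartedSpace EM M]
  [NormedAddCommGroup EN] [NormedSpace ℝ EN]
  [TopologicalSpace N] [ChartedSpace EN N] [IsManifold 𝓘(ℝ, EN) ∞ N]
  {V : M → Type*} [∀ x, AddCommGroup (V x)] [∀ x, Module ℝ (V x)] {r : ℕ}

/-- Let `V` be a family of vector spaces over `M`, embedded by `j` into the pull-back along `u` of
the tangent bundle of `N`. The family of frames `a` is smooth over `U` if its members are smooth
as maps to `TN`. -/
def IsSmoothFrameOn (u : M → N) (j : ∀ x, V x →ₗ[ℝ] TangentSpace 𝓘(ℝ, EN) (u x)) (U : Opens M)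
    (a : ∀ x, Frame r (V x)) : Prop :=
  ∀ c : Fin r → ℝ, ContMDiffOn 𝓘(ℝ, EM) (𝓘(ℝ, EN).prod 𝓘(ℝ, EN)) ∞
    (fun x => (⟨u x, j x (a x c)⟩ : TangentBundle 𝓘(ℝ, EN) N)) U

theorem contMDiffWithinAt_matrix_det {A : M → Matrix (Fin r) (Fin r) ℝ} {s : Set M} {x : M}
    (h : ∀ i k, ContMDiffWithinAt 𝓘(ℝ, EM) 𝓘(ℝ, ℝ) ∞ (fun y => A y i k) s x) :
    ContMDiffWithinAt 𝓘(ℝ, EM) 𝓘(ℝ, ℝ) ∞ (fun y => (A y).det) s x := by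
  simp only [Matrix.det_apply']
  refine contMDiffWithinAt_finsetSum fun σ _ => ?_
  exact contMDiffWithinAt_const.mul (contMDiffWithinAt_finsetProd fun i _ => h _ _)

theorem contMDiffOn_det [FiniteDimensional ℝ EN] {u : M → N}
    {j : ∀ x, V x →ₗ[ℝ] TangentSpace 𝓘(ℝ, EN) (u x)} (hj : ∀ x, Function.Injective (j x))
    {U U' : Opens M} {a b : ∀ x, Frame r (V x)} (ha : IsSmoothFrameOn (EM := EM) u j U a)
    (hb : IsSmoothFrameOn (EM := EM) u j U' b) :
    ContMDiffOn 𝓘(ℝ, EM) 𝓘(ℝ, ℝ) ∞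
      (fun x => (LinearEquiv.det ((a x).trans (b x).symm) : ℝ)) ((U : Set M) ∩ (U' : Set M)) := by
  intro x₀ hx₀
  let t := trivializationAt EN (TangentSpace 𝓘(ℝ, EN)) (u x₀)
  have hmem : u x₀ ∈ t.baseSet := mem_baseSet_trivializationAt _ _ _
  let s : Set M := (U : Set M) ∩ (U' : Set M)
  have hA : ∀ c, ContMDiffWithinAt 𝓘(ℝ, EM) 𝓘(ℝ, EN) ∞
      (fun x => (t ⟨u x, j x (a x c)⟩).2) s x₀ := fun c =>
    (contMDiffWithinAt_totalSpace.1 ((ha c x₀ hx₀.1).mono inter_subset_left)).2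
  have hB : ∀ c, ContMDiffWithinAt 𝓘(ℝ, EM) 𝓘(ℝ, EN) ∞
      (fun x => (t ⟨u x, j x (b x c)⟩).2) s x₀ := fun c =>
    (contMDiffWithinAt_totalSpace.1 ((hb c x₀ hx₀.2).mono inter_subset_right)).2
  have hu : ContinuousWithinAt u s x₀ :=
    (contMDiffWithinAt_totalSpace.1 ((ha 0 x₀ hx₀.1).mono inter_subset_left)).1.continuousWithinAt
  let T : ∀ x, V x →ₗ[ℝ] EN := fun x => t.linearMapAt ℝ (u x) ∘ₗ j x
  have hT : ∀ x, u x ∈ t.baseSet → ∀ v, T x v = (t ⟨u x, j x v⟩).2 := by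
    intro x hx v
    show t.linearMapAt ℝ (u x) (j x v) = _
    rw [t.coe_linearMapAt_of_mem hx]
  have hTinj : Function.Injective (T x₀ ∘ₗ (b x₀).toLinearMap) := by
    have h1 : Function.Injective (t.linearMapAt ℝ (u x₀)) := by
      have h2 : Function.Injective (t.linearEquivAt ℝ (u x₀) hmem) := LinearEquiv.injective _
      intro v w h
      apply h2
      simpa [t.coe_linearMapAt_of_mem hmem] using h
    exact (h1.comp (hj x₀)).comp (b x₀).injective
  obtain ⟨q', hq'⟩ := LinearMap.exists_leftInverse_of_injective _ (LinearMap.ker_eq_bot.2 hTinj)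
  let q : EN →L[ℝ] (Fin r → ℝ) := LinearMap.toContinuousLinearMap q'
  let P : (∀ x, Frame r (V x)) → M → Matrix (Fin r) (Fin r) ℝ := fun a x =>
    LinearMap.toMatrix' (q' ∘ₗ T x ∘ₗ (a x).toLinearMap)
  have hev : ∀ᶠ x in 𝓝[s] x₀, u x ∈ t.baseSet :=
    hu (t.open_baseSet.mem_nhds hmem)
  have hP : ∀ a : ∀ x, Frame r (V x), (∀ c, ContMDiffWithinAt 𝓘(ℝ, EM) 𝓘(ℝ, EN) ∞
      (fun x => (t ⟨u x, j x (a x c)⟩).2) s x₀) →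
      ContMDiffWithinAt 𝓘(ℝ, EM) 𝓘(ℝ, ℝ) ∞ (fun x => (P a x).det) s x₀ := by
    intro a ha
    refine contMDiffWithinAt_matrix_det fun i k => ?_
    let qi : EN →L[ℝ] ℝ := (ContinuousLinearMap.proj i).comp q
    have h1 := (qi.contDiff (n := ∞)).contMDiff.contMDiffAt.comp_contMDiffWithinAt x₀
      (ha (Pi.single k 1))
    refine h1.congr_of_eventuallyEq_of_mem ?_ hx₀
    filter_upwards [hev] with x hx
    simp only [P, LinearMap.toMatrix'_apply, LinearMap.comp_apply, Function.comp]
    rw [hT x hx]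
    rfl
  have hdet : ∀ x, (LinearEquiv.det ((a x).trans (b x).symm) : ℝ) * (P b x).det = (P a x).det := by
    intro x
    simp only [P, LinearMap.det_toMatrix', LinearEquiv.coe_det]
    rw [mul_comm, ← LinearMap.det_comp]
    congr 1
    ext c
    simp
  have hb0 : (P b x₀).det = 1 := by
    simp only [P, LinearMap.det_toMatrix']
    rw [hq', LinearMap.det_id]
  have hcont := (hP b hB).continuousWithinAt
  have hne : ∀ᶠ x in 𝓝[s] x₀, (P b x).det ≠ 0 :=
    hcont.eventually_ne (by simp only [hb0]; exact one_ne_zero)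
  refine ((hP a hA).div₀ (hP b hB) (by rw [hb0]; exact one_ne_zero)).congr_of_eventuallyEq_of_mem ?_ hx₀
  filter_upwards [hne] with x hx
  rw [Pi.div_apply, ← hdet x, mul_div_cancel_right₀ _ hx]

theorem contMDiffOn_char_det [FiniteDimensional ℝ EN] (χ : ℝ →*₀ ℝ) [hχ : SmoothChar χ] {u : M → N}
    {j : ∀ x, V x →ₗ[ℝ] TangentSpace 𝓘(ℝ, EN) (u x)} (hj : ∀ x, Function.Injective (j x))
    {U U' : Opens M} {a b : ∀ x, Frame r (V x)} (ha : IsSmoothFrameOn (EM := EM) u j U a)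
    (hb : IsSmoothFrameOn (EM := EM) u j U' b) :
    ContMDiffOn 𝓘(ℝ, EM) 𝓘(ℝ, ℝ) ∞
      (fun x => χ (LinearEquiv.det ((a x).trans (b x).symm) : ℝ))
      ((U : Set M) ∩ (U' : Set M)) := by
  exact hχ.contDiffOn.contMDiffOn.comp (contMDiffOn_det hj ha hb)
    (fun x _ => Units.ne_zero (LinearEquiv.det ((a x).trans (b x).symm)))

end Frames

section TangentLine

variable {EM M : Type*} [NormedAddCommGroup EM] [NormedSpace ℝ EM] [FiniteDimensional ℝ EM]
  [TopologicalSpace M] [ChartedSpace EM M]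

instance (x : M) : FiniteDimensional ℝ (TangentSpace 𝓘(ℝ, EM) x) :=
  inferInstanceAs (FiniteDimensional ℝ EM)

theorem nonempty_tangentFrame (x : M) :
    Nonempty (Frame (Module.finrank ℝ EM) (TangentSpace 𝓘(ℝ, EM) x)) :=
  ⟨(Module.finBasis ℝ EM).equivFun.symm⟩

variable [IsManifold 𝓘(ℝ, EM) ∞ M]

theorem exists_smoothFrame_tangent (x₀ : M) : ∃ (U : Opens M)
    (a : ∀ x : M, Frame (Module.finrank ℝ EM) (TangentSpace 𝓘(ℝ, EM) x)), x₀ ∈ U ∧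
      IsSmoothFrameOn (EM := EM) id (fun _ => LinearMap.id) U a := by
  classical
  let e := chartAt EM x₀
  have he : e ∈ IsManifold.maximalAtlas 𝓘(ℝ, EM) ∞ M := IsManifold.chart_mem_maximalAtlas x₀
  have hm := mdifferentiable_of_mem_maximalAtlas he
  let b : (Fin (Module.finrank ℝ EM) → ℝ) ≃ₗ[ℝ] EM := (Module.finBasis ℝ EM).equivFun.symm
  have key : ∀ x : M, ∃ a : Frame (Module.finrank ℝ EM) (TangentSpace 𝓘(ℝ, EM) x), x ∈ e.source →
      ∀ c, (a c : EM) = mfderiv 𝓘(ℝ, EM) 𝓘(ℝ, EM) e.symm (e x) (b c) := by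
    intro x
    by_cases hx : x ∈ e.source
    · let D : TangentSpace 𝓘(ℝ, EM) (e x) ≃L[ℝ] TangentSpace 𝓘(ℝ, EM) (e.symm (e x)) :=
        hm.symm.mfderiv (e.map_source hx)
      exact ⟨b.trans D.toLinearEquiv, fun _ c => rfl⟩
    · exact ⟨b, fun h => absurd h hx⟩
  choose a ha using key
  refine ⟨⟨e.source, e.open_source⟩, a, mem_chart_source EM x₀, fun c => ?_⟩
  refine (contMDiffOn_chart_field (u := (id : M → M)) contMDiff_id he (b c)).congr ?_
  intro x hx
  have h1 : e.symm (e x) = x := e.left_inv hx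
  refine TotalSpace.ext h1.symm (heq_of_eq ?_)
  exact ha x hx c

/-- The line bundle `L_χ(TM)`. Its local trivializations are the evaluations on the smooth local
frames of `TM`. -/
def tangentLine (EM M : Type*) [NormedAddCommGroup EM] [NormedSpace ℝ EM] [FiniteDimensional ℝ EM]
    [TopologicalSpace M] [ChartedSpace EM M] [IsManifold 𝓘(ℝ, EM) ∞ M]
    (χ : ℝ →*₀ ℝ) [SmoothChar χ] : LineBundle EM M where
  Fiber x := Line (detChar χ (Module.finrank ℝ EM)) (TangentSpace 𝓘(ℝ, EM) x)
  triv := {θ | ∃ a : ∀ x : M, Frame (Module.finrank ℝ EM) (TangentSpace 𝓘(ℝ, EM) x),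
    IsSmoothFrameOn (EM := EM) id (fun _ => LinearMap.id) θ.1 a ∧
      θ.2 = fun x => Line.eval _ (a x)}
  exists_mem_triv x := by
    obtain ⟨U, a, hx, ha⟩ := exists_smoothFrame_tangent (EM := EM) x
    exact ⟨(U, fun x => Line.eval _ (a x)), ⟨a, ha, rfl⟩, hx⟩
  contMDiffOn_transition := by
    rintro ⟨U, φ⟩ ⟨a, ha, rfl⟩ ⟨U', ψ⟩ ⟨b, hb, rfl⟩
    refine ((contMDiffOn_char_det χ (fun _ => Function.injective_id) hb ha).mono
      (fun x hx => ⟨hx.2, hx.1⟩)).congr ?_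
    intro x _
    exact mul_one _

end TangentLine

section Groupoids

/-- The arrows of a groupoid with set of objects `M`. -/
structure Arrows (M : Type*) [Groupoid M] where
  /-- the source -/
  src : M
  /-- the target -/
  tgt : M
  /-- the arrow from `src` to `tgt` -/
  hom : src ⟶ tgt

namespace Arrows

variable {M : Type*} [Groupoid M]

/-- An arrow `g : x ⟶ y` as an element of the set of all arrows. -/
abbrev of {x y : M} (g : x ⟶ y) : Arrows M := ⟨x, y, g⟩

/-- The unit `1_x`. -/
abbrev unit (x : M) : Arrows M := ⟨x, x, 𝟙 x⟩

/-- The inversion. -/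
abbrev inv (g : Arrows M) : Arrows M := ⟨g.tgt, g.src, Groupoid.inv g.hom⟩

open Classical in
/-- The multiplication `(g, h) ↦ g h`, first `h` and then `g`. It is meaningful if the source of
`g` is the target of `h`; the value is irrelevant otherwise. -/
def mul (g h : Arrows M) : Arrows M :=
  if e : g.src = h.tgt then ⟨h.src, g.tgt, h.hom ≫ eqToHom e.symm ≫ g.hom⟩ else g

theorem mul_of {x y z : M} (g : y ⟶ z) (h : x ⟶ y) : (of g).mul (of h) = of (h ≫ g) := by
  simp [mul]

theorem inv_inv (g : Arrows M) : g.inv.inv = g := by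
  cases g; simp [inv]

theorem mul_of_inv_cancel {x y : M} (g : x ⟶ y) (h : Arrows M) (hh : h.src = y) :
    (h.mul (of g)).mul (of (Groupoid.inv g)) = h := by
  obtain ⟨y', z, h⟩ := h
  obtain rfl : y' = y := hh
  show ((of h).mul (of g)).mul (of (Groupoid.inv g)) = of h
  rw [mul_of, mul_of]
  simp

theorem src_mul (g h : Arrows M) (e : g.src = h.tgt) : (g.mul h).src = h.src := by
  simp [mul, e]

end Arrows

/-- A Lie groupoid over `M`, with space of arrows `Arrows M`: the space of objects and that of
arrows are smooth manifolds, the source is a submersion, and the structure maps are smooth.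
As the source is a submersion, the composable pairs form an embedded submanifold of the product. -/
class LieGroupoid (EM EG M : Type*) [Groupoid M]
    [NormedAddCommGroup EM] [NormedSpace ℝ EM] [NormedAddCommGroup EG] [NormedSpace ℝ EG]
    [TopologicalSpace M] [ChartedSpace EM M] [IsManifold 𝓘(ℝ, EM) ∞ M]
    [TopologicalSpace (Arrows M)] [ChartedSpace EG (Arrows M)]
    [IsManifold 𝓘(ℝ, EG) ∞ (Arrows M)] : Prop where
  isSubmersion_src : Manifold.IsSubmersion 𝓘(ℝ, EG) 𝓘(ℝ, EM) ∞ (Arrows.src : Arrows M → M)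
  contMDiff_tgt : ContMDiff 𝓘(ℝ, EG) 𝓘(ℝ, EM) ∞ (Arrows.tgt : Arrows M → M)
  contMDiff_unit : ContMDiff 𝓘(ℝ, EM) 𝓘(ℝ, EG) ∞ (Arrows.unit : M → Arrows M)
  contMDiff_inv : ContMDiff 𝓘(ℝ, EG) 𝓘(ℝ, EG) ∞ (Arrows.inv : Arrows M → Arrows M)
  contMDiffOn_mul : ContMDiffOn (𝓘(ℝ, EG).prod 𝓘(ℝ, EG)) 𝓘(ℝ, EG) ∞
    (fun p : Arrows M × Arrows M => p.1.mul p.2) {p | p.1.src = p.2.tgt}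

variable (EM EG : Type*) {M : Type*} [Groupoid M]
    [NormedAddCommGroup EM] [NormedSpace ℝ EM] [NormedAddCommGroup EG] [NormedSpace ℝ EG]
    [TopologicalSpace M] [ChartedSpace EM M]
    [TopologicalSpace (Arrows M)] [ChartedSpace EG (Arrows M)]

section Rank

/-- The rank of the Lie algebroid, which is the dimension of the source fibres. -/
def algRank (EM EG : Type*) [NormedAddCommGroup EM] [NormedSpace ℝ EM] [NormedAddCommGroup EG]
    [NormedSpace ℝ EG] : ℕ := Module.finrank ℝ EG - Module.finrank ℝ EM

end Rank

/-- The fibre at `x` of the Lie algebroid: the kernel of `ds` at the unit `1_x`. -/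
def algFiber (x : M) : Submodule ℝ (TangentSpace 𝓘(ℝ, EG) (Arrows.unit x)) :=
  LinearMap.ker (mfderiv 𝓘(ℝ, EG) 𝓘(ℝ, EM) Arrows.src (Arrows.unit x)).toLinearMap

/-- The map `A_y → T_g 𝒢` for an arrow `g : x ⟶ y`: the restriction to the tangent space
`A_y` of the source fibre at `1_y` of the differential of the right translation `h ↦ h g`, which is
defined on the source fibre of `y`. -/
def rightTranslation {x y : M} (g : x ⟶ y) :
    algFiber EM EG y →ₗ[ℝ] TangentSpace 𝓘(ℝ, EG) (Arrows.of g) :=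
  let D : EG →L[ℝ] EG := mfderivWithin 𝓘(ℝ, EG) 𝓘(ℝ, EG) (fun h : Arrows M => h.mul (Arrows.of g))
    (Arrows.src ⁻¹' {y}) (Arrows.unit y)
  D.toLinearMap ∘ₗ (algFiber EM EG y).subtype

/-- The map `ds : T_g 𝒢 → T_x M` for an arrow `g : x ⟶ y`. -/
def dsrc {x y : M} (g : x ⟶ y) :
    TangentSpace 𝓘(ℝ, EG) (Arrows.of g) →ₗ[ℝ] TangentSpace 𝓘(ℝ, EM) x :=
  (mfderiv 𝓘(ℝ, EG) 𝓘(ℝ, EM) Arrows.src (Arrows.of g)).toLinearMap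

variable [IsManifold 𝓘(ℝ, EM) ∞ M] [IsManifold 𝓘(ℝ, EG) ∞ (Arrows M)]

variable {EM EG} in
theorem mdifferentiableWithinAt_mul (hG : LieGroupoid EM EG M) {x y : M} (g : x ⟶ y) (p : Arrows M) (hp : p.src = y) :
    MDifferentiableWithinAt 𝓘(ℝ, EG) 𝓘(ℝ, EG) (fun h : Arrows M => h.mul (Arrows.of g))
      (Arrows.src ⁻¹' {y}) p := by
  have h1 : ContMDiffOn 𝓘(ℝ, EG) (𝓘(ℝ, EG).prod 𝓘(ℝ, EG)) ∞
      (fun h : Arrows M => (h, Arrows.of g)) (Arrows.src ⁻¹' {y}) :=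
    (contMDiff_id.prodMk contMDiff_const).contMDiffOn
  exact ((hG.contMDiffOn_mul.comp h1 (fun h hh => hh)) p hp).mdifferentiableWithinAt (by simp)

theorem dinv_bijective [FiniteDimensional ℝ EG] (hG : LieGroupoid EM EG M) (g : Arrows M) :
    Function.Bijective (mfderiv 𝓘(ℝ, EG) 𝓘(ℝ, EG) Arrows.inv g) := by
  let D : EG →L[ℝ] EG := mfderiv 𝓘(ℝ, EG) 𝓘(ℝ, EG) Arrows.inv g
  let D' : EG →L[ℝ] EG := mfderiv 𝓘(ℝ, EG) 𝓘(ℝ, EG) Arrows.inv g.inv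
  have hd : MDifferentiable 𝓘(ℝ, EG) 𝓘(ℝ, EG) (Arrows.inv : Arrows M → Arrows M) :=
    hG.contMDiff_inv.mdifferentiable (by simp)
  have h1 : HasMFDerivAt 𝓘(ℝ, EG) 𝓘(ℝ, EG) (Arrows.inv ∘ Arrows.inv) g (D'.comp D) :=
    (hd g.inv).hasMFDerivAt.comp g (hd g).hasMFDerivAt
  have h2 : (Arrows.inv ∘ Arrows.inv : Arrows M → Arrows M) = id := funext Arrows.inv_inv
  rw [h2] at h1
  have h3 : ∀ v : EG, D' (D v) = v := fun v =>
    DFunLike.congr_fun (hasMFDerivAt_unique h1 (hasMFDerivAt_id g)) v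
  have h4 : Function.Injective D.toLinearMap := fun v w h => by
    rw [← h3 v, ← h3 w]; exact congrArg D' h
  exact ⟨h4, LinearMap.surjective_of_injective h4⟩

variable [hG : LieGroupoid EM EG M]

theorem dsrc_surjective {x y : M} (g : x ⟶ y) : Function.Surjective (dsrc EM EG g) :=
  submersion_surjective hG.isSubmersion_src (Arrows.of g)

theorem finrank_ker_dsrc [FiniteDimensional ℝ EG] {x y : M} (g : x ⟶ y) :
    Module.finrank ℝ (LinearMap.ker (dsrc EM EG g)) = algRank EM EG := by
  have : FiniteDimensional ℝ (TangentSpace 𝓘(ℝ, EG) (Arrows.of g)) :=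
    inferInstanceAs (FiniteDimensional ℝ EG)
  have h := LinearMap.finrank_range_add_finrank_ker (dsrc EM EG g)
  rw [LinearMap.range_eq_top.2 (dsrc_surjective EM EG g), finrank_top] at h
  change Module.finrank ℝ EM + _ = Module.finrank ℝ EG at h
  unfold algRank
  omega

theorem rightTranslation_spec {x y : M} (g : x ⟶ y) :
    Function.Injective (rightTranslation EM EG g) ∧
      ∀ v, dsrc EM EG g (rightTranslation EM EG g v) = 0 := by
  let f : Arrows M → Arrows M := fun h => h.mul (Arrows.of g)
  let f' : Arrows M → Arrows M := fun h => h.mul (Arrows.of (Groupoid.inv g))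
  let s : Set (Arrows M) := Arrows.src ⁻¹' {y}
  let s' : Set (Arrows M) := Arrows.src ⁻¹' {x}
  have hf0 : f (Arrows.unit y) = Arrows.of g := by
    have := Arrows.mul_of (𝟙 y) g
    simpa using this
  have hfs : ∀ h ∈ s, f h ∈ s' := fun h hh => Arrows.src_mul _ _ hh
  let D : EG →L[ℝ] EG := mfderivWithin 𝓘(ℝ, EG) 𝓘(ℝ, EG) f s (Arrows.unit y)
  let D' : EG →L[ℝ] EG := mfderivWithin 𝓘(ℝ, EG) 𝓘(ℝ, EG) f' s' (f (Arrows.unit y))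
  have h1 : HasMFDerivWithinAt 𝓘(ℝ, EG) 𝓘(ℝ, EG) f s (Arrows.unit y) D :=
    (mdifferentiableWithinAt_mul hG g (Arrows.unit y) rfl).hasMFDerivWithinAt
  have h2 : HasMFDerivWithinAt 𝓘(ℝ, EG) 𝓘(ℝ, EG) f' s' (f (Arrows.unit y)) D' :=
    (mdifferentiableWithinAt_mul hG (Groupoid.inv g) (f (Arrows.unit y))
      (hfs _ rfl)).hasMFDerivWithinAt
  let S : EG →L[ℝ] EM := mfderiv 𝓘(ℝ, EG) 𝓘(ℝ, EM) Arrows.src (Arrows.of g)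
  have h3 : HasMFDerivAt 𝓘(ℝ, EG) 𝓘(ℝ, EM) Arrows.src (f (Arrows.unit y)) S := by
    rw [hf0]
    exact (hG.isSubmersion_src.contMDiff.mdifferentiable (by simp) _).hasMFDerivAt
  have key : ∀ v : EG, mfderiv 𝓘(ℝ, EG) 𝓘(ℝ, EM) Arrows.src (Arrows.unit y) v = 0 →
      D' (D v) = v ∧ S (D v) = 0 := by
    intro v hv
    obtain ⟨γ, hγ0, hγs, hγ⟩ := submersion_ker hG.isSubmersion_src (Arrows.unit y) v hv
    have hmem : γ ⁻¹' s ∈ 𝓝 (0 : ℝ) := hγs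
    have h1' : HasMFDerivWithinAt 𝓘(ℝ, EG) 𝓘(ℝ, EG) f s (γ 0) D := by rw [hγ0]; exact h1
    have h2' : HasMFDerivWithinAt 𝓘(ℝ, EG) 𝓘(ℝ, EG) f' s' ((f ∘ γ) 0) D' := by
      show HasMFDerivWithinAt 𝓘(ℝ, EG) 𝓘(ℝ, EG) f' s' (f (γ 0)) D'
      rw [hγ0]; exact h2
    have h3' : HasMFDerivAt 𝓘(ℝ, EG) 𝓘(ℝ, EM) Arrows.src ((f ∘ γ) 0) S := by
      show HasMFDerivAt 𝓘(ℝ, EG) 𝓘(ℝ, EM) Arrows.src (f (γ 0)) S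
      rw [hγ0]; exact h3
    have a1 : HasMFDerivWithinAt 𝓘(ℝ, ℝ) 𝓘(ℝ, EG) (f ∘ γ) (γ ⁻¹' s) 0
        (D.comp (ContinuousLinearMap.toSpanSingleton ℝ v)) :=
      h1'.comp 0 hγ.hasMFDerivWithinAt subset_rfl
    have a2 : HasMFDerivWithinAt 𝓘(ℝ, ℝ) 𝓘(ℝ, EG) (f' ∘ (f ∘ γ)) (γ ⁻¹' s) 0
        (D'.comp (D.comp (ContinuousLinearMap.toSpanSingleton ℝ v))) :=
      h2'.comp 0 a1 (fun τ hτ => hfs _ hτ)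
    have a3 : HasMFDerivAt 𝓘(ℝ, ℝ) 𝓘(ℝ, EM) (Arrows.src ∘ (f ∘ γ)) 0
        (S.comp (D.comp (ContinuousLinearMap.toSpanSingleton ℝ v))) :=
      h3'.comp 0 (a1.hasMFDerivAt hmem)
    have e1 : f' ∘ (f ∘ γ) =ᶠ[𝓝 0] γ := by
      filter_upwards [hmem] with τ hτ using Arrows.mul_of_inv_cancel g (γ τ) hτ
    have e2 : Arrows.src ∘ (f ∘ γ) =ᶠ[𝓝 0] fun _ => x := by
      filter_upwards [hmem] with τ hτ using hfs _ hτ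
    constructor
    · have := hasMFDerivAt_unique ((a2.hasMFDerivAt hmem).congr_of_eventuallyEq e1.symm) hγ
      have h4 := DFunLike.congr_fun this (1 : ℝ)
      have h5 : D' (D ((1 : ℝ) • v)) = (1 : ℝ) • v := h4
      simpa using h5
    · have := hasMFDerivAt_unique (a3.congr_of_eventuallyEq e2.symm)
        (hasMFDerivAt_const (I := 𝓘(ℝ, ℝ)) (I' := 𝓘(ℝ, EM)) x (0 : ℝ))
      have h4 := DFunLike.congr_fun this (1 : ℝ)
      have h5 : S (D ((1 : ℝ) • v)) = 0 := h4
      simpa using h5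
  refine ⟨fun v w h => Subtype.ext ?_, fun v => (key v.1 v.2).2⟩
  have h4 : D v.1 = D w.1 := h
  rw [← (key v.1 v.2).1, h4, (key w.1 w.2).1]

theorem nonempty_algFrame [FiniteDimensional ℝ EG] (x : M) :
    Nonempty (Frame (algRank EM EG) (algFiber EM EG x)) := by
  have : FiniteDimensional ℝ (TangentSpace 𝓘(ℝ, EG) (Arrows.unit x)) :=
    inferInstanceAs (FiniteDimensional ℝ EG)
  have h : Module.finrank ℝ (algFiber EM EG x) = algRank EM EG := finrank_ker_dsrc EM EG (𝟙 x)
  exact ⟨(Module.finBasisOfFinrankEq ℝ _ h).equivFun.symm⟩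

theorem exact_rightTranslation [FiniteDimensional ℝ EG] {x y : M} (g : x ⟶ y) :
    Function.Exact (rightTranslation EM EG g) (dsrc EM EG g) := by
  have : FiniteDimensional ℝ (TangentSpace 𝓘(ℝ, EG) (Arrows.of g)) :=
    inferInstanceAs (FiniteDimensional ℝ EG)
  obtain ⟨h1, h2⟩ := rightTranslation_spec EM EG g
  rw [LinearMap.exact_iff]
  symm
  refine Submodule.eq_of_le_of_finrank_eq ?_ ?_
  · rintro _ ⟨v, rfl⟩
    exact h2 v
  · rw [LinearMap.finrank_range_of_inj h1, finrank_ker_dsrc]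
    exact finrank_ker_dsrc EM EG (𝟙 y)

/-- The short exact sequence `0 → A_y → T_g 𝒢 → T_x M → 0` of an arrow `g : x ⟶ y`. -/
theorem shortExact_arrow [FiniteDimensional ℝ EG] {x y : M} (g : x ⟶ y) :
    ShortExact (rightTranslation EM EG g) (dsrc EM EG g) :=
  ⟨(rightTranslation_spec EM EG g).1, exact_rightTranslation EM EG g, dsrc_surjective EM EG g⟩

/-- The isomorphism `T_g 𝒢 ≅ T_{g⁻¹} 𝒢` given by the differential of the inversion. -/
def dinv [FiniteDimensional ℝ EG] {x y : M} (g : x ⟶ y) :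
    TangentSpace 𝓘(ℝ, EG) (Arrows.of g) ≃ₗ[ℝ]
      TangentSpace 𝓘(ℝ, EG) (Arrows.of (Groupoid.inv g)) :=
  LinearEquiv.ofBijective
    (mfderiv 𝓘(ℝ, EG) 𝓘(ℝ, EG) Arrows.inv (Arrows.of g)).toLinearMap (dinv_bijective EM EG hG _)

variable [FiniteDimensional ℝ EM] [FiniteDimensional ℝ EG]

theorem exists_smoothFrame_alg (x₀ : M) : ∃ (U : Opens M)
    (a : ∀ x : M, Frame (algRank EM EG) (algFiber EM EG x)), x₀ ∈ U ∧
      IsSmoothFrameOn (EM := EM) Arrows.unit (fun x => (algFiber EM EG x).subtype) U a := by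
  obtain ⟨F, _, _, l, e, k, he, hp, -, hD⟩ :=
    submersion_local hG.isSubmersion_src (Arrows.unit x₀)
  have hm := mdifferentiable_of_mem_maximalAtlas he
  have : FiniteDimensional ℝ (EM × F) := Module.Finite.equiv l.toLinearEquiv
  have : FiniteDimensional ℝ F :=
    Module.Finite.of_surjective (LinearMap.snd ℝ EM F) LinearMap.snd_surjective
  have hF : Module.finrank ℝ F = algRank EM EG := by
    have := l.toLinearEquiv.finrank_eq
    rw [Module.finrank_prod] at this
    unfold algRank
    omega
  let b : (Fin (algRank EM EG) → ℝ) ≃ₗ[ℝ] F := (Module.finBasisOfFinrankEq ℝ F hF).equivFun.symm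
  have key : ∀ x : M, ∃ a : Frame (algRank EM EG) (algFiber EM EG x),
      Arrows.unit x ∈ e.source → ∀ c, ((a c).1 : EG) =
        mfderiv 𝓘(ℝ, EG) 𝓘(ℝ, EG) e.symm (e (Arrows.unit x)) (l.symm (0, b c)) := by
    intro x
    by_cases hx : Arrows.unit x ∈ e.source
    · have hz := e.map_source hx
      obtain ⟨D, hD⟩ := hD _ hz
      rw [e.left_inv hx] at hD
      let Φ : EG →L[ℝ] EG := mfderiv 𝓘(ℝ, EG) 𝓘(ℝ, EG) e.symm (e (Arrows.unit x))
      have hΦ : Function.Injective Φ := (hm.symm.mfderiv hz).injective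
      let T : (Fin (algRank EM EG) → ℝ) →ₗ[ℝ] EG :=
        Φ.toLinearMap ∘ₗ l.symm.toLinearEquiv.toLinearMap ∘ₗ LinearMap.inr ℝ EM F ∘ₗ b.toLinearMap
      have hT : Function.Injective T := by
        have h1 : Function.Injective fun c => ((0 : EM), b c) := fun c d h =>
          b.injective (congrArg Prod.snd h)
        exact hΦ.comp (l.symm.injective.comp h1)
      have hmem : ∀ c, T c ∈ algFiber EM EG x := by
        intro c
        have h1 : (l (l.symm (0, b c))).1 = 0 := by simp
        have h2 := hD (l.symm (0, b c))
        rw [h1] at h2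
        have h3 : D 0 = 0 := map_zero D
        exact h2.trans h3
      let T' : (Fin (algRank EM EG) → ℝ) →ₗ[ℝ] algFiber EM EG x :=
        LinearMap.codRestrict (M₂ := TangentSpace 𝓘(ℝ, EG) (Arrows.unit x)) _ T hmem
      have hT' : Function.Injective T' := fun c d h => hT (congrArg Subtype.val h)
      have hd : Module.finrank ℝ (algFiber EM EG x) = algRank EM EG :=
        finrank_ker_dsrc EM EG (𝟙 x)
      have : FiniteDimensional ℝ (TangentSpace 𝓘(ℝ, EG) (Arrows.unit x)) :=
        inferInstanceAs (FiniteDimensional ℝ EG)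
      exact ⟨LinearEquiv.ofBijective T' ⟨hT',
        (LinearMap.injective_iff_surjective_of_finrank_eq_finrank (by simp [hd])).1 hT'⟩,
        fun _ c => rfl⟩
    · exact ⟨(nonempty_algFrame EM EG x).some, fun h => absurd h hx⟩
  choose a ha using key
  refine ⟨⟨Arrows.unit ⁻¹' e.source, e.open_source.preimage hG.contMDiff_unit.continuous⟩, a, hp,
    fun c => ?_⟩
  refine (contMDiffOn_chart_field hG.contMDiff_unit he (l.symm (0, b c))).congr ?_
  intro x hx
  refine TotalSpace.ext (e.left_inv hx).symm (heq_of_eq ?_)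
  exact ha x hx c

/-- The line bundle `L_χ(A^*)`. Its local trivializations are the evaluations on the dual frames
of the smooth local frames of `A`, a section of `A` being smooth if it is smooth as a map to the
tangent bundle of the space of arrows. -/
def dualAlgLine (χ : ℝ →*₀ ℝ) [SmoothChar χ] : LineBundle EM M where
  Fiber x := Line (detChar χ (algRank EM EG)) (Module.Dual ℝ (algFiber EM EG x))
  triv := {θ | ∃ a : ∀ x : M, Frame (algRank EM EG) (algFiber EM EG x),
    IsSmoothFrameOn (EM := EM) Arrows.unit (fun x => (algFiber EM EG x).subtype) θ.1 a ∧
      θ.2 = fun x => Line.eval _ (dualFrame (a x))}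
  exists_mem_triv x := by
    obtain ⟨U, a, hx, ha⟩ := exists_smoothFrame_alg EM EG x
    exact ⟨(U, fun x => Line.eval _ (dualFrame (a x))), ⟨a, ha, rfl⟩, hx⟩
  contMDiffOn_transition := by
    rintro ⟨U, φ⟩ ⟨a, ha, rfl⟩ ⟨U', ψ⟩ ⟨b, hb, rfl⟩
    refine (contMDiffOn_char_det χ (fun _ => Subtype.val_injective) ha hb).congr ?_
    intro x _
    refine (mul_one _).trans ?_
    rw [detChar_apply, det_dualFrame]

/-- The bundle `L_χ^tr = L_χ(A^*) ⊗ L_χ(TM)`. -/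
def trLine (χ : ℝ →*₀ ℝ) [SmoothChar χ] : LineBundle EM M :=
  (dualAlgLine EM EG χ).tensor (tangentLine EM M χ)

/-- For `g : x ⟶ y`, the map `L_χ(A_x^*) ⊗ L_χ(T_x M) → L_χ(A_y^*) ⊗ L_χ(T_y M)` induced by
`L_χ(A_y) ⊗ L_χ(T_x M) ≅ L_χ(T_g 𝒢) ≅ L_χ(T_{g⁻¹} 𝒢) ≅ L_χ(A_x) ⊗ L_χ(T_y M)`, where the middle
isomorphism is given by the differential of the inversion and the outer ones by the short exact
sequences `0 → A_y → T_g 𝒢 → T_x M → 0` and `0 → A_x → T_{g⁻¹} 𝒢 → T_y M → 0`. -/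
def rawAction (χ : ℝ →*₀ ℝ) [SmoothChar χ] (x y : M) (g : x ⟶ y) :
    (trLine EM EG χ : LineBundle EM M).Fiber x →ₗ[ℝ] (trLine EM EG χ : LineBundle EM M).Fiber y :=
  Line.transport χ (shortExact_arrow EM EG g) (shortExact_arrow EM EG (Groupoid.inv g))
    (dinv EM EG g) (nonempty_algFrame EM EG y) (nonempty_tangentFrame x)
    (nonempty_algFrame EM EG x) (nonempty_tangentFrame y)

/-- The canonical action of the groupoid on `L_χ^tr`. The differential of the inversion at a unit
is the identity on the tangent space of the objects and `-1` on the quotient `A`; the factor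
`χ((-1)^r)`, `r` being the rank of `A`, makes the units act by the identity. It is `1` in the case
of densities. -/
def trAction (χ : ℝ →*₀ ℝ) [SmoothChar χ] (x y : M) (g : x ⟶ y) :
    (trLine EM EG χ : LineBundle EM M).Fiber x →ₗ[ℝ] (trLine EM EG χ : LineBundle EM M).Fiber y :=
  χ ((-1) ^ algRank EM EG) • rawAction EM EG χ x y g

theorem trAction_absChar (x y : M) (g : x ⟶ y) :
    trAction EM EG absChar x y g = rawAction EM EG absChar x y g := by
  have : absChar ((-1) ^ algRank EM EG) = 1 := by
    show |(-1 : ℝ) ^ algRank EM EG| = 1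
    simp
  rw [trAction, this, one_smul]

end Groupoids

section Representations

variable {EM EG M : Type*} [Groupoid M]
    [NormedAddCommGroup EM] [NormedSpace ℝ EM] [NormedAddCommGroup EG] [NormedSpace ℝ EG]
    [TopologicalSpace M] [ChartedSpace EM M]
    [TopologicalSpace (Arrows M)] [ChartedSpace EG (Arrows M)]

/-- The candidates for representations of a groupoid on a line bundle: families of linear maps
`g_* : L_x → L_y`, one for each arrow `g : x ⟶ y`. -/
abbrev ArrowMaps (L : LineBundle EM M) := ∀ x y : M, (x ⟶ y) → (L.Fiber x →ₗ[ℝ] L.Fiber y)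

/-- The tensor product action. -/
def ArrowMaps.tensor {L L' : LineBundle EM M} (ρ : ArrowMaps L) (ρ' : ArrowMaps L') :
    ArrowMaps (L.tensor L') :=
  fun x y g => TensorProduct.map (ρ x y g) (ρ' x y g)

/-- The dual action, `g · l = l ∘ (g⁻¹)_*`. -/
def ArrowMaps.dual {L : LineBundle EM M} (ρ : ArrowMaps L) : ArrowMaps L.dual :=
  fun x y g => (ρ y x (Groupoid.inv g)).dualMap

variable (EM M) in
/-- The trivial action on the trivial line bundle. -/
def ArrowMaps.trivial : ArrowMaps (LineBundle.trivial EM M) := fun _ _ _ => LinearMap.id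

/-- The linear isomorphisms `Φ` of the fibres commute with the maps `ρ` and `ρ'`. -/
def Intertwines {L L' : LineBundle EM M} (ρ : ArrowMaps L) (ρ' : ArrowMaps L')
    (Φ : ∀ x, L.Fiber x ≃ₗ[ℝ] L'.Fiber x) : Prop :=
  ∀ (x y : M) (g : x ⟶ y) (v : L.Fiber x), Φ y (ρ x y g v) = ρ' x y g (Φ x v)

/-- The linear isomorphisms `Φ` of the fibres form an isomorphism of smooth line bundles. -/
structure IsBundleIso {L L' : LineBundle EM M} (Φ : ∀ x, L.Fiber x ≃ₗ[ℝ] L'.Fiber x) : Prop where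
  contMDiff : ContMDiff (𝓘(ℝ, EM).prod 𝓘(ℝ, ℝ)) (𝓘(ℝ, EM).prod 𝓘(ℝ, ℝ)) ∞
    (fun p : TotalSpace ℝ L.Fiber => (⟨p.1, Φ p.1 p.2⟩ : TotalSpace ℝ L'.Fiber))
  contMDiff_symm : ContMDiff (𝓘(ℝ, EM).prod 𝓘(ℝ, ℝ)) (𝓘(ℝ, EM).prod 𝓘(ℝ, ℝ)) ∞
    (fun p : TotalSpace ℝ L'.Fiber => (⟨p.1, (Φ p.1).symm p.2⟩ : TotalSpace ℝ L.Fiber))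

variable [IsManifold 𝓘(ℝ, EM) ∞ M] [IsManifold 𝓘(ℝ, EG) ∞ (Arrows M)]

/-- The source as a continuous map. -/
def srcMap (hG : LieGroupoid EM EG M) : C(Arrows M, M) :=
  ⟨Arrows.src, hG.isSubmersion_src.contMDiff.continuous⟩

/-- `ρ` is a representation of the Lie groupoid on the line bundle `L`: it respects units and
products, and the map `s^* L → L` that sends `v` over the arrow `g` to `g_* v` is smooth. -/
structure IsRepresentation (hG : LieGroupoid EM EG M) {L : LineBundle EM M} (ρ : ArrowMaps L) :
    Prop where
  map_id : ∀ x, ρ x x (𝟙 x) = LinearMap.id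
  map_comp : ∀ (x y z : M) (g : x ⟶ y) (h : y ⟶ z), ρ x z (g ≫ h) = ρ y z h ∘ₗ ρ x y g
  contMDiff : ContMDiff (𝓘(ℝ, EG).prod 𝓘(ℝ, ℝ)) (𝓘(ℝ, EM).prod 𝓘(ℝ, ℝ)) ∞
    (fun p : TotalSpace ℝ ((srcMap hG : Arrows M → M) *ᵖ L.Fiber) =>
      (⟨p.1.tgt, ρ p.1.src p.1.tgt p.1.hom p.2⟩ : TotalSpace ℝ L.Fiber))

/-- `Φ` is an isomorphism between the representations `ρ` and `ρ'`. -/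
structure IsRepresentationIso (hG : LieGroupoid EM EG M) {L L' : LineBundle EM M}
    (ρ : ArrowMaps L) (ρ' : ArrowMaps L') (Φ : ∀ x, L.Fiber x ≃ₗ[ℝ] L'.Fiber x) : Prop where
  left : IsRepresentation hG ρ
  right : IsRepresentation hG ρ'
  isBundleIso : IsBundleIso Φ
  intertwines : Intertwines ρ ρ' Φ

end Representations

section CanonicalIsomorphisms

theorem detChar_mul {χ ψ κ : ℝ →*₀ ℝ} (h : χ * ψ = κ) (r : ℕ) :
    detChar χ r * detChar ψ r = detChar κ r := by
  subst h; ext A; rfl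

theorem detChar_one (r : ℕ) : detChar 1 r = 1 := by
  ext A
  exact MonoidWithZeroHom.one_apply_of_ne_zero (LinearEquiv.det A).ne_zero

theorem idChar_mul_signChar : idChar * signChar = absChar := by
  ext a
  exact self_mul_sign a

theorem absChar_mul_signChar : absChar * signChar = idChar := by
  ext a
  exact abs_mul_sign a

theorem signChar_mul_signChar : signChar * signChar = 1 := by
  ext a
  rcases eq_or_ne a 0 with rfl | ha
  · simp
  · rw [MonoidWithZeroHom.one_apply_of_ne_zero ha]
    rcases lt_or_gt_of_ne ha with h | h
    · show (SignType.sign a : ℝ) * (SignType.sign a : ℝ) = 1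
      simp [sign_neg h]
    · show (SignType.sign a : ℝ) * (SignType.sign a : ℝ) = 1
      simp [sign_pos h]

/-- An isomorphism `P ⊗ P ≅ ℝ`, with `P` of dimension one, gives `P ≅ P^*`. -/
theorem curry_bijective {P : Type*} [AddCommGroup P] [Module ℝ P] (φ : P ≃ₗ[ℝ] ℝ)
    (T : P ⊗[ℝ] P ≃ₗ[ℝ] ℝ) :
    Function.Bijective (TensorProduct.curry T.toLinearMap : P →ₗ[ℝ] Module.Dual ℝ P) := by
  have : Module.Finite ℝ P := Module.Finite.equiv φ.symm
  have hinj : Function.Injective (TensorProduct.curry T.toLinearMap : P →ₗ[ℝ] Module.Dual ℝ P) := by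
    rw [injective_iff_map_eq_zero]
    intro p hp
    have h1 : T (p ⊗ₜ p) = 0 := LinearMap.congr_fun hp p
    have h2 : p ⊗ₜ[ℝ] p = 0 := by simpa using h1
    have h3 := congrArg (TensorProduct.congr φ φ ≪≫ₗ TensorProduct.lid ℝ ℝ) h2
    have h4 : φ p * φ p = 0 := by simpa using h3
    simpa using h4
  exact ⟨hinj, (LinearMap.injective_iff_surjective_of_finrank_eq_finrank
    (Subspace.dual_finrank_eq).symm).1 hinj⟩

variable (EM EG : Type*) {M : Type*} [Groupoid M]
    [NormedAddCommGroup EM] [NormedSpace ℝ EM] [NormedAddCommGroup EG] [NormedSpace ℝ EG]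
    [TopologicalSpace M] [ChartedSpace EM M]
    [TopologicalSpace (Arrows M)] [ChartedSpace EG (Arrows M)]
    [IsManifold 𝓘(ℝ, EM) ∞ M] [IsManifold 𝓘(ℝ, EG) ∞ (Arrows M)] [hG : LieGroupoid EM EG M]
    [FiniteDimensional ℝ EG]

theorem nonempty_dualAlgFrame (x : M) :
    Nonempty (Frame (algRank EM EG) (Module.Dual ℝ (algFiber EM EG x))) :=
  (nonempty_algFrame EM EG x).map dualFrame

variable [FiniteDimensional ℝ EM]

/-- The isomorphism `L_χ^tr ⊗ L_ψ^tr ≅ L_χψ^tr` obtained from the pointwise multiplications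
`L_χ(A^*) ⊗ L_ψ(A^*) ≅ L_χψ(A^*)` and `L_χ(TM) ⊗ L_ψ(TM) ≅ L_χψ(TM)`. -/
def trMulIso {χ ψ κ : ℝ →*₀ ℝ} [SmoothChar χ] [SmoothChar ψ] [SmoothChar κ] (h : χ * ψ = κ)
    (x : M) : ((trLine EM EG χ).tensor (trLine EM EG ψ) : LineBundle EM M).Fiber x ≃ₗ[ℝ]
      (trLine EM EG κ : LineBundle EM M).Fiber x :=
  TensorProduct.tensorTensorTensorComm ℝ
      (Line (detChar χ (algRank EM EG)) (Module.Dual ℝ (algFiber EM EG x)))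
      (Line (detChar χ (Module.finrank ℝ EM)) (TangentSpace 𝓘(ℝ, EM) x))
      (Line (detChar ψ (algRank EM EG)) (Module.Dual ℝ (algFiber EM EG x)))
      (Line (detChar ψ (Module.finrank ℝ EM)) (TangentSpace 𝓘(ℝ, EM) x)) ≪≫ₗ
    TensorProduct.congr (Line.mulIso (detChar_mul h _) (nonempty_dualAlgFrame EM EG x))
      (Line.mulIso (detChar_mul h _) (nonempty_tangentFrame x))

variable (M)

/-- The transverse density bundle `𝒟^tr = 𝒟(A^*) ⊗ 𝒟(TM)`. -/
abbrev densityTr : LineBundle EM M := trLine EM EG absChar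

/-- The transverse volume bundle `𝒱^tr = 𝒱(A^*) ⊗ 𝒱(TM)`. -/
abbrev volumeTr : LineBundle EM M := trLine EM EG idChar

/-- The transverse orientation bundle `𝔬^tr = 𝔬(A^*) ⊗ 𝔬(TM)`. -/
abbrev orientationTr : LineBundle EM M := trLine EM EG signChar

/-- The canonical isomorphism `𝒟^tr ≅ 𝒱^tr ⊗ 𝔬^tr`. -/
def densityIso (x : M) : (densityTr EM EG M).Fiber x ≃ₗ[ℝ]
    ((volumeTr EM EG M).tensor (orientationTr EM EG M)).Fiber x :=
  (trMulIso EM EG idChar_mul_signChar x).symm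

/-- The canonical isomorphism `𝒱^tr ≅ 𝒟^tr ⊗ 𝔬^tr`. -/
def volumeIso (x : M) : (volumeTr EM EG M).Fiber x ≃ₗ[ℝ]
    ((densityTr EM EG M).tensor (orientationTr EM EG M)).Fiber x :=
  (trMulIso EM EG absChar_mul_signChar x).symm

/-- The canonical isomorphism of `𝔬^tr ⊗ 𝔬^tr` with the trivial line bundle. -/
def orientationSquareIso (x : M) :
    ((orientationTr EM EG M).tensor (orientationTr EM EG M)).Fiber x ≃ₗ[ℝ]
      (LineBundle.trivial EM M).Fiber x :=
  TensorProduct.tensorTensorTensorComm ℝ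
      (Line (detChar signChar (algRank EM EG)) (Module.Dual ℝ (algFiber EM EG x)))
      (Line (detChar signChar (Module.finrank ℝ EM)) (TangentSpace 𝓘(ℝ, EM) x))
      (Line (detChar signChar (algRank EM EG)) (Module.Dual ℝ (algFiber EM EG x)))
      (Line (detChar signChar (Module.finrank ℝ EM)) (TangentSpace 𝓘(ℝ, EM) x)) ≪≫ₗ
    TensorProduct.congr
      (Line.mulIso ((detChar_mul signChar_mul_signChar _).trans (detChar_one _))
          (nonempty_dualAlgFrame EM EG x) ≪≫ₗ Line.constIso (nonempty_dualAlgFrame EM EG x))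
      (Line.mulIso ((detChar_mul signChar_mul_signChar _).trans (detChar_one _))
          (nonempty_tangentFrame x) ≪≫ₗ Line.constIso (nonempty_tangentFrame x)) ≪≫ₗ
    TensorProduct.lid ℝ ℝ

/-- The canonical isomorphism `𝔬^tr ≅ (𝔬^tr)^*` given by the pairing
`𝔬^tr ⊗ 𝔬^tr → ℝ`. -/
def orientationDualIso (x : M) : (orientationTr EM EG M).Fiber x ≃ₗ[ℝ]
    (orientationTr EM EG M).dual.Fiber x :=
  LinearEquiv.ofBijective
    (TensorProduct.curry (orientationSquareIso EM EG M x).toLinearMap)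
    (curry_bijective (((orientationTr EM EG M).exists_mem_triv x).choose.2 x)
      (orientationSquareIso EM EG M x))

end CanonicalIsomorphisms

end TransverseBundles

end

/-! Fix frames `a`, `b` of `A_x`, `T_x M` and `a'`, `b'` of `A_y`, `T_y M`. Evaluation on the dual
frame of `a` and on `b` identifies the fibre of every `L_χ^tr` at `x` with `ℝ`, and likewise at `y`.
In these coordinates `g_♯` is multiplication by `χ(D_g)` for a nonzero number `D_g` that does not
involve `χ` (`trEval_rawAction`). Here `D_g` is `arrowDet`: inversion carries the sequence at `g⁻¹`
to a sequence `0 → A_x → T_g 𝒢 → T_y M → 0`, and `D_g` is the determinant of a frame adapted to it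
relative to a frame adapted to `0 → A_y → T_g 𝒢 → T_x M → 0`. In the same coordinates the canonical
isomorphisms are products of real numbers. Hence they commute with the arrows because `id · sign =
|·|`, `|·| · sign = id` and `sign · sign = 1`; for the dual one also needs `D_{g⁻¹} D_g = 1`. What
remains is that `(-1)^r D_g` is multiplicative, is `1` at units, and is smooth in `g`.

Multiplicativity (`frameDet_composition`): the tangent space `E` of the composable pairs at `(g, h)`
contains copies of `A_z`, `A_x` and `A_y`, with quotients `T_h 𝒢`, `T_g 𝒢` and `T_{gh} 𝒢`. Lifting
the frames of the three quotients to `E` and passing between the three filtrations costs three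
exchanges of blocks of size `r`, so `D_{gh} = β³ D_g D_h` with `β` the determinant of an exchange.
At a unit the unit map splits `T𝒢` into `A` and `TM`, and inversion is `-1` on `A` modulo `TM`, so
`D_1 = (-1)^r` (`arrowDet_id`). Applying the product formula to `1 · 1 = 1` yields `β³ = (-1)^r`.

Smoothness (`contMDiffOn_arrowDet`): right-invariant vector fields of smooth sections of `A`,
together with coordinate fields transverse to the source fibres, give smooth adapted frames, and
determinants between smooth frames are smooth.

Right translation and multiplication are differentiated within sets that need not be open, where
only vectors tangent to curves in the set are under control. Identities between their differentials
are therefore obtained by following curves (`HasVelocity`). -/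

namespace TransverseBundles

/-! ### Relative determinants of frames -/

section FrameDeterminants

variable {r m n : ℕ} {V W U : Type*} [AddCommGroup V] [Module ℝ V] [AddCommGroup W] [Module ℝ W]
  [AddCommGroup U] [Module ℝ U]

/-- The determinant of the frame `u` with respect to the frame `v`. -/
noncomputable def frameDet (u v : Frame r V) : ℝˣ := LinearEquiv.det (u.trans v.symm)

theorem frameDet_mul (u v w : Frame r V) : frameDet u v * frameDet v w = frameDet u w := by
  unfold frameDet
  rw [mul_comm, ← map_mul]
  congr 1
  ext x
  simp [LinearEquiv.mul_apply]

@[simp]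
theorem frameDet_self (u : Frame r V) : frameDet u u = 1 := by
  unfold frameDet
  rw [LinearEquiv.self_trans_symm]
  exact map_one _

theorem frameDet_trans_left (A : GLr r) (u v : Frame r V) :
    frameDet (A.trans u) v = LinearEquiv.det A * frameDet u v := by
  unfold frameDet
  rw [mul_comm, ← map_mul]
  rfl

theorem frameDet_isAdapted {i : V →ₗ[ℝ] U} {p : U →ₗ[ℝ] W}
    {e e' : Frame m V} {f f' : Frame n W} {u u' : Frame (m + n) U} (hu : IsAdapted i p e f u)
    (hu' : IsAdapted i p e' f' u') : frameDet u' u = frameDet e' e * frameDet f' f :=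
  det_isAdapted hu hu'

theorem exists_eq_append (x : Fin (m + n) → ℝ) :
    ∃ (c : Fin m → ℝ) (d : Fin n → ℝ), x = Fin.append c d :=
  ⟨fun j => x (Fin.castAdd n j), fun j => x (Fin.natAdd m j), (Fin.append_castAdd_natAdd).symm⟩

/-- A linear map from `ℝ^(m+n)` that satisfies the conditions of an adapted frame is bijective. -/
theorem exists_isAdapted_eq {i : V →ₗ[ℝ] U} {p : U →ₗ[ℝ] W} (h : ShortExact i p)
    (e : Frame m V) (f : Frame n W) (T : (Fin (m + n) → ℝ) →ₗ[ℝ] U)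
    (hT : ∀ c, T (Fin.append c 0) = i (e c)) (hT' : ∀ c d, p (T (Fin.append c d)) = f d) :
    ∃ u : Frame (m + n) U, IsAdapted i p e f u ∧ ∀ x, u x = T x := by
  obtain ⟨u, hu⟩ := exists_isAdapted h e f
  have hinj : Function.Injective T := by
    rw [injective_iff_map_eq_zero]
    intro x hx
    obtain ⟨c, d, rfl⟩ := exists_eq_append x
    have h1 : f d = 0 := by rw [← hT' c d, hx, map_zero]
    obtain rfl : d = 0 := by simpa using h1
    rw [hT] at hx
    have hc : c = 0 := by
      have := h.injective (hx.trans (map_zero i).symm)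
      simpa using this
    -- Injectivity of the auxiliary adapted frame `u` gives that two zero blocks append to zero.
    rw [hc, ← u.map_eq_zero_iff, hu.1]
    simp
  have : Module.Finite ℝ U := Module.Finite.equiv u
  have hd : Module.finrank ℝ (Fin (m + n) → ℝ) = Module.finrank ℝ U := u.finrank_eq
  exact ⟨LinearEquiv.ofBijective T
    ⟨hinj, (LinearMap.injective_iff_surjective_of_finrank_eq_finrank hd).1 hinj⟩, ⟨hT, hT'⟩,
    fun _ => rfl⟩

end FrameDeterminants

/-! ### The transport map in coordinates -/

section TransportFormula

variable {r m n : ℕ} {V W U V' W' U' : Type*} [AddCommGroup V] [Module ℝ V] [AddCommGroup W]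
  [Module ℝ W] [AddCommGroup U] [Module ℝ U] [AddCommGroup V'] [Module ℝ V'] [AddCommGroup W']
  [Module ℝ W'] [AddCommGroup U'] [Module ℝ U']

/-- Evaluation on a pair of frames. -/
noncomputable def Line.eval₂ (δ : GLr m →* ℝˣ) (δ' : GLr n →* ℝˣ) (e : Frame m V) (f : Frame n W) :
    Line δ V ⊗[ℝ] Line δ' W ≃ₗ[ℝ] ℝ :=
  TensorProduct.congr (Line.eval δ e) (Line.eval δ' f) ≪≫ₗ TensorProduct.lid ℝ ℝ

theorem Line.eval₂_tmul (δ : GLr m →* ℝˣ) (δ' : GLr n →* ℝˣ) (e : Frame m V) (f : Frame n W)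
    (α : Line δ V) (β : Line δ' W) : Line.eval₂ δ δ' e f (α ⊗ₜ β) = α.1 e * β.1 f := rfl

/-- On an adapted frame the isomorphism of the exact sequence becomes the identity of `ℝ`; by
linearity pure tensors suffice. -/
theorem Line.exactIso_symm_apply (χ : ℝ →*₀ ℝ) {i : V →ₗ[ℝ] U} {p : U →ₗ[ℝ] W}
    (h : ShortExact i p) (hV : Nonempty (Frame m V)) (hW : Nonempty (Frame n W))
    (t : Line (detChar χ m) V ⊗[ℝ] Line (detChar χ n) W) {e : Frame m V} {f : Frame n W}
    {u : Frame (m + n) U} (hu : IsAdapted i p e f u) :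
    ((Line.exactIso χ h hV hW).symm t).1 u = Line.eval₂ _ _ e f t := by
  induction t using TensorProduct.induction_on with
  | zero => simp
  | tmul α β => rw [Line.exactIso_symm_tmul χ h hV hW α β hu, Line.eval₂_tmul]
  | add s t hs ht =>
    rw [map_add, map_add, ← hs, ← ht]
    rfl

/-- Both exact sequence isomorphisms turn into evaluations on adapted frames, and `d` turns
evaluation on `u'` into evaluation on `u'.trans d.symm`. The factor comes from comparing that frame
with `u`. -/
theorem Line.eval₂_swapIso (χ : ℝ →*₀ ℝ) {i : V →ₗ[ℝ] U} {p : U →ₗ[ℝ] W} (h : ShortExact i p)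
    {i' : V' →ₗ[ℝ] U'} {p' : U' →ₗ[ℝ] W'} (h' : ShortExact i' p') (d : U ≃ₗ[ℝ] U')
    (hV : Nonempty (Frame m V)) (hW : Nonempty (Frame n W))
    (hV' : Nonempty (Frame m V')) (hW' : Nonempty (Frame n W'))
    {e : Frame m V} {f : Frame n W} {u : Frame (m + n) U} (hu : IsAdapted i p e f u)
    {e' : Frame m V'} {f' : Frame n W'} {u' : Frame (m + n) U'} (hu' : IsAdapted i' p' e' f' u')
    (t : Line (detChar χ m) V ⊗[ℝ] Line (detChar χ n) W) :
    Line.eval₂ _ _ e' f' (Line.swapIso χ h h' d hV hW hV' hW' t) =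
      χ (frameDet (u'.trans d.symm) u : ℝˣ) * Line.eval₂ _ _ e f t := by
  rw [← Line.exactIso_symm_apply χ h' hV' hW' _ hu', ← Line.exactIso_symm_apply χ h hV hW _ hu]
  simp only [Line.swapIso, LinearEquiv.trans_apply, LinearEquiv.symm_apply_apply]
  exact Line.eval_change _ ((Line.exactIso χ h hV hW).symm t) u (u'.trans d.symm)

/-- In terms of frames, `Line.transport` is the multiplication by the character of a
determinant. -/
theorem Line.eval₂_transport (χ : ℝ →*₀ ℝ) {i : V →ₗ[ℝ] U} {p : U →ₗ[ℝ] W} (h : ShortExact i p)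
    {i' : V' →ₗ[ℝ] U'} {p' : U' →ₗ[ℝ] W'} (h' : ShortExact i' p') (d : U ≃ₗ[ℝ] U')
    (hV : Nonempty (Frame m V)) (hW : Nonempty (Frame n W))
    (hV' : Nonempty (Frame m V')) (hW' : Nonempty (Frame n W'))
    {e : Frame m V} {f : Frame n W} {u : Frame (m + n) U} (hu : IsAdapted i p e f u)
    {e' : Frame m V'} {f' : Frame n W'} {u' : Frame (m + n) U'} (hu' : IsAdapted i' p' e' f' u')
    (t : Line (detChar χ m) (Module.Dual ℝ V') ⊗[ℝ] Line (detChar χ n) W) :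
    Line.eval₂ _ _ (dualFrame e) f' (Line.transport χ h h' d hV hW hV' hW' t) =
      χ (frameDet (u'.trans d.symm) u : ℝˣ) * Line.eval₂ _ _ (dualFrame e') f t := by
  set φ := (Line.swapIso χ h h' d hV hW hV' hW').toLinearMap with hφ
  -- The element with value `1` on `e`: pairing a functional with it reads off the coordinate on
  -- `dualFrame e`.
  let p₀ : Line (detChar χ m) V := (Line.eval _ e).symm 1
  have hp₀ : p₀.1 e = 1 := (Line.eval (detChar χ m) e).apply_symm_apply 1
  have h1 : ∀ s : Module.Dual ℝ (Line (detChar χ m) V) ⊗[ℝ] Line (detChar χ n) W',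
      Line.eval₂ _ _ (dualFrame e) f' (TensorProduct.congr (Line.dualIso χ hV).symm
        (LinearEquiv.refl ℝ (Line (detChar χ n) W')) s) =
        Line.eval _ f' (dualTensorHomEquiv ℝ (Line (detChar χ m) V) _ s p₀) := by
    intro s
    induction s using TensorProduct.induction_on with
    | zero => rw [LinearEquiv.map_zero, LinearEquiv.map_zero, LinearEquiv.map_zero,
        LinearMap.zero_apply, LinearEquiv.map_zero]
    | add s t hs ht =>
      rw [LinearEquiv.map_add, LinearEquiv.map_add, LinearEquiv.map_add, LinearMap.add_apply,
        LinearEquiv.map_add, hs, ht]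
    | tmul μ q =>
      have h2 := Line.dualIso_apply χ hV ((Line.dualIso χ hV).symm μ) p₀ e
      rw [hp₀, LinearEquiv.apply_symm_apply, mul_one] at h2
      have h3 : dualTensorHomEquiv ℝ (Line (detChar χ m) V) _ (μ ⊗ₜ[ℝ] q) p₀ = μ p₀ • q := by
        simp
      rw [h3, map_smul, TensorProduct.congr_tmul, Line.eval₂_tmul, ← h2]
      rfl
  have h2 : ∀ (l : Line (detChar χ m) (Module.Dual ℝ V'))
      (s : Line (detChar χ m) V' ⊗[ℝ] Line (detChar χ n) W'),
      Line.eval _ f' (TensorProduct.lid ℝ _ ((Line.dualIso χ hV' l).rTensor _ s)) =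
        l.1 (dualFrame e') * Line.eval₂ _ _ e' f' s := by
    intro l s
    induction s using TensorProduct.induction_on with
    | zero => simp
    | add s t hs ht => simp only [map_add, hs, ht, mul_add]
    | tmul a b =>
      rw [LinearMap.rTensor_tmul, TensorProduct.lid_tmul, map_smul,
        Line.dualIso_apply χ hV' l a e', Line.eval₂_tmul, smul_eq_mul, mul_assoc]
      rfl
  induction t using TensorProduct.induction_on with
  | zero => rw [LinearMap.map_zero, LinearEquiv.map_zero, LinearEquiv.map_zero, mul_zero]
  | add s t hs ht =>
    rw [LinearMap.map_add, LinearEquiv.map_add, LinearEquiv.map_add, hs, ht, mul_add]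
  | tmul l q =>
    unfold Line.transport
    simp only [LinearMap.comp_apply, LinearEquiv.coe_coe]
    rw [h1, TensorProduct.congr_tmul, transposeLeft]
    simp only [LinearMap.comp_apply, LinearEquiv.coe_coe, LinearEquiv.apply_symm_apply]
    rw [TensorProduct.lift.tmul, LinearMap.mk₂_apply]
    simp only [LinearMap.comp_apply, LinearEquiv.coe_coe, LinearEquiv.refl_apply,
      LinearMap.flip_apply, TensorProduct.mk_apply]
    rw [h2, Line.eval₂_swapIso χ h h' d hV hW hV' hW' hu hu', Line.eval₂_tmul, Line.eval₂_tmul,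
      hp₀]
    ring

end TransportFormula

/-! ### Frames adapted to two filtrations -/

section SwappedFrames

variable {r n : ℕ}

/-- The exchange of the first two blocks of `ℝ^r × ℝ^r × ℝ^n`. -/
noncomputable def blockSwap (r n : ℕ) : GLr (r + (r + n)) :=
  LinearEquiv.funCongrLeft ℝ ℝ
    -- The exchanged blocks have equal size, so the permutation is its own inverse.
    { toFun := Fin.addCases (fun i => Fin.natAdd r (Fin.castAdd n i))
        (Fin.addCases (fun i => Fin.castAdd (r + n) i) (fun i => Fin.natAdd r (Fin.natAdd r i)))
      invFun := Fin.addCases (fun i => Fin.natAdd r (Fin.castAdd n i))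
        (Fin.addCases (fun i => Fin.castAdd (r + n) i) (fun i => Fin.natAdd r (Fin.natAdd r i)))
      left_inv := by
        intro i
        refine Fin.addCases (fun i => ?_) (fun i => Fin.addCases (fun i => ?_) (fun i => ?_) i) i <;>
          simp
      right_inv := by
        intro i
        refine Fin.addCases (fun i => ?_) (fun i => Fin.addCases (fun i => ?_) (fun i => ?_) i) i <;>
          simp }

theorem blockSwap_append (a b : Fin r → ℝ) (d : Fin n → ℝ) :
    blockSwap r n (Fin.append a (Fin.append b d)) = Fin.append b (Fin.append a d) := by
  ext i
  simp only [blockSwap, LinearEquiv.funCongrLeft_apply, LinearMap.funLeft_apply, Equiv.coe_fn_mk]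
  refine Fin.addCases (fun i => ?_) (fun i => Fin.addCases (fun i => ?_) (fun i => ?_) i) i <;> simp

variable {V₁ V₂ U₁ U₂ E W : Type*} [AddCommGroup V₁] [Module ℝ V₁] [AddCommGroup V₂] [Module ℝ V₂]
  [AddCommGroup U₁] [Module ℝ U₁] [AddCommGroup U₂] [Module ℝ U₂] [AddCommGroup E] [Module ℝ E]
  [AddCommGroup W] [Module ℝ W]

/-- Two filtrations of `E` with subquotients `V₁, V₂, W` and `V₂, V₁, W`: adapted frames differ by
the exchange of the first two blocks. -/
theorem frameDet_blockSwap {i₁ : V₁ →ₗ[ℝ] E} {p₁ : E →ₗ[ℝ] U₁} {j₁ : V₂ →ₗ[ℝ] U₁}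
    {q₁ : U₁ →ₗ[ℝ] W} {i₂ : V₂ →ₗ[ℝ] E} {p₂ : E →ₗ[ℝ] U₂} {j₂ : V₁ →ₗ[ℝ] U₂} {q₂ : U₂ →ₗ[ℝ] W}
    (hi₁ : ShortExact i₁ p₁) (hi₂ : ShortExact i₂ p₂)
    (hj₂ : ShortExact j₂ q₂) (h₁₂ : ∀ v, p₁ (i₂ v) = j₁ v) (h₂₁ : ∀ v, p₂ (i₁ v) = j₂ v)
    (hq : ∀ x, q₁ (p₁ x) = q₂ (p₂ x)) {e₁ : Frame r V₁} {e₂ : Frame r V₂} {f : Frame n W}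
    {u₁ : Frame (r + n) U₁} {u₂ : Frame (r + n) U₂} (hu₁ : IsAdapted j₁ q₁ e₂ f u₁)
    (hu₂ : IsAdapted j₂ q₂ e₁ f u₂) {F₁ F₂ : Frame (r + (r + n)) E}
    (hF₁ : IsAdapted i₁ p₁ e₁ u₁ F₁) (hF₂ : IsAdapted i₂ p₂ e₂ u₂ F₂) :
    frameDet F₁ F₂ = LinearEquiv.det (blockSwap r n) := by
  let π₁ : (Fin (r + (r + n)) → ℝ) →ₗ[ℝ] Fin r → ℝ :=
    LinearMap.funLeft ℝ ℝ (Fin.castAdd (r + n))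
  let π₂ : (Fin (r + (r + n)) → ℝ) →ₗ[ℝ] Fin r → ℝ :=
    LinearMap.funLeft ℝ ℝ (Fin.natAdd r ∘ Fin.castAdd n)
  let π₃ : (Fin (r + (r + n)) → ℝ) →ₗ[ℝ] Fin (r + (r + n)) → ℝ :=
    LinearMap.pi (Fin.addCases (fun _ => 0) (Fin.addCases (fun _ => 0)
      (fun i => LinearMap.proj (Fin.natAdd r (Fin.natAdd r i)))))
  have hπ₁ : ∀ a b d, π₁ (Fin.append a (Fin.append b d)) = a := by
    intro a b d; ext i; simp [π₁, LinearMap.funLeft_apply]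
  have hπ₂ : ∀ a b d, π₂ (Fin.append a (Fin.append b d)) = b := by
    intro a b d; ext i; simp [π₂, LinearMap.funLeft_apply]
  have hπ₃ : ∀ a b d, π₃ (Fin.append a (Fin.append b d)) = Fin.append 0 (Fin.append 0 d) := by
    intro a b d; ext i
    refine Fin.addCases (fun i => ?_) (fun i => Fin.addCases (fun i => ?_) (fun i => ?_) i) i <;>
      simp [π₃]
  -- One frame for both filtrations: `e₁` and `e₂` through the inclusions, and the lift of `f`
  -- contained in `F₁`.
  let T : (Fin (r + (r + n)) → ℝ) →ₗ[ℝ] E :=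
    i₁ ∘ₗ e₁.toLinearMap ∘ₗ π₁ + i₂ ∘ₗ e₂.toLinearMap ∘ₗ π₂ + F₁.toLinearMap ∘ₗ π₃
  have hT : ∀ a b d, T (Fin.append a (Fin.append b d)) =
      i₁ (e₁ a) + i₂ (e₂ b) + F₁ (Fin.append 0 (Fin.append 0 d)) := by
    intro a b d
    simp [T, hπ₁, hπ₂, hπ₃]
  have z : ∀ {k l : ℕ}, (0 : Fin (k + l) → ℝ) = Fin.append 0 0 := by
    intro k l; ext i
    refine Fin.addCases (fun i => ?_) (fun i => ?_) i <;> simp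
  have app : ∀ b d, (Fin.append b d : Fin (r + n) → ℝ) = Fin.append b 0 + Fin.append 0 d := by
    intro b d; ext i
    refine Fin.addCases (fun i => ?_) (fun i => ?_) i <;> simp
  have c₁ : ∀ v, p₁ (i₁ v) = 0 := fun v => (hi₁.exact _).2 ⟨v, rfl⟩
  have c₂ : ∀ v, p₂ (i₂ v) = 0 := fun v => (hi₂.exact _).2 ⟨v, rfl⟩
  have d₂ : ∀ v, q₂ (j₂ v) = 0 := fun v => (hj₂.exact _).2 ⟨v, rfl⟩
  obtain ⟨G₁, hG₁, hG₁T⟩ := exists_isAdapted_eq hi₁ e₁ u₁ T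
    (by
      intro a
      rw [z, hT, ← z, ← z]
      simp)
    (by
      intro a c
      obtain ⟨b, d, rfl⟩ := exists_eq_append c
      rw [hT, map_add, map_add, c₁, zero_add, h₁₂, hF₁.2, ← hu₁.1, ← map_add, ← app])
  -- What the exchanged `T` induces on the quotient `U₂`. It need not be `u₂`, but it is adapted to
  -- the same outer frames `e₁` and `f`.
  let S : (Fin (r + n) → ℝ) →ₗ[ℝ] U₂ :=
    p₂ ∘ₗ T ∘ₗ (blockSwap r n).toLinearMap ∘ₗ LinearMap.pi (Fin.addCases (fun _ => 0)
      (fun i => LinearMap.proj i))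
  have hS : ∀ a d, S (Fin.append a d) = j₂ (e₁ a) + p₂ (F₁ (Fin.append 0 (Fin.append 0 d))) := by
    intro a d
    have : (LinearMap.pi (Fin.addCases (fun _ => 0) (fun i => LinearMap.proj i)) :
        (Fin (r + n) → ℝ) →ₗ[ℝ] Fin (r + (r + n)) → ℝ) (Fin.append a d) =
        Fin.append 0 (Fin.append a d) := by
      ext i
      refine Fin.addCases (fun i => ?_) (fun i => ?_) i <;> simp
    simp only [S, LinearMap.comp_apply, this, LinearEquiv.coe_coe, blockSwap_append, hT]
    simp [h₂₁]
  obtain ⟨u₃, hu₃, hu₃S⟩ := exists_isAdapted_eq hj₂ e₁ f S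
    (by
      intro a
      rw [hS, ← z, ← z]
      simp)
    (by
      intro a d
      rw [hS, map_add, d₂, zero_add, ← hq, hF₁.2, hu₁.2])
  have hG₂ : IsAdapted i₂ p₂ e₂ u₃ ((blockSwap r n).trans G₁) := by
    constructor
    · intro c
      rw [LinearEquiv.trans_apply, z, blockSwap_append, hG₁T, hT, ← z, ← z]
      simp
    · intro b c
      obtain ⟨a, d, rfl⟩ := exists_eq_append c
      rw [LinearEquiv.trans_apply, blockSwap_append, hG₁T, hT, hu₃S, hS, map_add, map_add, c₂, h₂₁,
        add_zero]
  -- Frames adapted to the same outer frames have relative determinant one. For `k₂` this is used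
  -- twice, in `E` and in `U₂`.
  have k₁ : frameDet F₁ G₁ = 1 := by
    rw [frameDet_isAdapted hG₁ hF₁]; simp
  have k₂ : frameDet ((blockSwap r n).trans G₁) F₂ = 1 := by
    rw [frameDet_isAdapted hF₂ hG₂, frameDet_isAdapted hu₂ hu₃]; simp
  have k₃ : (blockSwap r n).trans ((blockSwap r n).trans G₁) = G₁ := by
    ext x
    obtain ⟨a, c, rfl⟩ := exists_eq_append x
    obtain ⟨b, d, rfl⟩ := exists_eq_append c
    simp [blockSwap_append]
  rw [← frameDet_mul F₁ G₁ F₂, k₁, one_mul, ← k₃, frameDet_trans_left, k₂, mul_one]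

end SwappedFrames

/-! ### The determinant of a product -/

section Composition

variable {r n : ℕ} {Ax Ay Az Tx Ty Tz Tg Th Tk : Type*}
  [AddCommGroup Ax] [Module ℝ Ax] [AddCommGroup Ay] [Module ℝ Ay] [AddCommGroup Az] [Module ℝ Az]
  [AddCommGroup Tx] [Module ℝ Tx] [AddCommGroup Ty] [Module ℝ Ty] [AddCommGroup Tz] [Module ℝ Tz]
  [AddCommGroup Tg] [Module ℝ Tg] [AddCommGroup Th] [Module ℝ Th] [AddCommGroup Tk] [Module ℝ Tk]

/-- The linear algebra of the multiplicativity of the determinants attached to arrows: here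
`Tg`, `Th` and `Tk` are the tangent spaces at `g : y ⟶ z`, `h : x ⟶ y` and at their product, and
`μ` is the differential of the multiplication. -/
theorem frameDet_composition
    {ρg : Az →ₗ[ℝ] Tg} {sg : Tg →ₗ[ℝ] Ty} {lg : Ay →ₗ[ℝ] Tg} {tg : Tg →ₗ[ℝ] Tz}
    {ρh : Ay →ₗ[ℝ] Th} {sh : Th →ₗ[ℝ] Tx} {lh : Ax →ₗ[ℝ] Th} {th : Th →ₗ[ℝ] Ty}
    {ρk : Az →ₗ[ℝ] Tk} {sk : Tk →ₗ[ℝ] Tx} {lk : Ax →ₗ[ℝ] Tk} {tk : Tk →ₗ[ℝ] Tz}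
    (hρg : ShortExact ρg sg) (hlg : ShortExact lg tg) (hρh : ShortExact ρh sh)
    (hlh : ShortExact lh th) (hρk : ShortExact ρk sk)
    (μ : Tg × Th →ₗ[ℝ] Tk) (hμρ : ∀ a, μ (ρg a, 0) = ρk a) (hμl : ∀ a, μ (0, lh a) = lk a)
    (hμ : ∀ a, μ (lg a, ρh a) = 0) (hst : ∀ a, sg (lg a) = th (ρh a))
    (hμs : ∀ v w, sg v = th w → sk (μ (v, w)) = sh w)
    (hμt : ∀ v w, sg v = th w → tk (μ (v, w)) = tg v)
    {ex : Frame r Ax} {ey : Frame r Ay} {ez : Frame r Az} {fx : Frame n Tx} {fy : Frame n Ty}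
    {fz : Frame n Tz} {ug wg : Frame (r + n) Tg} {uh wh : Frame (r + n) Th}
    {uk wk : Frame (r + n) Tk}
    (hug : IsAdapted ρg sg ez fy ug) (hwg : IsAdapted lg tg ey fz wg)
    (huh : IsAdapted ρh sh ey fx uh) (hwh : IsAdapted lh th ex fy wh)
    (huk : IsAdapted ρk sk ez fx uk) (hwk : IsAdapted lk tk ex fz wk) :
    frameDet wk uk = LinearEquiv.det (blockSwap r n) ^ 3 * frameDet wg ug * frameDet wh uh := by
  -- The fibre product over `Ty`, that is, the tangent space of the composable pairs. The maps `i₁`,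
  -- `i₂`, `i₃` embed `Az`, `Ax`, `Ay` in it, with quotients `Th`, `Tg`, `Tk`.
  let E : Submodule ℝ (Tg × Th) :=
    LinearMap.eqLocus (sg ∘ₗ LinearMap.fst ℝ Tg Th) (th ∘ₗ LinearMap.snd ℝ Tg Th)
  have hE : ∀ x : Tg × Th, x ∈ E ↔ sg x.1 = th x.2 := fun x => Iff.rfl
  have z₁ : ∀ a, sg (ρg a) = 0 := fun a => (hρg.exact _).2 ⟨a, rfl⟩
  have z₂ : ∀ a, th (lh a) = 0 := fun a => (hlh.exact _).2 ⟨a, rfl⟩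
  have z₃ : ∀ a, sh (ρh a) = 0 := fun a => (hρh.exact _).2 ⟨a, rfl⟩
  let i₁ : Az →ₗ[ℝ] E := LinearMap.codRestrict E (LinearMap.inl ℝ Tg Th ∘ₗ ρg)
    (fun a => by simp [hE, z₁])
  let i₂ : Ax →ₗ[ℝ] E := LinearMap.codRestrict E (LinearMap.inr ℝ Tg Th ∘ₗ lh)
    (fun a => by simp [hE, z₂])
  let i₃ : Ay →ₗ[ℝ] E := LinearMap.codRestrict E (LinearMap.prod lg ρh)
    (fun a => by simp [hE, hst])
  let p₁ : E →ₗ[ℝ] Th := LinearMap.snd ℝ Tg Th ∘ₗ E.subtype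
  let p₂ : E →ₗ[ℝ] Tg := LinearMap.fst ℝ Tg Th ∘ₗ E.subtype
  let p₃ : E →ₗ[ℝ] Tk := μ ∘ₗ E.subtype
  have hp₃ : ∀ (v : Tg) (w : Th) (h : (v, w) ∈ E), p₃ ⟨(v, w), h⟩ = μ (v, w) := fun _ _ _ => rfl
  have hμ0 : ∀ v, sg v = 0 → μ (v, 0) = 0 → v = 0 := by
    intro v hv h
    obtain ⟨b, rfl⟩ := (hρg.exact v).1 hv
    rw [hμρ] at h
    have : b = 0 := hρk.injective (h.trans (map_zero ρk).symm)
    simp [this]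
  have e₁ : ShortExact i₁ p₁ := by
    refine ⟨fun a b h => hρg.injective (congrArg (fun x : E => x.1.1) h), ?_, ?_⟩
    · rintro ⟨⟨v, w⟩, h⟩
      constructor
      · intro (hw : w = 0)
        subst hw
        obtain ⟨b, rfl⟩ := (hρg.exact v).1 (((hE _).1 h).trans (map_zero th))
        exact ⟨b, rfl⟩
      · rintro ⟨b, hb⟩
        rw [← hb]; rfl
    · intro w
      obtain ⟨v, hv⟩ := hρg.surjective (th w)
      exact ⟨⟨(v, w), hv⟩, rfl⟩
  have e₂ : ShortExact i₂ p₂ := by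
    refine ⟨fun a b h => hlh.injective (congrArg (fun x : E => x.1.2) h), ?_, ?_⟩
    · rintro ⟨⟨v, w⟩, h⟩
      constructor
      · intro (hv : v = 0)
        subst hv
        obtain ⟨b, rfl⟩ := (hlh.exact w).1 (((hE _).1 h).symm.trans (map_zero sg))
        exact ⟨b, rfl⟩
      · rintro ⟨b, hb⟩
        rw [← hb]; rfl
    · intro v
      obtain ⟨w, hw⟩ := hlh.surjective (sg v)
      exact ⟨⟨(v, w), hw.symm⟩, rfl⟩
  have e₃ : ShortExact i₃ p₃ := by
    refine ⟨fun a b h => hρh.injective (congrArg (fun x : E => x.1.2) h), ?_, ?_⟩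
    · rintro ⟨⟨v, w⟩, h⟩
      constructor
      · intro h0
        rw [hp₃] at h0
        have hw : sh w = 0 := by rw [← hμs v w h, h0, map_zero]
        obtain ⟨a, rfl⟩ := (hρh.exact w).1 hw
        -- Subtracting `(lg a, ρh a)`, which `μ` kills, leaves a pair in `E` with vanishing second
        -- component, and `μ` is injective on such pairs.
        have h1 : v - lg a = 0 := by
          refine hμ0 _ (by rw [map_sub, hst, (hE _).1 h, sub_self]) ?_
          have : ((v - lg a, 0) : Tg × Th) = (v, ρh a) - (lg a, ρh a) := by simp
          rw [this, map_sub, h0, hμ, sub_self]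
        refine ⟨a, Subtype.ext ?_⟩
        show (lg a, ρh a) = (v, ρh a)
        rw [sub_eq_zero.1 h1]
      · rintro ⟨a, ha⟩
        rw [← ha]
        exact hμ a
    · intro y
      obtain ⟨w, hw⟩ := hρh.surjective (sk y)
      obtain ⟨v, hv⟩ := hρg.surjective (th w)
      -- The pair `(v, w)` already has the right image under `sk`; the error lies in the image of
      -- `ρk` and is corrected by `(ρg b, 0)`.
      obtain ⟨b, hb⟩ := (hρk.exact (y - μ (v, w))).1 (by rw [map_sub, hμs v w hv, hw, sub_self])
      refine ⟨⟨(v + ρg b, w), by simp [hE, hv, z₁]⟩, ?_⟩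
      rw [hp₃]
      have : ((v + ρg b, w) : Tg × Th) = (v, w) + (ρg b, 0) := by simp
      rw [this, map_add, hμρ, hb]
      abel
  -- Two frames of a quotient are lifted with the same frame of the subspace, so their relative
  -- determinant survives in `E`.
  obtain ⟨Fu₁, hFu₁⟩ := exists_isAdapted e₁ ez uh
  obtain ⟨Fw₁, hFw₁⟩ := exists_isAdapted e₁ ez wh
  obtain ⟨Fu₂, hFu₂⟩ := exists_isAdapted e₂ ex ug
  obtain ⟨Fw₂, hFw₂⟩ := exists_isAdapted e₂ ex wg
  obtain ⟨Fu₃, hFu₃⟩ := exists_isAdapted e₃ ey uk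
  obtain ⟨Fw₃, hFw₃⟩ := exists_isAdapted e₃ ey wk
  have a₁ : frameDet Fw₁ Fu₁ = frameDet wh uh := by
    rw [frameDet_isAdapted hFu₁ hFw₁]; simp
  have a₂ : frameDet Fw₂ Fu₂ = frameDet wg ug := by
    rw [frameDet_isAdapted hFu₂ hFw₂]; simp
  have a₃ : frameDet Fw₃ Fu₃ = frameDet wk uk := by
    rw [frameDet_isAdapted hFu₃ hFw₃]; simp
  -- The chain `Fw₃`, `Fw₂`, `Fu₂`, `Fw₁`, `Fu₁`, `Fu₃` alternates three exchanges of blocks with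
  -- the changes of frame belonging to `g` and to `h`.
  have b₁ : frameDet Fu₁ Fu₃ = LinearEquiv.det (blockSwap r n) :=
    frameDet_blockSwap e₁ e₃ hρk (fun _ => rfl) (fun a => hμρ a)
      (fun x => (hμs x.1.1 x.1.2 x.2).symm) huh huk hFu₁ hFu₃
  have b₂ : frameDet Fu₂ Fw₁ = LinearEquiv.det (blockSwap r n) :=
    frameDet_blockSwap e₂ e₁ hlh (fun _ => rfl) (fun _ => rfl)
      (fun x => x.2) hug hwh hFu₂ hFw₁
  have b₃ : frameDet Fw₃ Fw₂ = LinearEquiv.det (blockSwap r n) :=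
    frameDet_blockSwap e₃ e₂ hlg (fun a => hμl a) (fun _ => rfl)
      (fun x => hμt x.1.1 x.1.2 x.2) hwk hwg hFw₃ hFw₂
  rw [← a₃, ← frameDet_mul Fw₃ Fw₂ Fu₃, ← frameDet_mul Fw₂ Fu₂ Fu₃, ← frameDet_mul Fu₂ Fw₁ Fu₃,
    ← frameDet_mul Fw₁ Fu₁ Fu₃, a₁, a₂, b₁, b₂, b₃]
  ext
  push_cast
  ring

end Composition

end TransverseBundles

namespace TransverseBundles

/-! ### Velocities of curves in manifolds -/

section Velocities

variable {EN N EB B : Type*} [NormedAddCommGroup EN] [NormedSpace ℝ EN]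
  [TopologicalSpace N] [ChartedSpace EN N]
  [NormedAddCommGroup EB] [NormedSpace ℝ EB] [TopologicalSpace B] [ChartedSpace EB B]

variable (EN) in
/-- The curve `γ` passes at time `0` through `p` with velocity `v`. -/
structure HasVelocity (γ : ℝ → N) (p : N) (v : EN) : Prop where
  apply_zero : γ 0 = p
  exists_deriv : ∃ D : ℝ →L[ℝ] EN, D 1 = v ∧ HasMFDerivAt 𝓘(ℝ, ℝ) 𝓘(ℝ, EN) γ 0 D

theorem HasVelocity.continuousAt {γ : ℝ → N} {p : N} {v : EN} (h : HasVelocity EN γ p v) :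
    ContinuousAt γ 0 := by
  obtain ⟨D, -, hD⟩ := h.exists_deriv
  exact hD.continuousAt

theorem HasVelocity.eventually_mem {γ : ℝ → N} {p : N} {v : EN} (h : HasVelocity EN γ p v)
    {s : Set N} (hs : IsOpen s) (hp : p ∈ s) : ∀ᶠ τ in 𝓝 0, γ τ ∈ s :=
  h.continuousAt.preimage_mem_nhds (hs.mem_nhds (h.apply_zero.symm ▸ hp))

theorem HasVelocity.congr {γ δ : ℝ → N} {p : N} {v : EN} (h : HasVelocity EN γ p v)
    (e : δ =ᶠ[𝓝 0] γ) : HasVelocity EN δ p v := by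
  obtain ⟨h0, D, h1, h2⟩ := h
  exact ⟨e.eq_of_nhds.trans h0, D, h1, h2.congr_of_eventuallyEq e⟩

/-- The device that turns an identity between arrows into an identity between differentials: compute
the velocity of one germ of curves in two ways. Velocities live in the model space, so the base
points `p` and `q` need no identification. -/
theorem HasVelocity.unique {γ δ : ℝ → N} {p q : N} {v w : EN} (h : HasVelocity EN γ p v)
    (h' : HasVelocity EN δ q w) (e : δ =ᶠ[𝓝 0] γ) : v = w := by
  obtain ⟨-, D, rfl, h1⟩ := h
  obtain ⟨-, D', rfl, h2⟩ := h'.congr e.symm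
  exact DFunLike.congr_fun (hasMFDerivAt_unique h1 h2) (1 : ℝ)

variable (EN) in
theorem hasVelocity_const (p : N) : HasVelocity EN (fun _ => p) p (0 : EN) :=
  ⟨rfl, 0, rfl, hasMFDerivAt_const (I := 𝓘(ℝ, ℝ)) (I' := 𝓘(ℝ, EN)) p (0 : ℝ)⟩

/-- A derivative within `s` is determined on velocities of curves that stay in `s`, even if `s`
lacks unique differentials. -/
theorem HasVelocity.comp_hasMFDerivWithinAt {γ : ℝ → N} {p : N} {v : EN}
    (h : HasVelocity EN γ p v) {f : N → B} {s : Set N} {f' : EN →L[ℝ] EB}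
    (hf : HasMFDerivWithinAt 𝓘(ℝ, EN) 𝓘(ℝ, EB) f s p f') (hs : ∀ᶠ τ in 𝓝 0, γ τ ∈ s) :
    HasVelocity EB (fun τ => f (γ τ)) (f p) (f' v) := by
  obtain ⟨rfl, D, rfl, h1⟩ := h
  have h2 : HasMFDerivWithinAt 𝓘(ℝ, ℝ) 𝓘(ℝ, EB) (f ∘ γ) (γ ⁻¹' s) 0 (f'.comp D) :=
    hf.comp 0 h1.hasMFDerivWithinAt subset_rfl
  exact ⟨rfl, f'.comp D, rfl, h2.hasMFDerivAt hs⟩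

theorem HasVelocity.comp {γ : ℝ → N} {p : N} {v : EN} (h : HasVelocity EN γ p v) {f : N → B}
    (hf : MDifferentiableAt 𝓘(ℝ, EN) 𝓘(ℝ, EB) f p) :
    HasVelocity EB (fun τ => f (γ τ)) (f p) (mfderiv 𝓘(ℝ, EN) 𝓘(ℝ, EB) f p v) :=
  let D : EN →L[ℝ] EB := mfderiv 𝓘(ℝ, EN) 𝓘(ℝ, EB) f p
  HasVelocity.comp_hasMFDerivWithinAt (EB := EB) (f' := D) h
    (hf.hasMFDerivAt.hasMFDerivWithinAt (s := univ)) (Filter.Eventually.of_forall fun _ => mem_univ _)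

theorem HasDerivAt.hasVelocity {γ : ℝ → EN} {v : EN} (h : HasDerivAt γ v 0) :
    HasVelocity EN γ (γ 0) v :=
  ⟨rfl, _, one_smul ℝ v, h.hasFDerivAt.hasMFDerivAt⟩

theorem HasVelocity.hasDerivAt {γ : ℝ → EN} {p v : EN} (h : HasVelocity EN γ p v) :
    HasDerivAt γ v 0 := by
  obtain ⟨-, D, rfl, h1⟩ := h
  have h2 : HasFDerivAt γ D 0 := h1.hasFDerivAt
  exact h2.hasDerivAt

variable [IsManifold 𝓘(ℝ, EN) ∞ N]

theorem exists_hasVelocity (p : N) (v : EN) : ∃ γ : ℝ → N, HasVelocity EN γ p v := by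
  let e := chartAt EN p
  have hm : e.MDifferentiable 𝓘(ℝ, EN) 𝓘(ℝ, EN) :=
    mdifferentiable_of_mem_maximalAtlas (IsManifold.chart_mem_maximalAtlas p)
  have hp : p ∈ e.source := mem_chart_source EN p
  let w : EN := mfderiv 𝓘(ℝ, EN) 𝓘(ℝ, EN) e p v
  have hw : (mfderiv 𝓘(ℝ, EN) 𝓘(ℝ, EN) e.symm (e p) w : EN) = v :=
    DFunLike.congr_fun (hm.symm_comp_deriv hp) v
  have h1 : HasVelocity EN (fun τ : ℝ => e p + τ • w) (e p) w := by
    have := ((hasDerivAt_id (0 : ℝ)).smul_const w).const_add (e p)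
    rw [one_smul] at this
    simpa using HasDerivAt.hasVelocity this
  have h2 := h1.comp (hm.mdifferentiableAt_symm (e.map_source hp))
  rw [hw, e.left_inv hp] at h2
  exact ⟨_, h2⟩

/-- Curves can be lifted through a submersion, with prescribed velocity. -/
theorem HasVelocity.exists_lift {f : N → B} (hf : Manifold.IsSubmersion 𝓘(ℝ, EN) 𝓘(ℝ, EB) ∞ f)
    {p : N} {v : EN} {β : ℝ → B}
    (hβ : HasVelocity EB β (f p) (mfderiv 𝓘(ℝ, EN) 𝓘(ℝ, EB) f p v : EB)) :
    ∃ γ : ℝ → N, HasVelocity EN γ p v ∧ ∀ᶠ τ in 𝓝 0, f (γ τ) = β τ := by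
  have hp := hf.isSubmersionAt p
  have he := mdifferentiable_of_mem_maximalAtlas hp.domChart_mem_maximalAtlas
  have hc := mdifferentiable_of_mem_maximalAtlas hp.codChart_mem_maximalAtlas
  have hps := hp.mem_domChart_source
  set e := hp.domChart with he_def
  set c := hp.codChart with hc_def
  set l := hp.equiv with hl_def
  have hw : ∀ z ∈ e.target, c (f (e.symm z)) = (l z).1 := by
    intro z hz
    have hz2 : z ∈ (hp.domChart.extend 𝓘(ℝ, EN)).target := by simpa using hz
    have := hp.writtenInCharts hz2
    simpa using this
  have hs : ∀ z ∈ e.target, f (e.symm z) ∈ c.source := fun z hz =>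
    hp.source_subset_preimage_source (e.map_target hz)
  have hfp : f p ∈ c.source := by
    have := hs _ (e.map_source hps)
    rwa [e.left_inv hps] at this
  have hcp : c (f p) = (l (e p)).1 := by
    have := hw _ (e.map_source hps)
    rwa [e.left_inv hps] at this
  let w : EN := mfderiv 𝓘(ℝ, EN) 𝓘(ℝ, EN) e p v
  have hw' : (mfderiv 𝓘(ℝ, EN) 𝓘(ℝ, EN) e.symm (e p) w : EN) = v :=
    DFunLike.congr_fun (he.symm_comp_deriv hps) v
  have hc1 : HasVelocity EB (fun τ => c (β τ)) (c (f p)) (l w).1 := by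
    have h1 := hβ.comp (hc.mdifferentiableAt hfp)
    -- An auxiliary curve that computes the differential of `f`: in the charts its image under `f`
    -- is the first coordinate, whose velocity is `(l w).1`.
    obtain ⟨γ, hγ⟩ := exists_hasVelocity p v
    have h2 := (hγ.comp (hf.contMDiff.mdifferentiable (by simp) p)).comp
      (hc.mdifferentiableAt hfp)
    have h3 : HasDerivAt (fun τ => (l (e (γ τ))).1) (l w).1 0 :=
      (((ContinuousLinearMap.fst ℝ EB hp.complement).comp
        (l : EN →L[ℝ] EB × hp.complement)).hasFDerivAt.comp_hasDerivAt (0 : ℝ)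
        (hγ.comp (he.mdifferentiableAt hps)).hasDerivAt)
    have h4 : ∀ᶠ τ in 𝓝 (0 : ℝ), γ τ ∈ e.source := hγ.eventually_mem e.open_source hps
    have h5 := h2.unique (HasDerivAt.hasVelocity h3) (by
      filter_upwards [h4] with τ hτ
      rw [← hw _ (e.map_source hτ), e.left_inv hτ])
    rw [h5] at h1
    exact h1
  -- In the charts `f` is a projection: the first coordinate must follow `β`, and the second is free
  -- to move linearly so as to produce the velocity `v`.
  let ζ : ℝ → EN := fun τ => l.symm (c (β τ), (l (e p)).2 + τ • (l w).2)
  have hζ : HasVelocity EN ζ (e p) w := by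
    have h1 : HasDerivAt (fun τ : ℝ => (l (e p)).2 + τ • (l w).2) (l w).2 0 := by
      have := ((hasDerivAt_id (0 : ℝ)).smul_const (l w).2).const_add (l (e p)).2
      rwa [one_smul] at this
    have h2 := (l.symm : EB × hp.complement →L[ℝ] EN).hasFDerivAt.comp_hasDerivAt (0 : ℝ)
      (hc1.hasDerivAt.prodMk h1)
    have h3 := HasDerivAt.hasVelocity h2
    have h4 : (c (β 0), (l (e p)).2 + (0 : ℝ) • (l w).2) = l (e p) := by
      rw [hβ.apply_zero, hcp]; simp
    refine ⟨?_, ?_⟩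
    · show l.symm (c (β 0), (l (e p)).2 + (0 : ℝ) • (l w).2) = e p
      rw [h4]; simp
    · have h5 : l.symm ((l w).1, (l w).2) = w := l.symm_apply_apply w
      exact h5 ▸ h3.exists_deriv
  have hγ := hζ.comp (he.mdifferentiableAt_symm (e.map_source hps))
  rw [hw', e.left_inv hps] at hγ
  refine ⟨_, hγ, ?_⟩
  have e1 : ∀ᶠ τ in 𝓝 (0 : ℝ), ζ τ ∈ e.target := hζ.eventually_mem e.open_target (e.map_source hps)
  have e2 : ∀ᶠ τ in 𝓝 (0 : ℝ), β τ ∈ c.source := hβ.eventually_mem c.open_source hfp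
  filter_upwards [e1, e2] with τ h1 h2
  apply c.injOn (hs _ h1) h2
  rw [hw _ h1]
  simp [ζ]

end Velocities

/-! ### Differentials of the structure maps along curves -/

section Differentials

variable {EM EG M : Type*} [Groupoid M]
    [NormedAddCommGroup EM] [NormedSpace ℝ EM] [NormedAddCommGroup EG] [NormedSpace ℝ EG]
    [TopologicalSpace M] [ChartedSpace EM M]
    [TopologicalSpace (Arrows M)] [ChartedSpace EG (Arrows M)]

variable (EG) in
/-- The differential at `(g, h)` of the multiplication of composable pairs. -/
noncomputable def dmul {x y z : M} (g : y ⟶ z) (h : x ⟶ y) : EG × EG →L[ℝ] EG :=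
  mfderivWithin (𝓘(ℝ, EG).prod 𝓘(ℝ, EG)) 𝓘(ℝ, EG) (fun p : Arrows M × Arrows M => p.1.mul p.2)
    {p | p.1.src = p.2.tgt} (Arrows.of g, Arrows.of h)

variable [IsManifold 𝓘(ℝ, EM) ∞ M] [IsManifold 𝓘(ℝ, EG) ∞ (Arrows M)]

/-- The product is differentiated within the composable pairs, so the two curves have to be
composable near time `0`. -/
theorem HasVelocity.mul (hG : LieGroupoid EM EG M) {x y z : M} {g : y ⟶ z} {h : x ⟶ y} {δ δ' : ℝ → Arrows M} {v w : EG}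
    (hδ : HasVelocity EG δ (Arrows.of g) v) (hδ' : HasVelocity EG δ' (Arrows.of h) w)
    (hs : ∀ᶠ τ in 𝓝 0, (δ τ).src = (δ' τ).tgt) :
    HasVelocity EG (fun τ => (δ τ).mul (δ' τ)) (Arrows.of (h ≫ g)) (dmul EG g h (v, w)) := by
  have h1 : HasMFDerivWithinAt (𝓘(ℝ, EG).prod 𝓘(ℝ, EG)) 𝓘(ℝ, EG)
      (fun p : Arrows M × Arrows M => p.1.mul p.2)
      {p | p.1.src = p.2.tgt} (δ 0, δ' 0) (dmul EG g h) := by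
    rw [hδ.apply_zero, hδ'.apply_zero]
    exact ((hG.contMDiffOn_mul (Arrows.of g, Arrows.of h) rfl).mdifferentiableWithinAt
      (by simp)).hasMFDerivWithinAt
  obtain ⟨h0, D, hv, h2⟩ := hδ
  obtain ⟨h0', D', hw, h2'⟩ := hδ'
  have h3 : HasMFDerivWithinAt 𝓘(ℝ, ℝ) 𝓘(ℝ, EG) (fun τ => (δ τ).mul (δ' τ))
      {τ | (δ τ).src = (δ' τ).tgt} 0 ((dmul EG g h).comp (D.prod D')) :=
    h1.comp (0 : ℝ) (h2.prodMk h2').hasMFDerivWithinAt subset_rfl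
  refine ⟨by rw [h0, h0', Arrows.mul_of], (dmul EG g h).comp (D.prod D'), ?_, h3.hasMFDerivAt hs⟩
  rw [← hv, ← hw]
  rfl

theorem HasVelocity.inv (hG : LieGroupoid EM EG M) {δ : ℝ → Arrows M} {p : Arrows M} {v : EG} (hδ : HasVelocity EG δ p v) :
    HasVelocity EG (fun τ => (δ τ).inv) p.inv (mfderiv 𝓘(ℝ, EG) 𝓘(ℝ, EG) Arrows.inv p v) :=
  hδ.comp (hG.contMDiff_inv.mdifferentiable (by simp) p)

variable [hG : LieGroupoid EM EG M]

theorem HasVelocity.src {x y : M} {g : x ⟶ y} {δ : ℝ → Arrows M} {v : EG}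
    (hδ : HasVelocity EG δ (Arrows.of g) v) :
    HasVelocity EM (fun τ => (δ τ).src) x (dsrc EM EG g v) :=
  hδ.comp (hG.isSubmersion_src.contMDiff.mdifferentiable (by simp) _)

/-- Such curves exist because the source is a submersion. They stay in one source fibre, so they can
be right translated. -/
theorem algFiber_exists_curve {x : M} (a : algFiber EM EG x) : ∃ γ : ℝ → Arrows M,
    HasVelocity EG γ (Arrows.unit x) (a.1) ∧ ∀ᶠ τ in 𝓝 0, (γ τ).src = x := by
  obtain ⟨γ, h0, h1, h2⟩ := submersion_ker hG.isSubmersion_src (Arrows.unit x) a.1 a.2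
  exact ⟨γ, ⟨h0, _, one_smul ℝ (a.1 : EG), h2⟩, h1⟩

/-- The only access to `rightTranslation`, which is a derivative within a source fibre: test it on
curves in that fibre. -/
theorem HasVelocity.rightTranslation {x y : M} (g : x ⟶ y) {a : algFiber EM EG y}
    {γ : ℝ → Arrows M} (hγ : HasVelocity EG γ (Arrows.unit y) (a.1))
    (hs : ∀ᶠ τ in 𝓝 0, (γ τ).src = y) :
    HasVelocity EG (fun τ => (γ τ).mul (Arrows.of g)) (Arrows.of g)
      (TransverseBundles.rightTranslation EM EG g a) := by
  have h1 := (mdifferentiableWithinAt_mul hG g (Arrows.unit y) rfl).hasMFDerivWithinAt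
  have h2 := hγ.comp_hasMFDerivWithinAt h1 hs
  have h3 : (Arrows.unit y).mul (Arrows.of g) = Arrows.of g := by
    have := Arrows.mul_of (𝟙 y) g
    simpa using this
  rw [h3] at h2
  exact h2

variable [FiniteDimensional ℝ EG]

theorem HasVelocity.dinv {x y : M} {g : x ⟶ y} {δ : ℝ → Arrows M} {v : EG}
    (hδ : HasVelocity EG δ (Arrows.of g) v) :
    HasVelocity EG (fun τ => (δ τ).inv) (Arrows.of (Groupoid.inv g))
      (TransverseBundles.dinv EM EG g v) :=
  hδ.inv hG

variable (EM EG)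

/-- The map `A_x → T_g 𝒢` for an arrow `g : x ⟶ y`: the right translation by the inverse
followed by the inversion. -/
noncomputable def leftTranslation {x y : M} (g : x ⟶ y) :
    algFiber EM EG x →ₗ[ℝ] TangentSpace 𝓘(ℝ, EG) (Arrows.of g) :=
  (dinv EM EG g).symm.toLinearMap ∘ₗ rightTranslation EM EG (Groupoid.inv g)

/-- The map `dt : T_g 𝒢 → T_y M` for an arrow `g : x ⟶ y`. -/
noncomputable def dtgt {x y : M} (g : x ⟶ y) :
    TangentSpace 𝓘(ℝ, EG) (Arrows.of g) →ₗ[ℝ] TangentSpace 𝓘(ℝ, EM) y :=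
  dsrc EM EG (Groupoid.inv g) ∘ₗ (dinv EM EG g).toLinearMap

/-- This is the sequence at `g⁻¹` transported by the inversion, so that both sequences of an arrow
have the same middle term `T_g 𝒢` and their frames can be compared. -/
theorem shortExact_leftTranslation {x y : M} (g : x ⟶ y) :
    ShortExact (leftTranslation EM EG g) (dtgt EM EG g) := by
  obtain ⟨h1, h2, h3⟩ := shortExact_arrow EM EG (Groupoid.inv g)
  refine ⟨(dinv EM EG g).symm.injective.comp h1, fun v => ?_, h3.comp (dinv EM EG g).surjective⟩
  refine (h2 (dinv EM EG g v)).trans ⟨?_, ?_⟩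
  · rintro ⟨a, ha⟩
    exact ⟨a, (dinv EM EG g).symm_apply_eq.2 ha⟩
  · rintro ⟨a, ha⟩
    exact ⟨a, (dinv EM EG g).symm_apply_eq.1 ha⟩

variable {EM EG}

theorem HasVelocity.tgt {x y : M} {g : x ⟶ y} {δ : ℝ → Arrows M} {v : EG}
    (hδ : HasVelocity EG δ (Arrows.of g) v) :
    HasVelocity EM (fun τ => (δ τ).tgt) y (dtgt EM EG g v) :=
  (HasVelocity.dinv (EM := EM) hδ).src

theorem HasVelocity.leftTranslation {x y : M} (g : x ⟶ y) {a : algFiber EM EG x}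
    {γ : ℝ → Arrows M} (hγ : HasVelocity EG γ (Arrows.unit x) (a.1))
    (hs : ∀ᶠ τ in 𝓝 0, (γ τ).src = x) :
    HasVelocity EG (fun τ => ((γ τ).mul (Arrows.of (Groupoid.inv g))).inv) (Arrows.of g)
      (TransverseBundles.leftTranslation EM EG g a) := by
  have h1 := hγ.rightTranslation (Groupoid.inv g) hs
  have h2 := h1.inv hG
  rw [show (Arrows.of (Groupoid.inv g)).inv = Arrows.of g from Arrows.inv_inv (Arrows.of g)] at h2
  have h3 := HasVelocity.dinv (EM := EM) h2
  -- `leftTranslation` uses the inverse of `dinv` at `g`, whereas the inverted curve yields the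
  -- differential of the inversion at `g⁻¹`. Inverting twice shows that they agree on this vector.
  have h4 := h3.unique h1 (by
    filter_upwards with τ
    rw [Arrows.inv_inv])
  have h5 : TransverseBundles.leftTranslation EM EG g a =
      (mfderiv 𝓘(ℝ, EG) 𝓘(ℝ, EG) Arrows.inv (Arrows.of (Groupoid.inv g))
        (TransverseBundles.rightTranslation EM EG (Groupoid.inv g) a)) :=
    (TransverseBundles.dinv EM EG g).symm_apply_eq.2 h4.symm
  rw [h5]
  exact h2

end Differentials

end TransverseBundles

namespace TransverseBundles

/-! ### Identities between arrows on moving curves -/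

namespace Arrows

variable {M : Type*} [Groupoid M]

/-- In this and the next identities `k` stands for the point of a curve, whose source is known only
by a proof; hence the total space of arrows and the hypothesis `hk`. -/
theorem mul_mul_of {x y z : M} (g : y ⟶ z) (h : x ⟶ y) (k : Arrows M) (hk : k.src = z) :
    (k.mul (of g)).mul (of h) = k.mul (of (h ≫ g)) := by
  obtain ⟨z', w, k⟩ := k
  obtain rfl : z' = z := hk
  show ((of k).mul (of g)).mul (of h) = (of k).mul (of (h ≫ g))
  simp only [mul_of, Category.assoc]

theorem of_mul_inv {x y z : M} (g : y ⟶ z) (h : x ⟶ y) (k : Arrows M) (hk : k.src = x) :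
    (of g).mul (k.mul (of (Groupoid.inv h))).inv =
      (k.mul (of (Groupoid.inv (h ≫ g)))).inv := by
  obtain ⟨x', w, k⟩ := k
  obtain rfl : x' = x := hk
  show (of g).mul ((of k).mul (of (Groupoid.inv h))).inv =
    ((of k).mul (of (Groupoid.inv (h ≫ g)))).inv
  simp only [mul_of]
  simp [inv, Groupoid.inv_eq_inv]

theorem inv_mul_mul {x y z : M} (g : y ⟶ z) (h : x ⟶ y) (k : Arrows M) (hk : k.src = y) :
    ((k.mul (of (Groupoid.inv g))).inv).mul (k.mul (of h)) = of (h ≫ g) := by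
  obtain ⟨y', w, k⟩ := k
  obtain rfl : y' = y := hk
  show (((of k).mul (of (Groupoid.inv g))).inv).mul ((of k).mul (of h)) = _
  simp only [mul_of]
  simp [Groupoid.inv_eq_inv]

theorem mul_unit {x : M} (k : Arrows M) (hk : k.src = x) : k.mul (unit x) = k := by
  obtain ⟨x', w, k⟩ := k
  obtain rfl : x' = x := hk
  exact (mul_of k (𝟙 x')).trans (by simp)

theorem unit_mul {x : M} (k : Arrows M) (hk : k.tgt = x) : (unit x).mul k = k := by
  obtain ⟨w, x', k⟩ := k
  obtain rfl : x' = x := hk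
  exact (mul_of (𝟙 x') k).trans (by simp)

theorem mul_inv_self (k : Arrows M) : k.mul k.inv = unit k.tgt := by
  obtain ⟨x, y, k⟩ := k
  exact (mul_of k (Groupoid.inv k)).trans (by simp)

theorem tgt_mul (g h : Arrows M) (e : g.src = h.tgt) : (g.mul h).tgt = g.tgt := by
  simp [mul, e]

end Arrows

/-! ### The determinant of an arrow: products, units, inverses -/

section Determinants

variable (EM EG : Type*) {M : Type*} [Groupoid M]
    [NormedAddCommGroup EM] [NormedSpace ℝ EM] [NormedAddCommGroup EG] [NormedSpace ℝ EG]
    [TopologicalSpace M] [ChartedSpace EM M]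
    [TopologicalSpace (Arrows M)] [ChartedSpace EG (Arrows M)]
    [IsManifold 𝓘(ℝ, EM) ∞ M] [IsManifold 𝓘(ℝ, EG) ∞ (Arrows M)] [hG : LieGroupoid EM EG M]
    [FiniteDimensional ℝ EG]

/-- The derivative of `(k g) h = k (g h)` in `k`, with the second factor at rest. -/
theorem dmul_rightTranslation {x y z : M} (g : y ⟶ z) (h : x ⟶ y) (a : algFiber EM EG z) :
    dmul EG g h (rightTranslation EM EG g a, 0) = rightTranslation EM EG (h ≫ g) a := by
  obtain ⟨γ, hγ, hs⟩ := algFiber_exists_curve a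
  refine ((hγ.rightTranslation g hs).mul hG (hasVelocity_const EG (Arrows.of h)) ?_).unique
    (hγ.rightTranslation (h ≫ g) hs) ?_
  · filter_upwards [hs] with τ hτ
    rw [Arrows.src_mul _ _ hτ]
  · filter_upwards [hs] with τ hτ
    rw [Arrows.mul_mul_of g h _ hτ]

/-- The derivative of `g (k h⁻¹)⁻¹ = (k (g h)⁻¹)⁻¹` in `k`, with the first factor at rest. -/
theorem dmul_leftTranslation {x y z : M} (g : y ⟶ z) (h : x ⟶ y) (a : algFiber EM EG x) :
    dmul EG g h (0, leftTranslation EM EG h a) = leftTranslation EM EG (h ≫ g) a := by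
  obtain ⟨γ, hγ, hs⟩ := algFiber_exists_curve a
  refine ((hasVelocity_const EG (Arrows.of g)).mul hG (hγ.leftTranslation h hs) ?_).unique
    (hγ.leftTranslation (h ≫ g) hs) ?_
  · filter_upwards [hs] with τ hτ
    show y = ((γ τ).mul (Arrows.of (Groupoid.inv h))).src
    rw [Arrows.src_mul _ _ hτ]
  · filter_upwards [hs] with τ hτ
    rw [Arrows.of_mul_inv g h _ hτ]

/-- The product `(g k⁻¹)(k h)` does not depend on `k`. These pairs are the directions of the fibres
of the multiplication. -/
theorem dmul_leftTranslation_rightTranslation {x y z : M} (g : y ⟶ z) (h : x ⟶ y)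
    (a : algFiber EM EG y) :
    dmul EG g h (leftTranslation EM EG g a, rightTranslation EM EG h a) = 0 := by
  obtain ⟨γ, hγ, hs⟩ := algFiber_exists_curve a
  refine ((hγ.leftTranslation g hs).mul hG (hγ.rightTranslation h hs) ?_).unique
    (hasVelocity_const EG (Arrows.of (h ≫ g))) ?_
  · filter_upwards [hs] with τ hτ
    show ((γ τ).mul (Arrows.of (Groupoid.inv g))).tgt = _
    rw [Arrows.tgt_mul _ _ hτ, Arrows.tgt_mul _ _ hτ]
  · filter_upwards [hs] with τ hτ
    rw [Arrows.inv_mul_mul g h _ hτ]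

/-- The source of `g k⁻¹` and the target of `k h` are both the target of `k`. -/
theorem dsrc_leftTranslation {x y z : M} (g : y ⟶ z) (h : x ⟶ y) (a : algFiber EM EG y) :
    dsrc EM EG g (leftTranslation EM EG g a) = dtgt EM EG h (rightTranslation EM EG h a) := by
  obtain ⟨γ, hγ, hs⟩ := algFiber_exists_curve a
  refine HasVelocity.unique (EN := EM) (hγ.leftTranslation g hs).src (hγ.rightTranslation h hs).tgt ?_
  filter_upwards [hs] with τ hτ
  show _ = ((γ τ).mul (Arrows.of (Groupoid.inv g))).tgt
  rw [Arrows.tgt_mul _ _ hτ, Arrows.tgt_mul _ _ hτ]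

/-- The curve through `h` is arbitrary; its target is then lifted through the source submersion with
prescribed velocity `v`. -/
theorem exists_composable_curves {x y z : M} (g : y ⟶ z) (h : x ⟶ y)
    (v : TangentSpace 𝓘(ℝ, EG) (Arrows.of g)) (w : TangentSpace 𝓘(ℝ, EG) (Arrows.of h))
    (hvw : dsrc EM EG g v = dtgt EM EG h w) : ∃ δ δ' : ℝ → Arrows M,
      HasVelocity EG δ (Arrows.of g) v ∧ HasVelocity EG δ' (Arrows.of h) w ∧
        ∀ᶠ τ in 𝓝 0, (δ τ).src = (δ' τ).tgt := by
  obtain ⟨δ', hδ'⟩ := exists_hasVelocity (EN := EG) (Arrows.of h) w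
  have h1 := hδ'.tgt (EM := EM)
  rw [← hvw] at h1
  obtain ⟨δ, hδ, hs⟩ := HasVelocity.exists_lift hG.isSubmersion_src (p := Arrows.of g) h1
  exact ⟨δ, δ', hδ, hδ', hs⟩

theorem dsrc_dmul {x y z : M} (g : y ⟶ z) (h : x ⟶ y)
    (v : TangentSpace 𝓘(ℝ, EG) (Arrows.of g)) (w : TangentSpace 𝓘(ℝ, EG) (Arrows.of h))
    (hvw : dsrc EM EG g v = dtgt EM EG h w) :
    dsrc EM EG (h ≫ g) (dmul EG g h (v, w)) = dsrc EM EG h w := by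
  obtain ⟨δ, δ', hδ, hδ', hs⟩ := exists_composable_curves EM EG g h v w hvw
  refine HasVelocity.unique (EN := EM) (hδ.mul hG hδ' hs).src hδ'.src ?_
  filter_upwards [hs] with τ hτ
  rw [Arrows.src_mul _ _ hτ]

theorem dtgt_dmul {x y z : M} (g : y ⟶ z) (h : x ⟶ y)
    (v : TangentSpace 𝓘(ℝ, EG) (Arrows.of g)) (w : TangentSpace 𝓘(ℝ, EG) (Arrows.of h))
    (hvw : dsrc EM EG g v = dtgt EM EG h w) :
    dtgt EM EG (h ≫ g) (dmul EG g h (v, w)) = dtgt EM EG g v := by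
  obtain ⟨δ, δ', hδ, hδ', hs⟩ := exists_composable_curves EM EG g h v w hvw
  refine HasVelocity.unique (EN := EM) (hδ.mul hG hδ' hs).tgt hδ.tgt ?_
  filter_upwards [hs] with τ hτ
  rw [Arrows.tgt_mul _ _ hτ]

/-- The differential of the unit map. -/
noncomputable def dunit (x : M) : TangentSpace 𝓘(ℝ, EM) x →ₗ[ℝ] TangentSpace 𝓘(ℝ, EG) (Arrows.unit x) :=
  (mfderiv 𝓘(ℝ, EM) 𝓘(ℝ, EG) (Arrows.unit : M → Arrows M) x).toLinearMap

variable {EM} in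
theorem HasVelocity.unit {β : ℝ → M} {x : M} {v : EM} (hβ : HasVelocity EM β x v) :
    HasVelocity EG (fun τ => Arrows.unit (β τ)) (Arrows.unit x) (dunit EM EG x v) :=
  hβ.comp (hG.contMDiff_unit.mdifferentiable (by simp) x)

theorem dsrc_dunit (x : M) (v : TangentSpace 𝓘(ℝ, EM) x) :
    dsrc EM EG (𝟙 x) (dunit EM EG x v) = v := by
  obtain ⟨β, hβ⟩ := exists_hasVelocity (EN := EM) x v
  exact HasVelocity.unique (EN := EM) (hβ.unit EG).src hβ Filter.EventuallyEq.rfl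

theorem dtgt_dunit (x : M) (v : TangentSpace 𝓘(ℝ, EM) x) :
    dtgt EM EG (𝟙 x) (dunit EM EG x v) = v := by
  obtain ⟨β, hβ⟩ := exists_hasVelocity (EN := EM) x v
  exact HasVelocity.unique (EN := EM) (hβ.unit EG).tgt hβ Filter.EventuallyEq.rfl

theorem rightTranslation_id (x : M) (a : algFiber EM EG x) :
    rightTranslation EM EG (𝟙 x) a = a.1 := by
  obtain ⟨γ, hγ, hs⟩ := algFiber_exists_curve a
  refine (hγ.rightTranslation (𝟙 x) hs).unique hγ ?_
  filter_upwards [hs] with τ hτ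
  exact (Arrows.mul_unit _ hτ).symm

/-- At a unit, the differential of the inversion is `-1` on the Lie algebroid, up to vectors
tangent to the space of units. -/
theorem leftTranslation_id (x : M) (a : algFiber EM EG x) :
    leftTranslation EM EG (𝟙 x) a = dunit EM EG x (dtgt EM EG (𝟙 x) a.1) - a.1 := by
  obtain ⟨γ, hγ, hs⟩ := algFiber_exists_curve a
  have h0 := hγ.leftTranslation (𝟙 x) hs
  have h1 : HasVelocity EG (fun τ => (γ τ).inv) (Arrows.unit x)
      (leftTranslation EM EG (𝟙 x) a) := by
    refine h0.congr ?_
    filter_upwards [hs] with τ hτ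
    have := Arrows.mul_unit _ hτ
    rw [show Groupoid.inv (𝟙 x) = 𝟙 x by simp [Groupoid.inv_eq_inv]]
    exact congrArg Arrows.inv this.symm
  -- The unit laws give the two partial differentials of the multiplication at a pair of units.
  have h2 : dmul EG (𝟙 x) (𝟙 x) ((a.1 : EG), (0 : EG)) = a.1 := by
    refine (hγ.mul hG (hasVelocity_const EG (Arrows.unit x)) hs).unique hγ ?_
    filter_upwards [hs] with τ hτ using (Arrows.mul_unit _ hτ).symm
  have h3 : dmul EG (𝟙 x) (𝟙 x) ((0 : EG), (leftTranslation EM EG (𝟙 x) a : EG)) =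
      leftTranslation EM EG (𝟙 x) a := by
    refine ((hasVelocity_const EG (Arrows.unit x)).mul hG h1 ?_).unique h1 ?_
    · filter_upwards [hs] with τ hτ using hτ.symm
    · filter_upwards [hs] with τ hτ using (Arrows.unit_mul _ hτ).symm
  -- The derivative of `k k⁻¹ = 1_{t(k)}`; by additivity it is also the sum of `h2` and `h3`.
  have h4 : dmul EG (𝟙 x) (𝟙 x) ((a.1 : EG), (leftTranslation EM EG (𝟙 x) a : EG)) =
      dunit EM EG x (dtgt EM EG (𝟙 x) a.1) := by
    refine (hγ.mul hG h1 (Filter.Eventually.of_forall fun _ => rfl)).unique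
      (hγ.tgt.unit EG) ?_
    filter_upwards with τ using (Arrows.mul_inv_self _).symm
  have h5 : ∀ A X : EG, dmul EG (𝟙 x) (𝟙 x) (A, X) =
      dmul EG (𝟙 x) (𝟙 x) (A, 0) + dmul EG (𝟙 x) (𝟙 x) (0, X) := by
    intro A X
    rw [← map_add]
    simp
  have h6 := (h5 a.1 (leftTranslation EM EG (𝟙 x) a)).symm.trans h4
  refine eq_sub_of_add_eq' ?_
  exact (congrArg₂ (fun u v : EG => u + v) h2.symm h3.symm).trans h6

variable [FiniteDimensional ℝ EM]

/-- The determinant that describes the action of the arrow `g : x ⟶ y` in terms of frames of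
`A_x`, `T_x M`, `A_y` and `T_y M`. -/
noncomputable def arrowDet {x y : M} (g : x ⟶ y) (a : Frame (algRank EM EG) (algFiber EM EG x))
    (b : Frame (Module.finrank ℝ EM) (TangentSpace 𝓘(ℝ, EM) x))
    (a' : Frame (algRank EM EG) (algFiber EM EG y))
    (b' : Frame (Module.finrank ℝ EM) (TangentSpace 𝓘(ℝ, EM) y)) : ℝˣ :=
  frameDet (exists_isAdapted (shortExact_leftTranslation EM EG g) a b').choose
    (exists_isAdapted (shortExact_arrow EM EG g) a' b).choose

/-- The choices in `arrowDet` are immaterial, since frames adapted to the same outer frames have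
relative determinant one. -/
theorem arrowDet_eq {x y : M} {g : x ⟶ y} {a : Frame (algRank EM EG) (algFiber EM EG x)}
    {b : Frame (Module.finrank ℝ EM) (TangentSpace 𝓘(ℝ, EM) x)}
    {a' : Frame (algRank EM EG) (algFiber EM EG y)}
    {b' : Frame (Module.finrank ℝ EM) (TangentSpace 𝓘(ℝ, EM) y)}
    {u w : Frame (algRank EM EG + Module.finrank ℝ EM) (TangentSpace 𝓘(ℝ, EG) (Arrows.of g))}
    (hu : IsAdapted (rightTranslation EM EG g) (dsrc EM EG g) a' b u)
    (hw : IsAdapted (leftTranslation EM EG g) (dtgt EM EG g) a b' w) :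
    arrowDet EM EG g a b a' b' = frameDet w u := by
  have h1 := (exists_isAdapted (shortExact_leftTranslation EM EG g) a b').choose_spec
  have h2 := (exists_isAdapted (shortExact_arrow EM EG g) a' b).choose_spec
  rw [arrowDet, ← frameDet_mul _ w, ← frameDet_mul w u, frameDet_isAdapted hw h1,
    frameDet_isAdapted h2 hu]
  simp

/-- Used for smoothness, where adapted frames come with auxiliary frames of `T_x M` and `T_y M` that
depend on the arrow. -/
theorem arrowDet_change {x y : M} (g : x ⟶ y) (a c : Frame (algRank EM EG) (algFiber EM EG x))
    (b d : Frame (Module.finrank ℝ EM) (TangentSpace 𝓘(ℝ, EM) x))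
    (a' c' : Frame (algRank EM EG) (algFiber EM EG y))
    (b' d' : Frame (Module.finrank ℝ EM) (TangentSpace 𝓘(ℝ, EM) y)) :
    arrowDet EM EG g a b a' b' = frameDet a c * frameDet b' d' * arrowDet EM EG g c d c' d' *
      frameDet c' a' * frameDet d b := by
  obtain ⟨u, hu⟩ := exists_isAdapted (shortExact_arrow EM EG g) a' b
  obtain ⟨w, hw⟩ := exists_isAdapted (shortExact_leftTranslation EM EG g) a b'
  obtain ⟨u', hu'⟩ := exists_isAdapted (shortExact_arrow EM EG g) c' d
  obtain ⟨w', hw'⟩ := exists_isAdapted (shortExact_leftTranslation EM EG g) c d'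
  rw [arrowDet_eq EM EG hu hw, arrowDet_eq EM EG hu' hw', ← frameDet_isAdapted hw' hw, mul_assoc,
    ← frameDet_isAdapted hu hu', frameDet_mul, frameDet_mul]

theorem arrowDet_comp_aux {x y z : M} (h : x ⟶ y) (g : y ⟶ z)
    (ax : Frame (algRank EM EG) (algFiber EM EG x))
    (bx : Frame (Module.finrank ℝ EM) (TangentSpace 𝓘(ℝ, EM) x))
    (ay : Frame (algRank EM EG) (algFiber EM EG y))
    (by' : Frame (Module.finrank ℝ EM) (TangentSpace 𝓘(ℝ, EM) y))
    (az : Frame (algRank EM EG) (algFiber EM EG z))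
    (bz : Frame (Module.finrank ℝ EM) (TangentSpace 𝓘(ℝ, EM) z)) :
    arrowDet EM EG (h ≫ g) ax bx az bz =
      LinearEquiv.det (blockSwap (algRank EM EG) (Module.finrank ℝ EM)) ^ 3 *
        arrowDet EM EG g ay by' az bz * arrowDet EM EG h ax bx ay by' := by
  obtain ⟨ug, hug⟩ := exists_isAdapted (shortExact_arrow EM EG g) az by'
  obtain ⟨wg, hwg⟩ := exists_isAdapted (shortExact_leftTranslation EM EG g) ay bz
  obtain ⟨uh, huh⟩ := exists_isAdapted (shortExact_arrow EM EG h) ay bx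
  obtain ⟨wh, hwh⟩ := exists_isAdapted (shortExact_leftTranslation EM EG h) ax by'
  obtain ⟨uk, huk⟩ := exists_isAdapted (shortExact_arrow EM EG (h ≫ g)) az bx
  obtain ⟨wk, hwk⟩ := exists_isAdapted (shortExact_leftTranslation EM EG (h ≫ g)) ax bz
  rw [arrowDet_eq EM EG hug hwg, arrowDet_eq EM EG huh hwh, arrowDet_eq EM EG huk hwk]
  let μ : TangentSpace 𝓘(ℝ, EG) (Arrows.of g) × TangentSpace 𝓘(ℝ, EG) (Arrows.of h) →ₗ[ℝ]
      TangentSpace 𝓘(ℝ, EG) (Arrows.of (h ≫ g)) := (dmul EG g h).toLinearMap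
  exact frameDet_composition (shortExact_arrow EM EG g) (shortExact_leftTranslation EM EG g)
    (shortExact_arrow EM EG h) (shortExact_leftTranslation EM EG h)
    (shortExact_arrow EM EG (h ≫ g)) μ
    (dmul_rightTranslation EM EG g h) (dmul_leftTranslation EM EG g h)
    (dmul_leftTranslation_rightTranslation EM EG g h) (dsrc_leftTranslation EM EG g h)
    (dsrc_dmul EM EG g h) (dtgt_dmul EM EG g h) hug hwg huh hwh huk hwk

/-- The unit map splits both sequences at `1_x`. Right translation is the inclusion of `A_x` and
left translation is minus the inclusion modulo vectors tangent to the units, so the two frames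
differ by `-1` on a quotient of dimension `r`. -/
theorem arrowDet_id (x : M) (a : Frame (algRank EM EG) (algFiber EM EG x))
    (b : Frame (Module.finrank ℝ EM) (TangentSpace 𝓘(ℝ, EM) x)) :
    arrowDet EM EG (𝟙 x) a b a b = (-1) ^ algRank EM EG := by
  let r := algRank EM EG
  let n := Module.finrank ℝ EM
  let σ := dunit EM EG x
  let ι := (algFiber EM EG x).subtype
  let π₁ : (Fin (r + n) → ℝ) →ₗ[ℝ] Fin r → ℝ := LinearMap.funLeft ℝ ℝ (Fin.castAdd n)
  let π₂ : (Fin (r + n) → ℝ) →ₗ[ℝ] Fin n → ℝ := LinearMap.funLeft ℝ ℝ (Fin.natAdd r)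
  have hπ₁ : ∀ c d, π₁ (Fin.append c d) = c := by
    intro c d; ext i; simp [π₁, LinearMap.funLeft_apply]
  have hπ₂ : ∀ c d, π₂ (Fin.append c d) = d := by
    intro c d; ext i; simp [π₂, LinearMap.funLeft_apply]
  have hι : ∀ v, dsrc EM EG (𝟙 x) (ι v) = 0 := fun v => v.2
  obtain ⟨u, hu, huT⟩ := exists_isAdapted_eq (shortExact_arrow EM EG (𝟙 x)) a b
    (ι ∘ₗ a.toLinearMap ∘ₗ π₁ + σ ∘ₗ b.toLinearMap ∘ₗ π₂)
    (by
      intro c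
      simp only [LinearMap.add_apply, LinearMap.comp_apply, hπ₁, hπ₂, map_zero, add_zero,
        LinearEquiv.coe_coe]
      exact (rightTranslation_id EM EG x (a c)).symm)
    (by
      intro c d
      simp only [LinearMap.add_apply, LinearMap.comp_apply, hπ₁, hπ₂, map_add, hι, zero_add,
        LinearEquiv.coe_coe]
      exact dsrc_dunit EM EG x (b d))
  obtain ⟨w, hw, hwT⟩ := exists_isAdapted_eq (shortExact_leftTranslation EM EG (𝟙 x)) a b
    (leftTranslation EM EG (𝟙 x) ∘ₗ a.toLinearMap ∘ₗ π₁ + σ ∘ₗ b.toLinearMap ∘ₗ π₂)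
    (by
      intro c
      simp only [LinearMap.add_apply, LinearMap.comp_apply, hπ₁, hπ₂, map_zero, add_zero,
        LinearEquiv.coe_coe])
    (by
      intro c d
      simp only [LinearMap.add_apply, LinearMap.comp_apply, hπ₁, hπ₂, map_add,
        LinearEquiv.coe_coe]
      rw [((shortExact_leftTranslation EM EG (𝟙 x)).exact _).2 ⟨a c, rfl⟩, zero_add]
      exact dtgt_dunit EM EG x (b d))
  rw [arrowDet_eq EM EG hu hw]
  have hσ : ∀ v, dsrc EM EG (𝟙 x) (σ v) = v := dsrc_dunit EM EG x
  -- The projection onto `A_x` along the units. With `T_x M` as the subspace and `A_x` as the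
  -- quotient, both frames become adapted to one sequence, at the cost of flipping the blocks by
  -- `P`.
  let q : TangentSpace 𝓘(ℝ, EG) (Arrows.unit x) →ₗ[ℝ] algFiber EM EG x :=
    LinearMap.codRestrict _ (LinearMap.id - σ ∘ₗ dsrc EM EG (𝟙 x)) (fun v => by
      show dsrc EM EG (𝟙 x) (v - σ (dsrc EM EG (𝟙 x) v)) = 0
      rw [map_sub, hσ, sub_self])
  have hq : ∀ v, (q v).1 = v - σ (dsrc EM EG (𝟙 x) v) := fun _ => rfl
  have hqσ : ∀ v, q (σ v) = 0 := fun v => Subtype.ext (by rw [hq, hσ, sub_self]; rfl)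
  have hqι : ∀ v, q (ι v) = v := fun v => Subtype.ext (by rw [hq, hι, map_zero, sub_zero]; rfl)
  let P : (Fin (n + r) → ℝ) ≃ₗ[ℝ] (Fin (r + n) → ℝ) := LinearEquiv.funCongrLeft ℝ ℝ finAddFlip
  have hP : ∀ (d : Fin n → ℝ) (c : Fin r → ℝ), P (Fin.append d c) = Fin.append c d := by
    intro d c; ext i
    refine Fin.addCases (fun i => ?_) (fun i => ?_) i <;>
      simp [P, LinearEquiv.funCongrLeft_apply, LinearMap.funLeft_apply]
  have hu' : IsAdapted σ q b a (P.trans u) := by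
    constructor
    · intro d
      simp [hP, huT, hπ₁, hπ₂]
    · intro d c
      simp [hP, huT, hπ₁, hπ₂, hqσ, hqι]
  -- The term `σ (dt a)` of `leftTranslation_id` lies in the subspace and disappears under `q`; only
  -- the sign is left.
  have hw' : IsAdapted σ q b ((LinearEquiv.neg ℝ).trans a) (P.trans w) := by
    constructor
    · intro d
      simp [hP, hwT, hπ₁, hπ₂]
    · intro d c
      have h1 : leftTranslation EM EG (𝟙 x) (a c) = σ (dtgt EM EG (𝟙 x) (ι (a c))) - ι (a c) :=
        leftTranslation_id EM EG x (a c)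
      simp [hP, hwT, hπ₁, hπ₂, hqσ, hqι, h1]
  -- Flipping both frames conjugates the transition map.
  have h1 : frameDet (P.trans w) (P.trans u) = frameDet w u := by
    unfold frameDet
    rw [← LinearEquiv.det_conj (w.trans u.symm) P.symm]
    rfl
  rw [← h1, frameDet_isAdapted hu' hw', frameDet_self, one_mul, frameDet_trans_left, frameDet_self,
    mul_one]
  ext
  rw [LinearEquiv.coe_det]
  have : ((LinearEquiv.neg ℝ : GLr r) : (Fin r → ℝ) →ₗ[ℝ] Fin r → ℝ) =
      (-1 : ℝ) • LinearMap.id := by ext; simp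
  rw [this, LinearMap.det_smul]
  simp [r]

/-- The sign of the exchange is not computed but read off from `1_x · 1_x = 1_x`, where all three
determinants of arrows are known. -/
theorem det_blockSwap_pow_three (x : M) :
    LinearEquiv.det (blockSwap (algRank EM EG) (Module.finrank ℝ EM)) ^ 3 =
      (-1) ^ algRank EM EG := by
  obtain ⟨a⟩ := nonempty_algFrame EM EG x
  obtain ⟨b⟩ := nonempty_tangentFrame (EM := EM) x
  have h := arrowDet_comp_aux EM EG (𝟙 x) (𝟙 x) a b a b a b
  rw [Category.comp_id, arrowDet_id, mul_assoc, ← mul_pow] at h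
  simpa using h.symm

theorem arrowDet_comp {x y z : M} (h : x ⟶ y) (g : y ⟶ z)
    (ax : Frame (algRank EM EG) (algFiber EM EG x))
    (bx : Frame (Module.finrank ℝ EM) (TangentSpace 𝓘(ℝ, EM) x))
    (ay : Frame (algRank EM EG) (algFiber EM EG y))
    (by' : Frame (Module.finrank ℝ EM) (TangentSpace 𝓘(ℝ, EM) y))
    (az : Frame (algRank EM EG) (algFiber EM EG z))
    (bz : Frame (Module.finrank ℝ EM) (TangentSpace 𝓘(ℝ, EM) z)) :
    arrowDet EM EG (h ≫ g) ax bx az bz = (-1) ^ algRank EM EG *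
        arrowDet EM EG g ay by' az bz * arrowDet EM EG h ax bx ay by' := by
  rw [arrowDet_comp_aux EM EG h g ax bx ay by' az bz, det_blockSwap_pow_three EM EG x]

/-- The sign of the product formula cancels against the value at the unit. Hence inverse arrows have
inverse determinants even without the correction by `(-1)^r`, which serves the dual of `g_♯`. -/
theorem arrowDet_inv {x y : M} (g : x ⟶ y) (a : Frame (algRank EM EG) (algFiber EM EG x))
    (b : Frame (Module.finrank ℝ EM) (TangentSpace 𝓘(ℝ, EM) x))
    (a' : Frame (algRank EM EG) (algFiber EM EG y))
    (b' : Frame (Module.finrank ℝ EM) (TangentSpace 𝓘(ℝ, EM) y)) :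
    arrowDet EM EG (Groupoid.inv g) a' b' a b * arrowDet EM EG g a b a' b' = 1 := by
  have h := arrowDet_comp EM EG g (Groupoid.inv g) a b a' b' a b
  rw [Groupoid.comp_inv, arrowDet_id, mul_assoc] at h
  simpa using h.symm

/-- The local trivialization of `L_χ^tr` given by frames of the Lie algebroid and of the tangent
bundle. -/
noncomputable def trEval (χ : ℝ →*₀ ℝ) [SmoothChar χ] {x : M}
    (a : Frame (algRank EM EG) (algFiber EM EG x))
    (b : Frame (Module.finrank ℝ EM) (TangentSpace 𝓘(ℝ, EM) x)) :
    (trLine EM EG χ : LineBundle EM M).Fiber x ≃ₗ[ℝ] ℝ :=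
  Line.eval₂ _ _ (dualFrame a) b

/-- The crucial point is that `arrowDet` is the same for all `χ`: every comparison between the
bundles reduces to an identity between characters. -/
theorem trEval_rawAction (χ : ℝ →*₀ ℝ) [SmoothChar χ] {x y : M} (g : x ⟶ y)
    (a : Frame (algRank EM EG) (algFiber EM EG x))
    (b : Frame (Module.finrank ℝ EM) (TangentSpace 𝓘(ℝ, EM) x))
    (a' : Frame (algRank EM EG) (algFiber EM EG y))
    (b' : Frame (Module.finrank ℝ EM) (TangentSpace 𝓘(ℝ, EM) y))
    (v : (trLine EM EG χ : LineBundle EM M).Fiber x) :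
    trEval EM EG χ a' b' (rawAction EM EG χ x y g v) =
      χ (arrowDet EM EG g a b a' b' : ℝˣ) * trEval EM EG χ a b v := by
  obtain ⟨u, hu⟩ := exists_isAdapted (shortExact_arrow EM EG g) a' b
  obtain ⟨w, hw⟩ := exists_isAdapted (shortExact_arrow EM EG (Groupoid.inv g)) a b'
  -- The frame adapted at `g⁻¹` is brought to `T_g 𝒢` by the inverse of the differential of the
  -- inversion.
  have hw' : IsAdapted (leftTranslation EM EG g) (dtgt EM EG g) a b'
      (w.trans (dinv EM EG g).symm) :=
    ⟨fun c => congrArg (dinv EM EG g).symm (hw.1 c), fun c d =>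
      (congrArg (dsrc EM EG (Groupoid.inv g)) ((dinv EM EG g).apply_symm_apply _)).trans (hw.2 c d)⟩
  rw [arrowDet_eq EM EG hu hw']
  exact Line.eval₂_transport χ (shortExact_arrow EM EG g) (shortExact_arrow EM EG (Groupoid.inv g))
    (dinv EM EG g) (nonempty_algFrame EM EG y) (nonempty_tangentFrame x)
    (nonempty_algFrame EM EG x) (nonempty_tangentFrame y) hu hw v

theorem trEval_trAction (χ : ℝ →*₀ ℝ) [SmoothChar χ] {x y : M} (g : x ⟶ y)
    (a : Frame (algRank EM EG) (algFiber EM EG x))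
    (b : Frame (Module.finrank ℝ EM) (TangentSpace 𝓘(ℝ, EM) x))
    (a' : Frame (algRank EM EG) (algFiber EM EG y))
    (b' : Frame (Module.finrank ℝ EM) (TangentSpace 𝓘(ℝ, EM) y))
    (v : (trLine EM EG χ : LineBundle EM M).Fiber x) :
    trEval EM EG χ a' b' (trAction EM EG χ x y g v) =
      χ ((-1) ^ algRank EM EG * (arrowDet EM EG g a b a' b' : ℝˣ)) * trEval EM EG χ a b v := by
  rw [trAction, LinearMap.smul_apply, map_smul, trEval_rawAction EM EG χ g a b, smul_eq_mul,
    map_mul, mul_assoc]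

theorem trAction_id (χ : ℝ →*₀ ℝ) [SmoothChar χ] (x : M) :
    trAction EM EG χ x x (𝟙 x) = LinearMap.id := by
  obtain ⟨a⟩ := nonempty_algFrame EM EG x
  obtain ⟨b⟩ := nonempty_tangentFrame (EM := EM) x
  refine LinearMap.ext fun v => (trEval EM EG χ a b).injective ?_
  rw [trEval_trAction EM EG χ (𝟙 x) a b, arrowDet_id]
  push_cast
  rw [← mul_pow]
  simp

/-- Both sides carry two signs: on the left one from `trAction` and one from `arrowDet_comp`, on the
right one for each arrow. -/
theorem trAction_comp (χ : ℝ →*₀ ℝ) [SmoothChar χ] (x y z : M) (g : x ⟶ y) (h : y ⟶ z) :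
    trAction EM EG χ x z (g ≫ h) = trAction EM EG χ y z h ∘ₗ trAction EM EG χ x y g := by
  obtain ⟨a⟩ := nonempty_algFrame EM EG x
  obtain ⟨b⟩ := nonempty_tangentFrame (EM := EM) x
  obtain ⟨a'⟩ := nonempty_algFrame EM EG y
  obtain ⟨b'⟩ := nonempty_tangentFrame (EM := EM) y
  obtain ⟨a''⟩ := nonempty_algFrame EM EG z
  obtain ⟨b''⟩ := nonempty_tangentFrame (EM := EM) z
  refine LinearMap.ext fun v => (trEval EM EG χ a'' b'').injective ?_
  rw [LinearMap.comp_apply, trEval_trAction EM EG χ (g ≫ h) a b,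
    trEval_trAction EM EG χ h a' b', trEval_trAction EM EG χ g a b,
    arrowDet_comp EM EG g h a b a' b', ← mul_assoc, ← map_mul]
  congr 2
  push_cast
  ring

end Determinants

end TransverseBundles

namespace TransverseBundles

/-! ### Smooth dependence of derivatives on parameters -/

section ParametricDerivative

variable {EN N EB B F : Type*} [NormedAddCommGroup EN] [NormedSpace ℝ EN]
  [TopologicalSpace N] [ChartedSpace EN N] [IsManifold 𝓘(ℝ, EN) ∞ N]
  [NormedAddCommGroup EB] [NormedSpace ℝ EB] [TopologicalSpace B] [ChartedSpace EB B]
  [IsManifold 𝓘(ℝ, EB) ∞ B] [NormedAddCommGroup F] [NormedSpace ℝ F]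

/-- The derivative of a smooth map `Ψ : N × F → B` in the second variable is smooth. -/
theorem contMDiffAt_mfderiv_section {Ψ : N → F → B} {κ W : N → F} {p : N}
    (hΨ : ContMDiffAt (𝓘(ℝ, EN).prod 𝓘(ℝ, F)) 𝓘(ℝ, EB) ∞ (Function.uncurry Ψ) (p, κ p))
    (hκ : ContMDiffAt 𝓘(ℝ, EN) 𝓘(ℝ, F) ∞ κ p) (hW : ContMDiffAt 𝓘(ℝ, EN) 𝓘(ℝ, F) ∞ W p) :
    ContMDiffAt 𝓘(ℝ, EN) (𝓘(ℝ, EB).prod 𝓘(ℝ, EB)) ∞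
      (fun q => (⟨Ψ q (κ q), mfderiv 𝓘(ℝ, F) 𝓘(ℝ, EB) (Ψ q) (κ q) (W q)⟩ :
        TangentBundle 𝓘(ℝ, EB) B)) p := by
  have h1 := hΨ.mfderiv (m := ∞) Ψ κ hκ (by simp)
  have h2 : ContMDiffAt 𝓘(ℝ, EN) (𝓘(ℝ, F).prod 𝓘(ℝ, F)) ∞
      (fun q => (⟨κ q, W q⟩ : TangentBundle 𝓘(ℝ, F) F)) p := by
    rw [contMDiffAt_totalSpace]
    exact ⟨hκ, by simpa using hW⟩
  have h3 : ContMDiffAt 𝓘(ℝ, EN) 𝓘(ℝ, EB) ∞ (fun q => Ψ q (κ q)) p :=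
    hΨ.comp p (contMDiffAt_id.prodMk hκ)
  exact ContMDiffWithinAt.clm_apply_of_inCoordinates (s := univ)
    (ϕ := fun q => mfderiv 𝓘(ℝ, F) 𝓘(ℝ, EB) (Ψ q) (κ q)) h1 h2 h3

end ParametricDerivative

/-! ### Smooth adapted frames and smoothness of the determinants -/

section SmoothFrames

variable {EM EG M : Type*} [Groupoid M]
    [NormedAddCommGroup EM] [NormedSpace ℝ EM] [NormedAddCommGroup EG] [NormedSpace ℝ EG]
    [TopologicalSpace M] [ChartedSpace EM M]
    [TopologicalSpace (Arrows M)] [ChartedSpace EG (Arrows M)]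
    [IsManifold 𝓘(ℝ, EM) ∞ M] [IsManifold 𝓘(ℝ, EG) ∞ (Arrows M)] [hG : LieGroupoid EM EG M]

/-- The right-invariant vector field of a smooth section of the Lie algebroid is smooth. -/
theorem contMDiffOn_rightTranslation {U : Opens M} {Y : ∀ y : M, algFiber EM EG y}
    (hY : ContMDiffOn 𝓘(ℝ, EM) (𝓘(ℝ, EG).prod 𝓘(ℝ, EG)) ∞
      (fun y => (⟨Arrows.unit y, (Y y).1⟩ : TangentBundle 𝓘(ℝ, EG) (Arrows M))) U) :
    ContMDiffOn 𝓘(ℝ, EG) (𝓘(ℝ, EG).prod 𝓘(ℝ, EG)) ∞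
      (fun g : Arrows M => (⟨g, rightTranslation EM EG g.hom (Y g.tgt)⟩ :
        TangentBundle 𝓘(ℝ, EG) (Arrows M))) (Arrows.tgt ⁻¹' (U : Set M)) := by
  intro g₀ hg₀
  obtain ⟨F, _, _, l, e, k, he, hp, hk, hD⟩ :=
    submersion_local hG.isSubmersion_src (Arrows.unit g₀.tgt)
  have hm := mdifferentiable_of_mem_maximalAtlas he
  let O : Set M := Arrows.unit ⁻¹' e.source
  have hO : IsOpen O := e.open_source.preimage hG.contMDiff_unit.continuous
  let κ : M → EM × F := fun y => l (e (Arrows.unit y))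
  let w : ∀ y : M, EG := fun y => mfderiv 𝓘(ℝ, EG) 𝓘(ℝ, EG) e (Arrows.unit y) (Y y).1
  have hw : ∀ y ∈ O, (mfderiv 𝓘(ℝ, EG) 𝓘(ℝ, EG) e.symm (e (Arrows.unit y)) (w y) : EG) =
      (Y y).1 := fun y hy => DFunLike.congr_fun (hm.symm_comp_deriv hy) (Y y).1
  -- The section is tangent to the source fibres, so in the submersion chart it has no component
  -- along the base.
  have hw0 : ∀ y ∈ O, (l (w y)).1 = 0 := by
    intro y hy
    obtain ⟨D, hD⟩ := hD _ (e.map_source hy)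
    have h1 := hD (w y)
    rw [hw y hy, e.left_inv hy] at h1
    have h2 : D (l (w y)).1 = 0 := h1.symm.trans (Y y).2
    simpa using h2
  have hκ : ContMDiffOn 𝓘(ℝ, EM) 𝓘(ℝ, EM × F) ∞ κ O :=
    l.contDiff.contMDiff.comp_contMDiffOn
      ((contMDiffOn_of_mem_maximalAtlas he).comp hG.contMDiff_unit.contMDiffOn (fun y hy => hy))
  have hwC : ContMDiffOn 𝓘(ℝ, EM) 𝓘(ℝ, EG) ∞ w (O ∩ U) := by
    have h1 := (contMDiffOn_of_mem_maximalAtlas he).contMDiffOn_tangentMapWithin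
      (m := ∞) (by simp) e.open_source.uniqueMDiffOn
    have h2 := h1.comp (hY.mono inter_subset_right) (fun y (hy : y ∈ O ∩ U) => hy.1)
    have h3 : ContMDiffOn 𝓘(ℝ, EM) (𝓘(ℝ, EG).prod 𝓘(ℝ, EG)) ∞
        (fun y => (⟨e (Arrows.unit y), w y⟩ : TangentBundle 𝓘(ℝ, EG) EG)) (O ∩ U) := by
      refine h2.congr ?_
      intro y hy
      simp only [Function.comp, tangentMapWithin]
      rw [mfderivWithin_of_isOpen e.open_source hy.1]
    intro y hy
    have h4 := (contMDiffWithinAt_totalSpace.1 (h3 y hy)).2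
    simpa using h4
  -- The base coordinate is frozen at that of the unit `1_{t(g)}` while `F` parametrizes the source
  -- fibre. The resulting arrow has source `t(g)` and may be multiplied by `g`, so right translation
  -- becomes a derivative in the `F` variable of a map on an open set.
  let θ : Arrows M × F → EG := fun q => l.symm ((κ q.1.tgt).1, q.2)
  let Ω₁ : Set (Arrows M × F) := Prod.fst ⁻¹' (Arrows.tgt ⁻¹' O)
  have hΩ₁ : IsOpen Ω₁ := (hO.preimage hG.contMDiff_tgt.continuous).preimage continuous_fst
  have hθ : ContMDiffOn (𝓘(ℝ, EG).prod 𝓘(ℝ, F)) 𝓘(ℝ, EG) ∞ θ Ω₁ := by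
    have h1 : ContMDiffOn (𝓘(ℝ, EG).prod 𝓘(ℝ, F)) 𝓘(ℝ, EM) ∞
        (fun q : Arrows M × F => (κ q.1.tgt).1) Ω₁ :=
      contDiff_fst.contMDiff.comp_contMDiffOn
        (hκ.comp (hG.contMDiff_tgt.comp contMDiff_fst).contMDiffOn (fun q hq => hq))
    have h2 : ContMDiffOn (𝓘(ℝ, EG).prod 𝓘(ℝ, F)) 𝓘(ℝ, EM × F) ∞
        (fun q : Arrows M × F => ((κ q.1.tgt).1, q.2)) Ω₁ :=
      h1.prodMk_space contMDiff_snd.contMDiffOn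
    exact l.symm.contDiff.contMDiff.comp_contMDiffOn h2
  let Ω : Set (Arrows M × F) := Ω₁ ∩ θ ⁻¹' e.target
  have hΩ : IsOpen Ω := hθ.continuousOn.isOpen_inter_preimage hΩ₁ e.open_target
  have hsrc : ∀ q ∈ Ω, (e.symm (θ q)).src = q.1.tgt := by
    intro q hq
    have h1 := hk _ (e.map_source hq.1)
    rw [e.left_inv hq.1] at h1
    rw [hk _ hq.2]
    exact (congrArg (fun z => k (Prod.fst z)) (l.apply_symm_apply _)).trans h1.symm
  let Ψ : Arrows M → F → Arrows M := fun g ζ => (e.symm (θ (g, ζ))).mul g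
  have hΨ : ContMDiffOn (𝓘(ℝ, EG).prod 𝓘(ℝ, F)) 𝓘(ℝ, EG) ∞ (Function.uncurry Ψ) Ω := by
    have h1 : ContMDiffOn (𝓘(ℝ, EG).prod 𝓘(ℝ, F)) 𝓘(ℝ, EG) ∞ (fun q => e.symm (θ q)) Ω :=
      (contMDiffOn_symm_of_mem_maximalAtlas he).comp (hθ.mono inter_subset_left)
        (fun q hq => hq.2)
    exact hG.contMDiffOn_mul.comp (h1.prodMk contMDiff_fst.contMDiffOn) hsrc
  let κ₂ : Arrows M → F := fun g => (κ g.tgt).2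
  let W : Arrows M → F := fun g => (l (w g.tgt)).2
  have hθκ : ∀ g : Arrows M, θ (g, κ₂ g) = e (Arrows.unit g.tgt) := fun g =>
    l.symm_apply_apply (e (Arrows.unit g.tgt))
  have hmem : ∀ g : Arrows M, g.tgt ∈ O → (g, κ₂ g) ∈ Ω := fun g hg =>
    ⟨hg, by
      show θ (g, κ₂ g) ∈ e.target
      rw [hθκ]
      exact e.map_source hg⟩
  have hΨat : ∀ g : Arrows M, g.tgt ∈ O →
      ContMDiffAt (𝓘(ℝ, EG).prod 𝓘(ℝ, F)) 𝓘(ℝ, EG) ∞ (Function.uncurry Ψ) (g, κ₂ g) :=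
    fun g hg => hΨ.contMDiffAt (hΩ.mem_nhds (hmem g hg))
  have hκ₂ : ContMDiffAt 𝓘(ℝ, EG) 𝓘(ℝ, F) ∞ κ₂ g₀ :=
    contDiff_snd.contMDiff.contMDiffAt.comp g₀
      ((hκ.contMDiffAt (hO.mem_nhds hp)).comp g₀ hG.contMDiff_tgt.contMDiffAt)
  have hW : ContMDiffAt 𝓘(ℝ, EG) 𝓘(ℝ, F) ∞ W g₀ :=
    contDiff_snd.contMDiff.contMDiffAt.comp g₀ (l.contDiff.contMDiff.contMDiffAt.comp g₀
      ((hwC.contMDiffAt ((hO.inter U.isOpen).mem_nhds ⟨hp, hg₀⟩)).comp g₀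
        hG.contMDiff_tgt.contMDiffAt))
  refine ((contMDiffAt_mfderiv_section (hΨat g₀ hp) hκ₂ hW).congr_of_eventuallyEq ?_).contMDiffWithinAt
  filter_upwards [(hO.preimage hG.contMDiff_tgt.continuous).mem_nhds hp] with g (hg : g.tgt ∈ O)
  have hu : Ψ g (κ₂ g) = g := by
    show (e.symm (θ (g, κ₂ g))).mul g = g
    rw [hθκ, e.left_inv hg]
    exact Arrows.unit_mul g rfl
  refine TotalSpace.ext hu.symm (heq_of_eq ?_)
  have hζ : HasVelocity F (fun τ : ℝ => κ₂ g + τ • W g) (κ₂ g) (W g) := by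
    have := ((hasDerivAt_id (0 : ℝ)).smul_const (W g)).const_add (κ₂ g)
    rw [one_smul] at this
    simpa using HasDerivAt.hasVelocity this
  have hΨg : MDifferentiableAt 𝓘(ℝ, F) 𝓘(ℝ, EG) (Ψ g) (κ₂ g) :=
    ((hΨat g hg).comp (κ₂ g) (contMDiffAt_const.prodMk contMDiffAt_id)).mdifferentiableAt (by simp)
  have hv := hζ.comp hΨg
  -- As `w` has no base component, the line in `F` is the full straight line through the unit in the
  -- chart, and so its velocity there is `Y`.
  have hline : ∀ τ : ℝ, θ (g, κ₂ g + τ • W g) = e (Arrows.unit g.tgt) + τ • w g.tgt := by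
    intro τ
    apply l.injective
    rw [map_add, map_smul]
    show l (l.symm _) = _
    rw [l.apply_symm_apply]
    refine Prod.ext ?_ rfl
    show (κ g.tgt).1 = (κ g.tgt).1 + τ • (l (w g.tgt)).1
    rw [hw0 _ hg, smul_zero, add_zero]
  have hγ : HasVelocity EG (fun τ : ℝ => e.symm (θ (g, κ₂ g + τ • W g))) (Arrows.unit g.tgt)
      (Y g.tgt).1 := by
    have h1 : HasVelocity EG (fun τ : ℝ => θ (g, κ₂ g + τ • W g)) (e (Arrows.unit g.tgt))
        (w g.tgt) := by
      have := ((hasDerivAt_id (0 : ℝ)).smul_const (w g.tgt)).const_add (e (Arrows.unit g.tgt))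
      rw [one_smul] at this
      simp only [hline]
      simpa using HasDerivAt.hasVelocity this
    have h2 := h1.comp (hm.mdifferentiableAt_symm (e.map_source hg))
    rw [hw _ hg, e.left_inv hg] at h2
    exact h2
  have hs : ∀ᶠ τ : ℝ in 𝓝 0, (e.symm (θ (g, κ₂ g + τ • W g))).src = g.tgt := by
    have hc : Continuous fun τ : ℝ => (g, κ₂ g + τ • W g) := by fun_prop
    have : (fun τ : ℝ => (g, κ₂ g + τ • W g)) ⁻¹' Ω ∈ 𝓝 (0 : ℝ) :=
      (hΩ.preimage hc).mem_nhds (by simpa using hmem g hg)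
    filter_upwards [this] with τ hτ using hsrc _ hτ
  exact (hγ.rightTranslation g.hom hs).unique hv Filter.EventuallyEq.rfl

variable [FiniteDimensional ℝ EM] [FiniteDimensional ℝ EG]

/-- Near a given arrow there are smooth frames of the tangent bundle of the space of arrows that
are adapted to the sequences `0 → A_y → T_g 𝒢 → T_x M → 0`. -/
theorem exists_smooth_adapted_frame {U : Opens M}
    {a : ∀ y : M, Frame (algRank EM EG) (algFiber EM EG y)}
    (ha : IsSmoothFrameOn (EM := EM) Arrows.unit (fun x => (algFiber EM EG x).subtype) U a)
    (g₀ : Arrows M) (hg₀ : g₀.tgt ∈ U) : ∃ (O : Opens (Arrows M))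
      (u : ∀ g : Arrows M, Frame (algRank EM EG + Module.finrank ℝ EM) (TangentSpace 𝓘(ℝ, EG) g))
      (f : ∀ g : Arrows M, Frame (Module.finrank ℝ EM) (TangentSpace 𝓘(ℝ, EM) g.src)),
      g₀ ∈ O ∧ IsSmoothFrameOn (EM := EG) id (fun _ => LinearMap.id) O u ∧
      IsSmoothFrameOn (EM := EG) Arrows.src (fun _ => LinearMap.id) O f ∧
      ∀ g ∈ O, IsAdapted (rightTranslation EM EG g.hom) (dsrc EM EG g.hom) (a g.tgt) (f g)
        (u g) := by
  obtain ⟨F, _, _, l, e, k, he, hp, -, hD⟩ := submersion_local hG.isSubmersion_src g₀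
  let β : (Fin (Module.finrank ℝ EM) → ℝ) ≃ₗ[ℝ] EM := (Module.finBasis ℝ EM).equivFun.symm
  let O : Opens (Arrows M) :=
    ⟨e.source ∩ Arrows.tgt ⁻¹' U, e.open_source.inter (U.isOpen.preimage hG.contMDiff_tgt.continuous)⟩
  -- Coordinate fields of the submersion chart that `ds` maps isomorphically. The frame `f` of
  -- `T_{s(g)} M` is defined as their image, so that they lift it by construction.
  let X : (Fin (Module.finrank ℝ EM) → ℝ) → ∀ g : Arrows M, TangentSpace 𝓘(ℝ, EG) g :=
    fun d g => (mfderiv 𝓘(ℝ, EG) 𝓘(ℝ, EG) e.symm (e g) (l.symm (β d, 0)) : EG)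
  have hX : ∀ d, ContMDiffOn 𝓘(ℝ, EG) (𝓘(ℝ, EG).prod 𝓘(ℝ, EG)) ∞
      (fun g => (⟨g, X d g⟩ : TangentBundle 𝓘(ℝ, EG) (Arrows M))) O := by
    intro d
    refine ((contMDiffOn_chart_field (u := (id : Arrows M → Arrows M)) contMDiff_id he
      (l.symm (β d, 0))).mono (fun g hg => hg.1)).congr ?_
    intro g hg
    exact TotalSpace.ext (e.left_inv hg.1).symm (heq_of_eq rfl)
  have key : ∀ g : Arrows M, ∃ (f : Frame (Module.finrank ℝ EM) (TangentSpace 𝓘(ℝ, EM) g.src))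
      (u : Frame (algRank EM EG + Module.finrank ℝ EM) (TangentSpace 𝓘(ℝ, EG) g)), g ∈ O →
      (∀ d, f d = dsrc EM EG g.hom (X d g)) ∧
      IsAdapted (rightTranslation EM EG g.hom) (dsrc EM EG g.hom) (a g.tgt) f u ∧
      ∀ c d, u (Fin.append c d) = rightTranslation EM EG g.hom (a g.tgt c) + X d g := by
    intro g
    by_cases hg : g ∈ O
    · obtain ⟨D, hD⟩ := hD _ (e.map_source hg.1)
      rw [e.left_inv hg.1] at hD
      let f : Frame (Module.finrank ℝ EM) (TangentSpace 𝓘(ℝ, EM) g.src) :=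
        β.trans D.toLinearEquiv
      have hf : ∀ d, f d = dsrc EM EG g.hom (X d g) := by
        intro d
        have h1 := hD (l.symm (β d, 0))
        rw [l.apply_symm_apply] at h1
        exact h1.symm
      let L : EG →L[ℝ] EG := mfderiv 𝓘(ℝ, EG) 𝓘(ℝ, EG) e.symm (e g)
      let X' : (Fin (Module.finrank ℝ EM) → ℝ) →ₗ[ℝ] TangentSpace 𝓘(ℝ, EG) g :=
        L.toLinearMap ∘ₗ l.symm.toLinearEquiv.toLinearMap ∘ₗ LinearMap.inl ℝ EM F ∘ₗ β.toLinearMap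
      have hX' : ∀ d, X' d = X d g := fun d => rfl
      let T := rightTranslation EM EG g.hom ∘ₗ (a g.tgt).toLinearMap ∘ₗ
        LinearMap.funLeft ℝ ℝ (Fin.castAdd (Module.finrank ℝ EM)) +
        X' ∘ₗ LinearMap.funLeft ℝ ℝ (Fin.natAdd (algRank EM EG))
      have hT : ∀ c d, T (Fin.append c d) =
          rightTranslation EM EG g.hom (a g.tgt c) + X d g := by
        intro c d
        have h1 : LinearMap.funLeft ℝ ℝ (Fin.castAdd (Module.finrank ℝ EM)) (Fin.append c d) =
            c := by ext i; simp [LinearMap.funLeft_apply]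
        have h2 : LinearMap.funLeft ℝ ℝ (Fin.natAdd (algRank EM EG)) (Fin.append c d) = d := by
          ext i; simp [LinearMap.funLeft_apply]
        simp only [T, LinearMap.add_apply, LinearMap.comp_apply, h1, h2, LinearEquiv.coe_coe]
        rfl
      obtain ⟨u, hu, huT⟩ := exists_isAdapted_eq (shortExact_arrow EM EG g.hom) (a g.tgt) f T
        (by
          intro c
          rw [hT, ← hX', map_zero, add_zero])
        (by
          intro c d
          rw [hT, map_add, ((shortExact_arrow EM EG g.hom).exact _).2 ⟨_, rfl⟩, zero_add, hf])
      exact ⟨f, u, fun _ => ⟨hf, hu, fun c d => (huT _).trans (hT c d)⟩⟩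
    · obtain ⟨f⟩ := nonempty_tangentFrame (EM := EM) g.src
      obtain ⟨u, -⟩ := exists_isAdapted (shortExact_arrow EM EG g.hom) (a g.tgt) f
      exact ⟨f, u, fun h => absurd h hg⟩
  choose f u hfu using key
  refine ⟨O, u, f, ⟨hp, hg₀⟩, ?_, ?_, fun g hg => (hfu g hg).2.1⟩
  · intro c
    obtain ⟨c, d, rfl⟩ := exists_eq_append c
    have h1 := (contMDiffOn_rightTranslation (Y := fun y => a y c) (ha c)).mono
      (fun g (hg : g ∈ O) => hg.2)
    refine (h1.add_section (hX d)).congr ?_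
    intro g hg
    exact TotalSpace.ext rfl (heq_of_eq ((hfu g hg).2.2 c d))
  · intro d
    refine ((hG.isSubmersion_src.contMDiff.contMDiff_tangentMap (m := ∞)
      (by simp)).comp_contMDiffOn (hX d)).congr ?_
    intro g hg
    exact TotalSpace.ext rfl (heq_of_eq ((hfu g hg).1 d))

/-- The determinants that describe the action of the arrows in terms of smooth frames are
smooth. -/
theorem contMDiffOn_arrowDet {U V U' V' : Opens M}
    {a a' : ∀ y : M, Frame (algRank EM EG) (algFiber EM EG y)}
    {b b' : ∀ y : M, Frame (Module.finrank ℝ EM) (TangentSpace 𝓘(ℝ, EM) y)}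
    (ha : IsSmoothFrameOn (EM := EM) Arrows.unit (fun x => (algFiber EM EG x).subtype) U a)
    (hb : IsSmoothFrameOn (EM := EM) id (fun _ => LinearMap.id) V b)
    (ha' : IsSmoothFrameOn (EM := EM) Arrows.unit (fun x => (algFiber EM EG x).subtype) U' a')
    (hb' : IsSmoothFrameOn (EM := EM) id (fun _ => LinearMap.id) V' b') :
    ContMDiffOn 𝓘(ℝ, EG) 𝓘(ℝ, ℝ) ∞
      (fun g : Arrows M => (arrowDet EM EG g.hom (a g.src) (b g.src) (a' g.tgt) (b' g.tgt) : ℝ))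
      {g | g.src ∈ U ⊓ V ∧ g.tgt ∈ U' ⊓ V'} := by
  rintro g₀ ⟨⟨hU, hV⟩, hU', hV'⟩
  have hsrc := hG.isSubmersion_src.contMDiff
  have htgt := hG.contMDiff_tgt
  have hinv := hG.contMDiff_inv
  obtain ⟨O, u, f, hO, hu, hf, huf⟩ := exists_smooth_adapted_frame ha' g₀ hU'
  obtain ⟨O', u', f', hO', hu', hf', huf'⟩ := exists_smooth_adapted_frame ha g₀.inv hU
  let Q : Opens (Arrows M) := ⟨Arrows.inv ⁻¹' O', O'.isOpen.preimage hinv.continuous⟩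
  -- An adapted frame near `g₀⁻¹`, carried back by the inversion, is adapted to the left sequence.
  let w : ∀ g : Arrows M, Frame (algRank EM EG + Module.finrank ℝ EM) (TangentSpace 𝓘(ℝ, EG) g) :=
    fun g => (u' g.inv).trans (dinv EM EG g.hom).symm
  let d : ∀ g : Arrows M, Frame (Module.finrank ℝ EM) (TangentSpace 𝓘(ℝ, EM) g.tgt) :=
    fun g => f' g.inv
  have hw : IsSmoothFrameOn (EM := EG) id (fun _ => LinearMap.id) Q w := by
    intro c
    refine (((hinv.contMDiff_tangentMap (m := ∞) (by simp)).comp_contMDiffOn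
      (hu' c)).comp hinv.contMDiffOn (fun g (hg : g ∈ Q) => hg)).congr ?_
    intro g hg
    refine TotalSpace.ext (Arrows.inv_inv g).symm (heq_of_eq ?_)
    -- The inverse of the differential of the inversion at `g` is its differential at `g⁻¹`; hence
    -- `w` is the image of a smooth frame under a tangent map.
    obtain ⟨γ, hγ⟩ := exists_hasVelocity (EN := EG) g (w g c)
    have h1 : HasVelocity EG (fun τ => (γ τ).inv) g.inv (u' g.inv c) := by
      have := hγ.inv hG
      have h2 : (mfderiv 𝓘(ℝ, EG) 𝓘(ℝ, EG) Arrows.inv g (w g c) : EG) = u' g.inv c :=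
        (dinv EM EG g.hom).apply_symm_apply _
      rwa [h2] at this
    refine HasVelocity.unique (EN := EG) hγ (h1.inv hG) ?_
    filter_upwards with τ using Arrows.inv_inv _
  have hd : IsSmoothFrameOn (EM := EG) Arrows.tgt (fun _ => LinearMap.id) Q d := fun c =>
    (hf' c).comp hinv.contMDiffOn (fun g (hg : g ∈ Q) => hg)
  have hbs : IsSmoothFrameOn (EM := EG) (V := fun g : Arrows M => TangentSpace 𝓘(ℝ, EM) g.src)
      Arrows.src (fun _ => LinearMap.id)
      ⟨Arrows.src ⁻¹' V, V.isOpen.preimage hsrc.continuous⟩ (fun g => b g.src) := fun c =>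
    (hb c).comp hsrc.contMDiffOn (fun g hg => hg)
  have hbt : IsSmoothFrameOn (EM := EG) (V := fun g : Arrows M => TangentSpace 𝓘(ℝ, EM) g.tgt)
      Arrows.tgt (fun _ => LinearMap.id)
      ⟨Arrows.tgt ⁻¹' V', V'.isOpen.preimage htgt.continuous⟩ (fun g => b' g.tgt) := fun c =>
    (hb' c).comp htgt.contMDiffOn (fun g hg => hg)
  have k₁ := contMDiffOn_det (fun _ => Function.injective_id) hbt hd
  have k₂ := contMDiffOn_det (fun _ => Function.injective_id) hw hu
  have k₃ := contMDiffOn_det (fun _ => Function.injective_id) hf hbs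
  have n₁ := k₁.contMDiffAt (x := g₀) (IsOpen.mem_nhds
    ((V'.isOpen.preimage htgt.continuous).inter Q.isOpen) ⟨hV', hO'⟩)
  have n₂ := k₂.contMDiffAt (x := g₀) (IsOpen.mem_nhds (Q.isOpen.inter O.isOpen) ⟨hO', hO⟩)
  have n₃ := k₃.contMDiffAt (x := g₀) (IsOpen.mem_nhds
    (O.isOpen.inter (V.isOpen.preimage hsrc.continuous)) ⟨hO, hV⟩)
  -- In `arrowDet_change` the frames of the algebroid are kept, so three factors remain: `b'`
  -- against `d`, `w` against `u`, and `f` against `b`.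
  refine (((n₁.mul n₂).mul n₃).congr_of_eventuallyEq ?_).contMDiffWithinAt
  filter_upwards [(Q.isOpen.inter O.isOpen).mem_nhds ⟨hO', hO⟩] with g hg
  have hw' : IsAdapted (leftTranslation EM EG g.hom) (dtgt EM EG g.hom) (a g.src) (d g) (w g) :=
    ⟨fun c => congrArg (dinv EM EG g.hom).symm ((huf' g.inv hg.1).1 c), fun c e =>
      (congrArg (dsrc EM EG (Groupoid.inv g.hom)) ((dinv EM EG g.hom).apply_symm_apply _)).trans
        ((huf' g.inv hg.1).2 c e)⟩
  rw [arrowDet_change EM EG g.hom (a g.src) (a g.src) (b g.src) (f g) (a' g.tgt) (a' g.tgt)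
    (b' g.tgt) (d g), arrowDet_eq EM EG (huf g hg.2) hw']
  simp only [frameDet_self, one_mul, mul_one, Units.val_mul]
  rfl

end SmoothFrames

end TransverseBundles

namespace TransverseBundles

/-! ### Smooth maps into line bundles -/

section SmoothMaps

variable {EM M EN N : Type*} [NormedAddCommGroup EM] [NormedSpace ℝ EM] [TopologicalSpace M]
  [ChartedSpace EM M] [NormedAddCommGroup EN] [NormedSpace ℝ EN] [TopologicalSpace N]
  [ChartedSpace EN N]

theorem LineBundle.triv_apply_eq (L : LineBundle EM M) (φ ψ : Opens M × ∀ x, L.Fiber x ≃ₗ[ℝ] ℝ)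
    (x : M) (v : L.Fiber x) : ψ.2 x v = ψ.2 x ((φ.2 x).symm 1) * φ.2 x v := by
  have h : v = φ.2 x v • (φ.2 x).symm 1 := by
    apply (φ.2 x).injective
    simp
  conv_lhs => rw [h, map_smul]
  simp [mul_comm]

variable {EP HP P : Type*} [NormedAddCommGroup EP] [NormedSpace ℝ EP] [TopologicalSpace HP]
  {I : ModelWithCorners ℝ EP HP} [TopologicalSpace P] [ChartedSpace HP P]

/-- A map to the total space of a line bundle is smooth if and only if the map to the base and
the coordinate in a local trivialization are smooth. -/
theorem LineBundle.contMDiffAt_iff (L : LineBundle EM M) {f : P → TotalSpace ℝ L.Fiber} {p : P}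
    {φ : Opens M × ∀ x, L.Fiber x ≃ₗ[ℝ] ℝ} (hφ : φ ∈ L.triv) (hp : (f p).1 ∈ φ.1) :
    ContMDiffAt I (𝓘(ℝ, EM).prod 𝓘(ℝ, ℝ)) ∞ f p ↔
      ContMDiffAt I 𝓘(ℝ, EM) ∞ (fun q => (f q).1) p ∧
        ContMDiffAt I 𝓘(ℝ, ℝ) ∞ (fun q => φ.2 (f q).1 (f q).2) p := by
  -- The trivialization that the bundle structure itself selects at this point, for which the
  -- criterion holds by construction; `φ` is reached through the smooth transition function.
  let ψ := (L.exists_mem_triv (f p).1).choose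
  have hψ : ψ ∈ L.triv := (L.exists_mem_triv (f p).1).choose_spec.1
  have hp' : (f p).1 ∈ ψ.1 := (L.exists_mem_triv (f p).1).choose_spec.2
  have h0 : ContMDiffAt I (𝓘(ℝ, EM).prod 𝓘(ℝ, ℝ)) ∞ f p ↔
      ContMDiffAt I 𝓘(ℝ, EM) ∞ (fun q => (f q).1) p ∧
        ContMDiffAt I 𝓘(ℝ, ℝ) ∞ (fun q => ψ.2 (f q).1 (f q).2) p := contMDiffAt_totalSpace
  have change : ∀ {α β : Opens M × ∀ x, L.Fiber x ≃ₗ[ℝ] ℝ}, α ∈ L.triv → β ∈ L.triv →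
      (f p).1 ∈ α.1 → (f p).1 ∈ β.1 → ContMDiffAt I 𝓘(ℝ, EM) ∞ (fun q => (f q).1) p →
      ContMDiffAt I 𝓘(ℝ, ℝ) ∞ (fun q => α.2 (f q).1 (f q).2) p →
      ContMDiffAt I 𝓘(ℝ, ℝ) ∞ (fun q => β.2 (f q).1 (f q).2) p := by
    intro α β hα hβ ha hb h1 h2
    have h3 := ((L.contMDiffOn_transition α hα β hβ).contMDiffAt (x := (f p).1)
      ((α.1.isOpen.inter β.1.isOpen).mem_nhds ⟨ha, hb⟩)).comp p h1
    refine (h3.mul h2).congr_of_eventuallyEq (Filter.Eventually.of_forall fun q => ?_)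
    exact L.triv_apply_eq α β _ _
  rw [h0]
  exact ⟨fun h => ⟨h.1, change hψ hφ hp' hp h.1 h.2⟩, fun h => ⟨h.1, change hφ hψ hp hp' h.1 h.2⟩⟩

theorem LineBundle.contMDiffAt_coord (L : LineBundle EM M) {φ : Opens M × ∀ x, L.Fiber x ≃ₗ[ℝ] ℝ}
    (hφ : φ ∈ L.triv) {p : TotalSpace ℝ L.Fiber} (hp : p.1 ∈ φ.1) :
    ContMDiffAt (𝓘(ℝ, EM).prod 𝓘(ℝ, ℝ)) 𝓘(ℝ, ℝ) ∞
      (fun q : TotalSpace ℝ L.Fiber => φ.2 q.1 q.2) p :=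
  ((L.contMDiffAt_iff hφ hp).1 contMDiffAt_id).2

/-- Isomorphisms of the fibres that are the identity in suitable local trivializations form an
isomorphism of smooth line bundles. -/
theorem isBundleIso_of_triv {L L' : LineBundle EM M} {Φ : ∀ x, L.Fiber x ≃ₗ[ℝ] L'.Fiber x}
    (h : ∀ x₀, ∃ φ ∈ L.triv, ∃ ψ ∈ L'.triv, x₀ ∈ φ.1 ∧ x₀ ∈ ψ.1 ∧
      ∀ x v, ψ.2 x (Φ x v) = φ.2 x v) : IsBundleIso Φ := by
  constructor
  · intro p
    obtain ⟨φ, hφ, ψ, hψ, hx, hx', hΦ⟩ := h p.1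
    rw [L'.contMDiffAt_iff hψ hx']
    refine ⟨contMDiffAt_proj L.Fiber, ?_⟩
    simp only [hΦ]
    exact L.contMDiffAt_coord hφ hx
  · intro p
    obtain ⟨φ, hφ, ψ, hψ, hx, hx', hΦ⟩ := h p.1
    rw [L.contMDiffAt_iff hφ hx]
    refine ⟨contMDiffAt_proj L'.Fiber, ?_⟩
    simp only [← hΦ, LinearEquiv.apply_symm_apply]
    exact L'.contMDiffAt_coord hψ hx'

theorem IsBundleIso.symm {L L' : LineBundle EM M} {Φ : ∀ x, L.Fiber x ≃ₗ[ℝ] L'.Fiber x}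
    (h : IsBundleIso Φ) : IsBundleIso fun x => (Φ x).symm :=
  ⟨h.contMDiff_symm, h.contMDiff⟩

end SmoothMaps

/-! ### Representations from smooth coordinates -/

section SmoothActions

variable {EM EG M : Type*} [Groupoid M]
    [NormedAddCommGroup EM] [NormedSpace ℝ EM] [NormedAddCommGroup EG] [NormedSpace ℝ EG]
    [TopologicalSpace M] [ChartedSpace EM M]
    [TopologicalSpace (Arrows M)] [ChartedSpace EG (Arrows M)]

variable (EG) in
/-- The coordinates of the maps `ρ` in suitable local trivializations are smooth. -/
def HasSmoothCoordinates {L : LineBundle EM M} (ρ : ArrowMaps L) : Prop :=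
  ∀ g₀ : Arrows M, ∃ φ ∈ L.triv, ∃ ψ ∈ L.triv, g₀.src ∈ φ.1 ∧ g₀.tgt ∈ ψ.1 ∧
    ContMDiffAt 𝓘(ℝ, EG) 𝓘(ℝ, ℝ) ∞
      (fun g : Arrows M => ψ.2 g.tgt (ρ g.src g.tgt g.hom ((φ.2 g.src).symm 1))) g₀

variable {L L' : LineBundle EM M} {ρ : ArrowMaps L} {ρ' : ArrowMaps L'}

theorem coord_tensorMap {V V' W W' : Type*} [AddCommGroup V] [Module ℝ V] [AddCommGroup V']
    [Module ℝ V'] [AddCommGroup W] [Module ℝ W] [AddCommGroup W'] [Module ℝ W'] (φ : V ≃ₗ[ℝ] ℝ)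
    (φ' : V' ≃ₗ[ℝ] ℝ) (ψ : W ≃ₗ[ℝ] ℝ) (ψ' : W' ≃ₗ[ℝ] ℝ) (A : V →ₗ[ℝ] W) (A' : V' →ₗ[ℝ] W') :
    (TensorProduct.congr ψ ψ' ≪≫ₗ TensorProduct.lid ℝ ℝ) (TensorProduct.map A A'
      ((TensorProduct.congr φ φ' ≪≫ₗ TensorProduct.lid ℝ ℝ).symm 1)) =
    ψ (A (φ.symm 1)) * ψ' (A' (φ'.symm 1)) := by
  simp

theorem coord_dualMap {V W : Type*} [AddCommGroup V] [Module ℝ V] [AddCommGroup W] [Module ℝ W]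
    (φ : V ≃ₗ[ℝ] ℝ) (ψ : W ≃ₗ[ℝ] ℝ) (A : V →ₗ[ℝ] W) :
    (φ.symm.dualMap ≪≫ₗ LinearMap.ringLmapEquivSelf ℝ ℝ ℝ) (A.dualMap
      ((ψ.symm.dualMap ≪≫ₗ LinearMap.ringLmapEquivSelf ℝ ℝ ℝ).symm 1)) = ψ (A (φ.symm 1)) := by
  simp

theorem HasSmoothCoordinates.tensor (h : HasSmoothCoordinates EG ρ)
    (h' : HasSmoothCoordinates EG ρ') : HasSmoothCoordinates EG (ArrowMaps.tensor ρ ρ') := by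
  intro g₀
  obtain ⟨φ, hφ, ψ, hψ, hs, ht, hρ⟩ := h g₀
  obtain ⟨φ', hφ', ψ', hψ', hs', ht', hρ'⟩ := h' g₀
  refine ⟨_, ⟨φ, hφ, φ', hφ', rfl⟩, _, ⟨ψ, hψ, ψ', hψ', rfl⟩, ⟨hs, hs'⟩, ⟨ht, ht'⟩, ?_⟩
  refine (hρ.mul hρ').congr_of_eventuallyEq (Filter.Eventually.of_forall fun g => ?_)
  exact coord_tensorMap _ _ _ _ _ _

variable (EG M) in
theorem hasSmoothCoordinates_trivial : HasSmoothCoordinates EG (ArrowMaps.trivial EM M) := by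
  intro g₀
  exact ⟨_, rfl, _, rfl, trivial, trivial, contMDiffAt_const (c := (1 : ℝ))⟩

variable [IsManifold 𝓘(ℝ, EM) ∞ M] [IsManifold 𝓘(ℝ, EG) ∞ (Arrows M)]

theorem HasSmoothCoordinates.dual (hG : LieGroupoid EM EG M) (h : HasSmoothCoordinates EG ρ) :
    HasSmoothCoordinates EG (ArrowMaps.dual ρ) := by
  intro g₀
  -- The dual action of `g` is the transpose of the action of `g⁻¹`, so the coordinates are those at
  -- `g⁻¹`, with source and target trivializations exchanged.
  obtain ⟨φ, hφ, ψ, hψ, hs, ht, hρ⟩ := h g₀.inv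
  refine ⟨_, ⟨ψ, hψ, rfl⟩, _, ⟨φ, hφ, rfl⟩, ht, hs, ?_⟩
  refine (hρ.comp g₀ hG.contMDiff_inv.contMDiffAt).congr_of_eventuallyEq
    (Filter.Eventually.of_forall fun g => ?_)
  exact coord_dualMap _ _ _

/-- Maps that respect units and products form a representation if their coordinates are smooth. -/
theorem HasSmoothCoordinates.isRepresentation (hG : LieGroupoid EM EG M)
    (h : HasSmoothCoordinates EG ρ) (h₁ : ∀ x, ρ x x (𝟙 x) = LinearMap.id)
    (h₂ : ∀ (x y z : M) (g : x ⟶ y) (h : y ⟶ z), ρ x z (g ≫ h) = ρ y z h ∘ₗ ρ x y g) :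
    IsRepresentation hG ρ := by
  refine ⟨h₁, h₂, fun p => ?_⟩
  obtain ⟨φ, hφ, ψ, hψ, hs, ht, hρ⟩ := h p.1
  have hproj : ContMDiffAt (𝓘(ℝ, EG).prod 𝓘(ℝ, ℝ)) 𝓘(ℝ, EG) ∞
      (fun q : TotalSpace ℝ ((srcMap hG : Arrows M → M) *ᵖ L.Fiber) => q.1) p :=
    contMDiffAt_proj _
  -- The canonical map from the pull-back along the source to `L` is smooth: its fibre coordinate is
  -- that of the identity of the pull-back.
  have hlift : ContMDiffAt (𝓘(ℝ, EG).prod 𝓘(ℝ, ℝ)) (𝓘(ℝ, EM).prod 𝓘(ℝ, ℝ)) ∞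
      (fun q : TotalSpace ℝ ((srcMap hG : Arrows M → M) *ᵖ L.Fiber) =>
        (⟨q.1.src, q.2⟩ : TotalSpace ℝ L.Fiber)) p := by
    have hid : ContMDiffAt (𝓘(ℝ, EG).prod 𝓘(ℝ, ℝ)) (𝓘(ℝ, EG).prod 𝓘(ℝ, ℝ)) ∞
      (fun q : TotalSpace ℝ ((srcMap hG : Arrows M → M) *ᵖ L.Fiber) => q) p := contMDiffAt_id
    rw [contMDiffAt_totalSpace]
    exact ⟨hG.isSubmersion_src.contMDiff.contMDiffAt.comp p hproj,
      (contMDiffAt_totalSpace.1 hid).2⟩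
  have hcoord := ((L.contMDiffAt_iff hφ hs).1 hlift).2
  rw [L.contMDiffAt_iff hψ ht]
  refine ⟨hG.contMDiff_tgt.contMDiffAt.comp p hproj, ?_⟩
  refine ((hρ.comp p hproj).mul hcoord).congr_of_eventuallyEq
    (Filter.Eventually.of_forall fun q => ?_)
  have h3 : (q.2 : L.Fiber q.1.src) = φ.2 q.1.src q.2 • (φ.2 q.1.src).symm 1 := by
    apply (φ.2 q.1.src).injective
    simp
  show ψ.2 q.1.tgt (ρ q.1.src q.1.tgt q.1.hom q.2) = _
  conv_lhs => rw [h3, map_smul, map_smul]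
  exact mul_comm _ _

theorem isRepresentation_tensor {hG : LieGroupoid EM EG M} (h : IsRepresentation hG ρ)
    (h' : IsRepresentation hG ρ') (hs : HasSmoothCoordinates EG ρ)
    (hs' : HasSmoothCoordinates EG ρ') : IsRepresentation hG (ArrowMaps.tensor ρ ρ') := by
  refine (hs.tensor hs').isRepresentation hG (fun x => ?_) (fun x y z g k => ?_)
  · simp only [ArrowMaps.tensor, h.map_id, h'.map_id]
    exact TensorProduct.map_id
  · simp only [ArrowMaps.tensor, h.map_comp, h'.map_comp]
    exact TensorProduct.map_comp _ _ _ _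

theorem isRepresentation_dual {hG : LieGroupoid EM EG M} (h : IsRepresentation hG ρ)
    (hs : HasSmoothCoordinates EG ρ) : IsRepresentation hG (ArrowMaps.dual ρ) := by
  refine (hs.dual hG).isRepresentation hG (fun x => ?_) (fun x y z g k => ?_)
  · have h1 : Groupoid.inv (𝟙 x) = 𝟙 x := by simp [Groupoid.inv_eq_inv]
    simp only [ArrowMaps.dual, h1, h.map_id]
    rfl
  · have h1 : Groupoid.inv (g ≫ k) = Groupoid.inv k ≫ Groupoid.inv g := by
      simp [Groupoid.inv_eq_inv]
    simp only [ArrowMaps.dual, h1, h.map_comp]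
    rfl

variable (EM M) in
theorem isRepresentation_trivial (hG : LieGroupoid EM EG M) :
    IsRepresentation hG (ArrowMaps.trivial EM M) :=
  (hasSmoothCoordinates_trivial EG M).isRepresentation hG (fun _ => rfl) (fun _ _ _ _ _ => rfl)

end SmoothActions

/-! ### Pointwise multiplication in coordinates -/

section Products

variable {m n : ℕ} {V W : Type*} [AddCommGroup V] [Module ℝ V] [AddCommGroup W] [Module ℝ W]

/-- Pointwise multiplication commutes with evaluation on a frame, and rearranging the tensor factors
only reorders a product of real numbers. -/
theorem Line.eval₂_mulIso {δ δ' δ'' : GLr m →* ℝˣ} (h : δ * δ' = δ'') {ε ε' ε'' : GLr n →* ℝˣ}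
    (h' : ε * ε' = ε'') (hV : Nonempty (Frame m V)) (hW : Nonempty (Frame n W))
    (e : Frame m V) (f : Frame n W) (v : Line δ V ⊗[ℝ] Line ε W) (w : Line δ' V ⊗[ℝ] Line ε' W) :
    Line.eval₂ δ'' ε'' e f (TensorProduct.congr (Line.mulIso h hV) (Line.mulIso h' hW)
      (TensorProduct.tensorTensorTensorComm ℝ (Line δ V) (Line ε W) (Line δ' V) (Line ε' W)
        (v ⊗ₜ w))) = Line.eval₂ δ ε e f v * Line.eval₂ δ' ε' e f w := by
  induction v using TensorProduct.induction_on with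
  | zero => simp only [TensorProduct.zero_tmul, LinearEquiv.map_zero, zero_mul]
  | add v v' hv hv' => simp only [TensorProduct.add_tmul, LinearEquiv.map_add, hv, hv', add_mul]
  | tmul α β =>
    induction w using TensorProduct.induction_on with
    | zero => simp only [TensorProduct.tmul_zero, LinearEquiv.map_zero, mul_zero]
    | add w w' hw hw' => simp only [TensorProduct.tmul_add, LinearEquiv.map_add, hw, hw', mul_add]
    | tmul α' β' =>
      rw [TensorProduct.tensorTensorTensorComm_tmul, TensorProduct.congr_tmul, Line.eval₂_tmul,
        Line.eval₂_tmul, Line.eval₂_tmul]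
      show (α.1 e * α'.1 e) * (β.1 f * β'.1 f) = _
      ring

/-- A function in `L_1` is constant, so the frame chosen inside `Line.constIso` can be replaced by
the given one. -/
theorem Line.constIso_mulIso {δ δ' : GLr m →* ℝˣ} (h : δ * δ' = 1) {ε ε' : GLr n →* ℝˣ}
    (h' : ε * ε' = 1) (hV : Nonempty (Frame m V)) (hW : Nonempty (Frame n W))
    (e : Frame m V) (f : Frame n W) (v : Line δ V ⊗[ℝ] Line ε W) (w : Line δ' V ⊗[ℝ] Line ε' W) :
    TensorProduct.lid ℝ ℝ (TensorProduct.congr (Line.mulIso h hV ≪≫ₗ Line.constIso hV)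
      (Line.mulIso h' hW ≪≫ₗ Line.constIso hW)
      (TensorProduct.tensorTensorTensorComm ℝ (Line δ V) (Line ε W) (Line δ' V) (Line ε' W)
        (v ⊗ₜ w))) = Line.eval₂ δ ε e f v * Line.eval₂ δ' ε' e f w := by
  rw [← Line.eval₂_mulIso h h' hV hW e f v w]
  have hc : ∀ (hV : Nonempty (Frame m V)), Line.constIso hV = Line.eval 1 e := fun hV =>
    LinearEquiv.ext fun ξ => Line.constIso_apply hV ξ e
  have hc' : ∀ (hW : Nonempty (Frame n W)), Line.constIso hW = Line.eval 1 f := fun hW =>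
    LinearEquiv.ext fun ξ => Line.constIso_apply hW ξ f
  rw [hc, hc', TensorProduct.congr_trans]
  rfl

end Products

/-! ### The canonical isomorphisms and the actions -/

section Main

variable (EM EG : Type*) {M : Type*} [Groupoid M]
    [NormedAddCommGroup EM] [NormedSpace ℝ EM] [NormedAddCommGroup EG] [NormedSpace ℝ EG]
    [TopologicalSpace M] [ChartedSpace EM M]
    [TopologicalSpace (Arrows M)] [ChartedSpace EG (Arrows M)]
    [IsManifold 𝓘(ℝ, EM) ∞ M] [IsManifold 𝓘(ℝ, EG) ∞ (Arrows M)] [hG : LieGroupoid EM EG M]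
    [FiniteDimensional ℝ EG] [FiniteDimensional ℝ EM]

theorem trEval_trMulIso {χ ψ κ : ℝ →*₀ ℝ} [SmoothChar χ] [SmoothChar ψ] [SmoothChar κ]
    (h : χ * ψ = κ) {x : M} (a : Frame (algRank EM EG) (algFiber EM EG x))
    (b : Frame (Module.finrank ℝ EM) (TangentSpace 𝓘(ℝ, EM) x))
    (v : (trLine EM EG χ : LineBundle EM M).Fiber x)
    (w : (trLine EM EG ψ : LineBundle EM M).Fiber x) :
    trEval EM EG κ a b (trMulIso EM EG h x (v ⊗ₜ[ℝ] w)) =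
      trEval EM EG χ a b v * trEval EM EG ψ a b w :=
  Line.eval₂_mulIso (detChar_mul h _) (detChar_mul h _) (nonempty_dualAlgFrame EM EG x)
    (nonempty_tangentFrame x) (dualFrame a) b v w

theorem orientationSquareIso_tmul {x : M} (a : Frame (algRank EM EG) (algFiber EM EG x))
    (b : Frame (Module.finrank ℝ EM) (TangentSpace 𝓘(ℝ, EM) x))
    (v w : (trLine EM EG signChar : LineBundle EM M).Fiber x) :
    (orientationSquareIso EM EG M x (v ⊗ₜ[ℝ] w) : ℝ) =
      trEval EM EG signChar a b v * trEval EM EG signChar a b w :=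
  Line.constIso_mulIso ((detChar_mul signChar_mul_signChar _).trans (detChar_one _))
    ((detChar_mul signChar_mul_signChar _).trans (detChar_one _)) (nonempty_dualAlgFrame EM EG x)
    (nonempty_tangentFrame x) (dualFrame a) b v w

/-- The character is quantified after the frames: one pair of local frames trivializes all the
bundles at once, and in these matching trivializations the canonical isomorphisms become the
identity. -/
theorem exists_trEval_mem_triv (x₀ : M) :
    ∃ (U V : Opens M) (a : ∀ x : M, Frame (algRank EM EG) (algFiber EM EG x))
      (b : ∀ x : M, Frame (Module.finrank ℝ EM) (TangentSpace 𝓘(ℝ, EM) x)),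
      x₀ ∈ U ⊓ V ∧ IsSmoothFrameOn (EM := EM) Arrows.unit (fun x => (algFiber EM EG x).subtype) U a ∧
      IsSmoothFrameOn (EM := EM) id (fun _ => LinearMap.id) V b ∧
      ∀ (χ : ℝ →*₀ ℝ) [SmoothChar χ], ((U ⊓ V, fun x => trEval EM EG χ (a x) (b x)) :
        Opens M × ∀ x, (trLine EM EG χ : LineBundle EM M).Fiber x ≃ₗ[ℝ] ℝ) ∈
          (trLine EM EG χ : LineBundle EM M).triv := by
  obtain ⟨U, a, hU, ha⟩ := exists_smoothFrame_alg EM EG x₀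
  obtain ⟨V, b, hV, hb⟩ := exists_smoothFrame_tangent (EM := EM) x₀
  refine ⟨U, V, a, b, ⟨hU, hV⟩, ha, hb, fun χ _ => ?_⟩
  exact ⟨(U, fun x => Line.eval _ (dualFrame (a x))), ⟨a, ha, rfl⟩,
    (V, fun x => Line.eval _ (b x)), ⟨b, hb, rfl⟩, rfl⟩

theorem hasSmoothCoordinates_trAction (χ : ℝ →*₀ ℝ) [hχ : SmoothChar χ] :
    HasSmoothCoordinates EG (trAction EM EG χ : ArrowMaps (trLine EM EG χ : LineBundle EM M)) := by
  intro g₀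
  obtain ⟨U, V, a, b, hUV, ha, hb, hab⟩ := exists_trEval_mem_triv EM EG g₀.src
  obtain ⟨U', V', a', b', hUV', ha', hb', hab'⟩ := exists_trEval_mem_triv EM EG g₀.tgt
  refine ⟨_, hab χ, _, hab' χ, hUV, hUV', ?_⟩
  have h1 := contMDiffOn_arrowDet ha hb ha' hb'
  have h2 : ContMDiffAt 𝓘(ℝ, EG) 𝓘(ℝ, ℝ) ∞ (fun g : Arrows M => (-1 : ℝ) ^ algRank EM EG *
      (arrowDet EM EG g.hom (a g.src) (b g.src) (a' g.tgt) (b' g.tgt) : ℝ)) g₀ :=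
    contMDiffAt_const.mul (h1.contMDiffAt ((IsOpen.inter
      ((U ⊓ V).isOpen.preimage hG.isSubmersion_src.contMDiff.continuous)
      ((U' ⊓ V').isOpen.preimage hG.contMDiff_tgt.continuous)).mem_nhds ⟨hUV, hUV'⟩))
  -- The character is smooth only away from zero.
  have hne : (-1 : ℝ) ^ algRank EM EG * (arrowDet EM EG g₀.hom (a g₀.src) (b g₀.src)
      (a' g₀.tgt) (b' g₀.tgt) : ℝ) ≠ 0 :=
    mul_ne_zero (pow_ne_zero _ (by norm_num)) (Units.ne_zero _)
  have h3 : ContMDiffAt 𝓘(ℝ, ℝ) 𝓘(ℝ, ℝ) ∞ χ ((-1 : ℝ) ^ algRank EM EG *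
      (arrowDet EM EG g₀.hom (a g₀.src) (b g₀.src) (a' g₀.tgt) (b' g₀.tgt) : ℝ)) :=
    (hχ.contDiffOn.contDiffAt (isOpen_compl_singleton.mem_nhds hne)).contMDiffAt
  refine (ContMDiffAt.comp g₀ h3 h2).congr_of_eventuallyEq
    (Filter.Eventually.of_forall fun g => ?_)
  refine (trEval_trAction EM EG χ g.hom (a g.src) (b g.src) (a' g.tgt) (b' g.tgt) _).trans ?_
  exact (congrArg _ ((trEval EM EG χ (a g.src) (b g.src)).apply_symm_apply 1)).trans (mul_one _)

variable (M) in
theorem isRepresentation_trAction (χ : ℝ →*₀ ℝ) [SmoothChar χ] :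
    IsRepresentation hG (trAction EM EG χ : ArrowMaps (trLine EM EG χ : LineBundle EM M)) :=
  (hasSmoothCoordinates_trAction EM EG χ).isRepresentation hG (trAction_id EM EG χ)
    (trAction_comp EM EG χ)

variable (M) in
theorem isBundleIso_trMulIso {χ ψ κ : ℝ →*₀ ℝ} [SmoothChar χ] [SmoothChar ψ] [SmoothChar κ]
    (h : χ * ψ = κ) : IsBundleIso (EM := EM) (M := M) (fun x => trMulIso EM EG h x) := by
  refine isBundleIso_of_triv fun x₀ => ?_
  obtain ⟨U, V, a, b, hUV, -, -, hab⟩ := exists_trEval_mem_triv EM EG x₀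
  refine ⟨_, ⟨_, hab χ, _, hab ψ, rfl⟩, _, hab κ, ⟨hUV, hUV⟩, hUV, fun x t => ?_⟩
  refine TensorProduct.induction_on t ?_ ?_ ?_
  · exact (map_zero (trMulIso EM EG h x ≪≫ₗ trEval EM EG κ (a x) (b x))).trans (map_zero _).symm
  · intro v w
    exact trEval_trMulIso EM EG h (a x) (b x) v w
  · intro s t hs ht
    refine (map_add (trMulIso EM EG h x ≪≫ₗ trEval EM EG κ (a x) (b x)) s t).trans ?_
    exact (congrArg₂ (· + ·) hs ht).trans (map_add _ s t).symm

variable (M) in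
theorem isBundleIso_orientationSquareIso :
    IsBundleIso (EM := EM) (M := M) (orientationSquareIso EM EG M) := by
  refine isBundleIso_of_triv fun x₀ => ?_
  obtain ⟨U, V, a, b, hUV, -, -, hab⟩ := exists_trEval_mem_triv EM EG x₀
  refine ⟨_, ⟨_, hab signChar, _, hab signChar, rfl⟩, _, rfl, ⟨hUV, hUV⟩, trivial, fun x t => ?_⟩
  refine TensorProduct.induction_on t ?_ ?_ ?_
  · exact (map_zero (orientationSquareIso EM EG M x)).trans (map_zero _).symm
  · intro v w
    exact orientationSquareIso_tmul EM EG (a x) (b x) v w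
  · intro s t hs ht
    refine (map_add (orientationSquareIso EM EG M x) s t).trans ?_
    exact (congrArg₂ (· + ·) hs ht).trans (map_add _ s t).symm

variable (M) in
theorem isBundleIso_orientationDualIso :
    IsBundleIso (EM := EM) (M := M) (orientationDualIso EM EG M) := by
  refine isBundleIso_of_triv fun x₀ => ?_
  obtain ⟨U, V, a, b, hUV, -, -, hab⟩ := exists_trEval_mem_triv EM EG x₀
  refine ⟨_, hab signChar, _, ⟨_, hab signChar, rfl⟩, hUV, hUV, fun x v => ?_⟩
  refine (orientationSquareIso_tmul EM EG (a x) (b x) v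
    ((trEval EM EG signChar (a x) (b x)).symm 1)).trans ?_
  rw [LinearEquiv.apply_symm_apply, mul_one]

/-- `trMulIso` commutes with maps that are given in coordinates by the values of the characters on
the same number. -/
theorem trMulIso_map {χ ψ κ : ℝ →*₀ ℝ} [SmoothChar χ] [SmoothChar ψ] [SmoothChar κ]
    (h : χ * ψ = κ) {x y : M} (a : Frame (algRank EM EG) (algFiber EM EG x))
    (b : Frame (Module.finrank ℝ EM) (TangentSpace 𝓘(ℝ, EM) x))
    (a' : Frame (algRank EM EG) (algFiber EM EG y))
    (b' : Frame (Module.finrank ℝ EM) (TangentSpace 𝓘(ℝ, EM) y)) (c : ℝ)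
    {A : (trLine EM EG χ : LineBundle EM M).Fiber x →ₗ[ℝ]
      (trLine EM EG χ : LineBundle EM M).Fiber y}
    {B : (trLine EM EG ψ : LineBundle EM M).Fiber x →ₗ[ℝ]
      (trLine EM EG ψ : LineBundle EM M).Fiber y}
    {C : (trLine EM EG κ : LineBundle EM M).Fiber x →ₗ[ℝ]
      (trLine EM EG κ : LineBundle EM M).Fiber y}
    (hA : ∀ v, trEval EM EG χ a' b' (A v) = χ c * trEval EM EG χ a b v)
    (hB : ∀ v, trEval EM EG ψ a' b' (B v) = ψ c * trEval EM EG ψ a b v)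
    (hC : ∀ v, trEval EM EG κ a' b' (C v) = κ c * trEval EM EG κ a b v)
    (t : (trLine EM EG χ : LineBundle EM M).Fiber x ⊗[ℝ]
      (trLine EM EG ψ : LineBundle EM M).Fiber x) :
    trMulIso EM EG h y (TensorProduct.map A B t) = C (trMulIso EM EG h x t) := by
  have key : (trMulIso EM EG h y).toLinearMap ∘ₗ TensorProduct.map A B =
      C ∘ₗ (trMulIso EM EG h x).toLinearMap := by
    refine TensorProduct.ext' fun v w => (trEval EM EG κ a' b').injective ?_
    have h1 := trEval_trMulIso EM EG h a' b' (A v) (B w)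
    have h2 := hC (trMulIso EM EG h x (v ⊗ₜ[ℝ] w))
    rw [trEval_trMulIso EM EG h a b v w] at h2
    refine h1.trans (Eq.trans ?_ h2.symm)
    have hc : κ c = χ c * ψ c := by rw [← h]; rfl
    rw [hA, hB, hc]
    exact mul_mul_mul_comm _ _ _ _
  exact LinearMap.congr_fun key t

theorem signChar_mul_self {c : ℝ} (hc : c ≠ 0) : signChar c * signChar c = 1 :=
  (congrArg (fun χ : ℝ →*₀ ℝ => χ c) signChar_mul_signChar).trans
    (MonoidWithZeroHom.one_apply_of_ne_zero hc)

theorem orientationSquareIso_map {x y : M} (a : Frame (algRank EM EG) (algFiber EM EG x))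
    (b : Frame (Module.finrank ℝ EM) (TangentSpace 𝓘(ℝ, EM) x))
    (a' : Frame (algRank EM EG) (algFiber EM EG y))
    (b' : Frame (Module.finrank ℝ EM) (TangentSpace 𝓘(ℝ, EM) y)) {c : ℝ} (hc : c ≠ 0)
    {A : (trLine EM EG signChar : LineBundle EM M).Fiber x →ₗ[ℝ]
      (trLine EM EG signChar : LineBundle EM M).Fiber y}
    (hA : ∀ v, trEval EM EG signChar a' b' (A v) = signChar c * trEval EM EG signChar a b v)
    (t : (trLine EM EG signChar : LineBundle EM M).Fiber x ⊗[ℝ]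
      (trLine EM EG signChar : LineBundle EM M).Fiber x) :
    (orientationSquareIso EM EG M y (TensorProduct.map A A t) : ℝ) =
      orientationSquareIso EM EG M x t := by
  have key : (orientationSquareIso EM EG M y).toLinearMap ∘ₗ TensorProduct.map A A =
      (orientationSquareIso EM EG M x).toLinearMap := by
    refine TensorProduct.ext' fun v w => ?_
    refine (orientationSquareIso_tmul EM EG a' b' (A v) (A w)).trans
      (Eq.trans ?_ (orientationSquareIso_tmul EM EG a b v w).symm)
    rw [hA, hA, mul_mul_mul_comm, signChar_mul_self hc, one_mul]
  exact LinearMap.congr_fun key t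

/-- Inverse numbers have equal signs, because a sign is its own inverse. So the transpose of the
inverse map acts by the same sign as the map itself. -/
theorem orientationDualIso_map {x y : M} (a : Frame (algRank EM EG) (algFiber EM EG x))
    (b : Frame (Module.finrank ℝ EM) (TangentSpace 𝓘(ℝ, EM) x))
    (a' : Frame (algRank EM EG) (algFiber EM EG y))
    (b' : Frame (Module.finrank ℝ EM) (TangentSpace 𝓘(ℝ, EM) y)) {c c' : ℝ} (hc : c' * c = 1)
    {A : (trLine EM EG signChar : LineBundle EM M).Fiber x →ₗ[ℝ]
      (trLine EM EG signChar : LineBundle EM M).Fiber y}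
    {A' : (trLine EM EG signChar : LineBundle EM M).Fiber y →ₗ[ℝ]
      (trLine EM EG signChar : LineBundle EM M).Fiber x}
    (hA : ∀ v, trEval EM EG signChar a' b' (A v) = signChar c * trEval EM EG signChar a b v)
    (hA' : ∀ v, trEval EM EG signChar a b (A' v) = signChar c' * trEval EM EG signChar a' b' v)
    (v : (trLine EM EG signChar : LineBundle EM M).Fiber x) :
    orientationDualIso EM EG M y (A v) = A'.dualMap (orientationDualIso EM EG M x v) := by
  have hcc : signChar c = signChar c' := by
    have h2 := signChar_mul_self (right_ne_zero_of_mul_eq_one hc)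
    have h3 : signChar c' * signChar c = 1 := by rw [← map_mul, hc, map_one]
    exact mul_right_cancel₀ (left_ne_zero_of_mul_eq_one h2) (h2.trans h3.symm)
  refine LinearMap.ext fun w => ?_
  refine (orientationSquareIso_tmul EM EG a' b' (A v) w).trans
    (Eq.trans ?_ (orientationSquareIso_tmul EM EG a b v (A' w)).symm)
  rw [hA, hA', hcc]
  exact (mul_assoc (_ : ℝ) _ _).trans (mul_left_comm _ _ _)

variable (M) in
/-- The canonical isomorphisms commute with any maps of the bundles `L_χ^tr` which are given in
coordinates by the values of `χ` on invertible numbers that do not depend on `χ`. -/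
theorem intertwines_of_trEval
    (R : ∀ (χ : ℝ →*₀ ℝ) [SmoothChar χ], ArrowMaps (trLine EM EG χ : LineBundle EM M))
    (D : ∀ (x y : M) (_ : x ⟶ y), Frame (algRank EM EG) (algFiber EM EG x) →
      Frame (Module.finrank ℝ EM) (TangentSpace 𝓘(ℝ, EM) x) →
      Frame (algRank EM EG) (algFiber EM EG y) →
      Frame (Module.finrank ℝ EM) (TangentSpace 𝓘(ℝ, EM) y) → ℝ)
    (hR : ∀ (χ : ℝ →*₀ ℝ) [SmoothChar χ] (x y : M) (g : x ⟶ y) a b a' b'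
      (v : (trLine EM EG χ : LineBundle EM M).Fiber x),
      trEval EM EG χ a' b' (R χ x y g v) = χ (D x y g a b a' b') * trEval EM EG χ a b v)
    (hD : ∀ (x y : M) (g : x ⟶ y) a b a' b',
      D y x (Groupoid.inv g) a' b' a b * D x y g a b a' b' = 1) :
    Intertwines (R absChar) (ArrowMaps.tensor (R idChar) (R signChar)) (densityIso EM EG M) ∧
    Intertwines (R idChar) (ArrowMaps.tensor (R absChar) (R signChar)) (volumeIso EM EG M) ∧
    Intertwines (ArrowMaps.tensor (R signChar) (R signChar)) (ArrowMaps.trivial EM M)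
      (orientationSquareIso EM EG M) ∧
    Intertwines (R signChar) (ArrowMaps.dual (R signChar)) (orientationDualIso EM EG M) := by
  have frames : ∀ x : M, Nonempty (Frame (algRank EM EG) (algFiber EM EG x)) ∧
      Nonempty (Frame (Module.finrank ℝ EM) (TangentSpace 𝓘(ℝ, EM) x)) := fun x =>
    ⟨nonempty_algFrame EM EG x, nonempty_tangentFrame x⟩
  refine ⟨fun x y g v => ?_, fun x y g v => ?_, fun x y g v => ?_, fun x y g v => ?_⟩ <;>
    obtain ⟨⟨a⟩, ⟨b⟩⟩ := frames x <;> obtain ⟨⟨a'⟩, ⟨b'⟩⟩ := frames y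
  · refine (LinearEquiv.symm_apply_eq (trMulIso EM EG idChar_mul_signChar y)).2 ?_
    refine Eq.trans ?_ (trMulIso_map EM EG idChar_mul_signChar a b a' b' (D x y g a b a' b')
      (hR idChar x y g a b a' b') (hR signChar x y g a b a' b') (hR absChar x y g a b a' b')
      ((trMulIso EM EG idChar_mul_signChar x).symm v)).symm
    rw [LinearEquiv.apply_symm_apply]
  · refine (LinearEquiv.symm_apply_eq (trMulIso EM EG absChar_mul_signChar y)).2 ?_
    refine Eq.trans ?_ (trMulIso_map EM EG absChar_mul_signChar a b a' b' (D x y g a b a' b')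
      (hR absChar x y g a b a' b') (hR signChar x y g a b a' b') (hR idChar x y g a b a' b')
      ((trMulIso EM EG absChar_mul_signChar x).symm v)).symm
    rw [LinearEquiv.apply_symm_apply]
  · exact orientationSquareIso_map EM EG a b a' b'
      (right_ne_zero_of_mul_eq_one (hD x y g a b a' b')) (hR signChar x y g a b a' b') v
  · exact orientationDualIso_map EM EG a b a' b' (hD x y g a b a' b')
      (hR signChar x y g a b a' b') (hR signChar y x (Groupoid.inv g) a' b' a b) v

end Main

end TransverseBundles

open TransverseBundles in
theorem mainTheorem7 {EM EG M : Type*} [Groupoid M]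
    [NormedAddCommGroup EM] [NormedSpace ℝ EM] [FiniteDimensional ℝ EM]
    [NormedAddCommGroup EG] [NormedSpace ℝ EG] [FiniteDimensional ℝ EG]
    [TopologicalSpace M] [ChartedSpace EM M] [IsManifold 𝓘(ℝ, EM) ∞ M]
    [TopologicalSpace (Arrows M)] [ChartedSpace EG (Arrows M)] [IsManifold 𝓘(ℝ, EG) ∞ (Arrows M)]
    [hG : LieGroupoid EM EG M] :
    -- the canonical isomorphisms are isomorphisms of representations
    (IsRepresentationIso hG (trAction EM EG absChar)
        (ArrowMaps.tensor (trAction EM EG idChar) (trAction EM EG signChar)) (densityIso EM EG M) ∧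
      IsRepresentationIso hG (trAction EM EG idChar)
        (ArrowMaps.tensor (trAction EM EG absChar) (trAction EM EG signChar)) (volumeIso EM EG M) ∧
      IsRepresentationIso hG (ArrowMaps.tensor (trAction EM EG signChar) (trAction EM EG signChar))
        (ArrowMaps.trivial EM M) (orientationSquareIso EM EG M) ∧
      IsRepresentationIso hG (trAction EM EG signChar)
        (ArrowMaps.dual (trAction EM EG signChar)) (orientationDualIso EM EG M)) ∧
    -- they also commute with the transformations without the sign `χ((-1)^r)`
    (Intertwines (rawAction EM EG absChar)
        (ArrowMaps.tensor (rawAction EM EG idChar) (rawAction EM EG signChar)) (densityIso EM EG M) ∧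
      Intertwines (rawAction EM EG idChar)
        (ArrowMaps.tensor (rawAction EM EG absChar) (rawAction EM EG signChar)) (volumeIso EM EG M) ∧
      Intertwines (ArrowMaps.tensor (rawAction EM EG signChar) (rawAction EM EG signChar))
        (ArrowMaps.trivial EM M) (orientationSquareIso EM EG M) ∧
      Intertwines (rawAction EM EG signChar)
        (ArrowMaps.dual (rawAction EM EG signChar)) (orientationDualIso EM EG M)) := by
  -- The factor `χ((-1)^r)` is absorbed into the argument of `χ`. In the product for inverse arrows
  -- the two signs cancel, so `arrowDet_inv` still applies.
  obtain ⟨h₁, h₂, h₃, h₄⟩ := intertwines_of_trEval EM EG M (fun χ _ => trAction EM EG χ)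
    (fun x y g a b a' b' => (-1) ^ algRank EM EG * (arrowDet EM EG g a b a' b' : ℝˣ))
    (fun χ _ x y g a b a' b' v => trEval_trAction EM EG χ g a b a' b' v)
    (fun x y g a b a' b' => by
      rw [mul_mul_mul_comm, ← mul_pow, ← Units.val_mul, arrowDet_inv EM EG g a b a' b']
      simp)
  have hrep := fun (χ : ℝ →*₀ ℝ) [SmoothChar χ] => isRepresentation_trAction (hG := hG) EM EG M χ
  have hco := fun (χ : ℝ →*₀ ℝ) [SmoothChar χ] => hasSmoothCoordinates_trAction (M := M) EM EG χ
  refine ⟨⟨⟨hrep absChar, ?_, ?_, h₁⟩, ⟨hrep idChar, ?_, ?_, h₂⟩, ⟨?_, ?_, ?_, h₃⟩,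
    ⟨hrep signChar, ?_, ?_, h₄⟩⟩, ?_⟩
  · exact isRepresentation_tensor (hrep idChar) (hrep signChar) (hco idChar) (hco signChar)
  · exact (isBundleIso_trMulIso EM EG M idChar_mul_signChar).symm
  · exact isRepresentation_tensor (hrep absChar) (hrep signChar) (hco absChar) (hco signChar)
  · exact (isBundleIso_trMulIso EM EG M absChar_mul_signChar).symm
  · exact isRepresentation_tensor (hrep signChar) (hrep signChar) (hco signChar) (hco signChar)
  · exact isRepresentation_trivial EM M hG
  · exact isBundleIso_orientationSquareIso EM EG M
  · exact isRepresentation_dual (hrep signChar) (hco signChar)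
  · exact isBundleIso_orientationDualIso EM EG M
  -- The criterion asks neither for units nor for products to be respected, only for inverse numbers
  -- at inverse arrows; hence it covers `g_♯` too.
  · exact intertwines_of_trEval EM EG M (fun χ _ => rawAction EM EG χ)
      (fun x y g a b a' b' => (arrowDet EM EG g a b a' b' : ℝˣ))
      (fun χ _ x y g a b a' b' v => trEval_rawAction EM EG χ g a b a' b' v)
      (fun x y g a b a' b' => by
        rw [← Units.val_mul, arrowDet_inv EM EG g a b a' b', Units.val_one])
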